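/- **Setting.** Let $d\ge 2$, $k\ge 0$ and write $x=(z,t)\in\mathbb R^{d-1}\times\mathbb R$. Let $\Omega_z\subseteq\mathbb R^{d-1}$ and $\Omega_t\subseteq\mathbb R$ be compact, $\Omega=\Omega_z\times\Omega_t$, $m_{\Omega_z}=\sup_{\omega\in\Omega_z}|\omega|_2$, $m_{\Omega_t}=\sup_{\omega\in\Omega_t}|\omega|$. Let $\mathrm B(\Omega)=\{f\in L^2(\mathbb R^d):\operatorname{supp}\hat f\subseteq\Omega\}$, where $\hat f(\omega)=\int f(x)e^{-i\omega\cdot x}\,dx$; each $f\in \mathrm B(\Omega)$ is identified with its smooth representative. Let $\Phi_\Omega(x)=(2\pi)^{-d}\int_\Omega e^{i\omega\cdot x}\,d\omega$. Let $|\cdot|_*$ be a norm on $\mathbb R^{d-1}$ and $b>0$ the smallest constant with $|z|_2\le b|z|_*$ for all $z$. Let $I$ be a countable index set, $\{z_n\}_{n\in I}\subseteq\mathbb R^{d-1}$, and for each $n\in I$ let $(t_{m,n})_{m\in\mathbb Z}$ be a strictly increasing real sequence. Put $$\delta_z=\sup_{z\in\mathbb R^{d-1}}\inf_{n\in I}|z-z_n|_*,\qquad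 \delta_t=\sup_{n\in I}\sup_{t\in\mathbb R}\inf_{m\in\mathbb Z}|t-t_{m,n}| .$$ Assume that the Voronoi cells $V_n=\{z:|z-z_n|_*\le|z-z_{n'}|_*\ \forall n'\in I\}$ form a partition of $\mathbb R^{d-1}$ up to Lebesgue null sets (their union is of full measure, and $V_n\cap V_{n'}$ is null for $n\ne n'$). For $\alpha\in\mathbb N_0^{d-1}$ let $$\mu_{m,n,\alpha}=\frac{t_{m+1,n}-t_{m-1,n}}{2\,\alpha!}\int_{V_n}(z-z_n)^{2\alpha}\,dz .$$ For $z>0$ let $R_k(z)=e^z-\sum_{r=0}^k z^r/r!$, $\sigma_d^*(z)=\frac{z+\sqrt{z(d+z)}}d$, $h_k(z)=e^zR_k(z)$, $g_{k,d}(z)=(1+2\sigma_d^*(z))^{d/2}e^{z/\sigma_d^*(z)}R_k(z)$ (and $h_k(0)=g_{k,d}(0)=0$), and let $H_k,G_{k,d}$ be the inverse functions of $h_k,g_{k,d}$ on $(0,\infty)$. For $j\ge1$ let $c_j>0$ be the smallest constant such that $\int_p^q|f|^2\le c_j^{2j}(q-p)^{2j}\int_p^q|f^{(j)}|^2$ for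 all $p<q$ and all $f\in H^j(p,q)$ for which $f,f',\dots,f^{(j-1)}$ all vanish at $p$, or all vanish at $q$. Let $$C(k,d)=\begin{cases}1/c_{k+1}& d=2,\\ \max\{H_k(1),G_{k,d}(1)\}& d\ge3.\end{cases}$$ **Proposition 3.8.** Suppose that $$\delta_t<\frac{2}{\pi m_{\Omega_t}},\qquad \delta_z<\frac{C(k,d)}{m_{\Omega_z}b}$$ (a right-hand side with zero denominator is read as $\infty$), and put $\theta=m_{\Omega_z}b\,\delta_z$. Then there are $A_z,B_z>0$ with $$A_z\ge e^{-1}\bigl(1-(c_{k+1}\theta)^{k+1}\bigr)^2,\qquad B_z\le(1+2\theta/\pi)^2e^{\theta^2}\qquad\text{if } d=2,$$ $$A_z\ge e^{-d}\bigl(1-\min\{h_k(\theta),g_{k,d}(\theta)\}\bigr)^2,\qquad B_z\le e^{2\theta+\theta^2}\qquad\text{if } d\ge3,$$ such that, for all $f\in\mathrm B(\Omega)$, $$\Bigl(1-\tfrac{2\delta_tm_{\Omega_t}}\pi\Bigr)^2A_z\|f\|^2\le\sum_{m\in\mathbb Z}\sum_{n\in I}\sum_{|\alpha|_1\le k}\mu_{m,n,\alpha}\,|D_z^\alpha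 f(z_n,t_{m,n})|^2\le\Bigl(1+\tfrac{2\delta_tm_{\Omega_t}}\pi\Bigr)^2B_z\|f\|^2 .$$ Equivalently, the functions $\sqrt{\mu_{m,n,\alpha}}\,D_z^\alpha\Phi_\Omega(\cdot-x_{n,m})$, with $x_{n,m}=(z_n,t_{m,n})$, $m\in\mathbb Z$, $n\in I$, $|\alpha|_1\le k$, belong to $\mathrm B(\Omega)$ and form a frame for $\mathrm B(\Omega)$ with frame bounds $(1-2\delta_tm_{\Omega_t}/\pi)^2A_z$ and $(1+2\delta_tm_{\Omega_t}/\pi)^2B_z$. -/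

import Mathlib

open MeasureTheory Set FourierTransform

noncomputable section

namespace LineSampling

/-- The spatial domain `ℝ^(d-1)` with its Euclidean structure. -/
abbrev Space (d : ℕ) : Type := EuclideanSpace ℝ (Fin (d - 1))

/-- Space-time `ℝ^d = ℝ^(d-1) × ℝ` with its Euclidean structure and Lebesgue measure. -/
abbrev SpaceTime (d : ℕ) : Type := WithLp 2 (Space d × ℝ)

/-- The point `x = (z, t)`. -/
def point {d : ℕ} (z : Space d) (t : ℝ) : SpaceTime d := WithLp.toLp 2 (z, t)

/-- The product band `Ω_z × Ω_t`. -/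
def productBand {d : ℕ} (Ωz : Set (Space d)) (Ωt : Set ℝ) : Set (SpaceTime d) :=
  {ω | ω.fst ∈ Ωz ∧ ω.snd ∈ Ωt}

section General

variable {E : Type*} [NormedAddCommGroup E] [InnerProductSpace ℝ E] [FiniteDimensional ℝ E]
  [MeasurableSpace E] [BorelSpace E]

/-- `B(Ω)`: the square-integrable functions whose (Plancherel) Fourier transform is supported in
`Ω`.  The frequency variable here is that of `∫ f(x) exp(-i ω·x) dx`, which is `2π` times
the frequency variable `ξ` of the transform `∫ f(x) exp(-2πi ξ·x) dx` used by Mathlib. -/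
def bandlimited (Ω : Set E) : Submodule ℂ (Lp (α := E) ℂ 2 volume) where
  carrier := {f | ∀ᵐ ξ : E, (2 * Real.pi) • ξ ∉ Ω →
    (𝓕 f : Lp (α := E) ℂ 2 volume) ξ = 0}
  zero_mem' := by
    have h0 : (𝓕 (0 : Lp (α := E) ℂ 2 volume) : Lp (α := E) ℂ 2 volume) = 0 :=
      (Lp.fourierTransformₗᵢ E ℂ).map_zero
    have h := Lp.coeFn_zero ℂ 2 (volume : Measure E)
    rw [mem_ofPred_eq, h0]
    filter_upwards [h] with ξ hξ _
    simp [hξ]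
  add_mem' := by
    intro f g hf hg
    have h0 : (𝓕 (f + g) : Lp (α := E) ℂ 2 volume) = 𝓕 f + 𝓕 g :=
      (Lp.fourierTransformₗᵢ E ℂ).map_add f g
    rw [mem_ofPred_eq] at hf hg ⊢
    rw [h0]
    filter_upwards [hf, hg, Lp.coeFn_add (𝓕 f : Lp (α := E) ℂ 2 volume) (𝓕 g)]
      with ξ h1 h2 h3 hξ
    rw [h3, Pi.add_apply, h1 hξ, h2 hξ, add_zero]
  smul_mem' := by
    intro c f hf
    have h0 : (𝓕 (c • f) : Lp (α := E) ℂ 2 volume) = c • 𝓕 f :=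
      (Lp.fourierTransformₗᵢ E ℂ).map_smul c f
    rw [mem_ofPred_eq] at hf ⊢
    rw [h0]
    filter_upwards [hf, Lp.coeFn_smul c (𝓕 f : Lp (α := E) ℂ 2 volume)] with ξ h1 h2 hξ
    rw [h2, Pi.smul_apply, h1 hξ, smul_zero]

/-- `Φ_Ω(x) = (2π)^(-dim) ∫_Ω exp(i ω·x) dω`. -/
def kernelPhi (Ω : Set E) (x : E) : ℂ :=
  ((2 * Real.pi : ℝ) : ℂ)⁻¹ ^ Module.finrank ℝ E *
    ∫ ω in Ω, Complex.exp (Complex.I * (inner ℝ ω x : ℝ))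

end General

/-- `m_Ω = sup_{ω ∈ Ω} |ω|₂` (equal to `0` for empty `Ω`). -/
def bandRadius {E : Type*} [Norm E] (Ω : Set E) : ℝ := sSup ((fun ω => ‖ω‖) '' Ω)

/-- The partial derivative `D^α = ∂₁^{α₁} ⋯ ∂ₙ^{αₙ}`. -/
def multiDeriv {n : ℕ} (α : Fin n → ℕ) (g : EuclideanSpace ℝ (Fin n) → ℂ) :
    EuclideanSpace ℝ (Fin n) → ℂ :=
  (List.finRange n).foldr
    (fun i u => (fun v x => lineDeriv ℝ v x (EuclideanSpace.single i 1))^[α i] u) g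

/-- The partial derivative `D_z^α f` in the spatial variables only. -/
def spatialDeriv {d : ℕ} (α : Fin (d - 1) → ℕ) (f : SpaceTime d → ℂ) (x : SpaceTime d) : ℂ :=
  multiDeriv α (fun z => f (point z x.snd)) x.fst

/-- Multi-indices in `n` variables of order at most `k`. -/
abbrev MultiIndex (n k : ℕ) : Type := {α : Fin n → ℕ // ∑ i, α i ≤ k}

/-- The optimal (smallest) constant `b` with `|x|₂ ≤ b |x|_*`. -/
def embedConst {n : ℕ} (N : Seminorm ℝ (EuclideanSpace ℝ (Fin n))) : ℝ :=
  sInf {b : ℝ | 0 < b ∧ ∀ x, ‖x‖ ≤ b * N x}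

/-- The Voronoi cell of the sampling point `z n` for the norm `N`. -/
def voronoi {p : ℕ} {I : Type*} (N : Seminorm ℝ (EuclideanSpace ℝ (Fin p)))
    (z : I → EuclideanSpace ℝ (Fin p)) (n : I) : Set (EuclideanSpace ℝ (Fin p)) :=
  {x | ∀ m, N (x - z n) ≤ N (x - z m)}

/-- `δ_z = sup_x inf_n |x - z_n|_*`, possibly infinite. -/
def spaceDensity {p : ℕ} {I : Type*} (N : Seminorm ℝ (EuclideanSpace ℝ (Fin p)))
    (z : I → EuclideanSpace ℝ (Fin p)) : ENNReal :=
  ⨆ x, ⨅ n, ENNReal.ofReal (N (x - z n))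

/-- `δ_t = sup_n sup_s inf_m |s - t_{m,n}|`, possibly infinite; `t n m` stands for `t_{m,n}`. -/
def timeDensity {I : Type*} (t : I → ℤ → ℝ) : ENNReal :=
  ⨆ n, ⨆ s : ℝ, ⨅ m, ENNReal.ofReal |s - t n m|

/-- The weight
`μ_{m,n,α} = (t_{m+1,n} - t_{m-1,n}) / (2 α!) * ∫_{V_n} (x - z_n)^{2α} dx`. -/
def weight {p : ℕ} {I : Type*} (N : Seminorm ℝ (EuclideanSpace ℝ (Fin p)))
    (z : I → EuclideanSpace ℝ (Fin p)) (t : I → ℤ → ℝ) (m : ℤ) (n : I) (α : Fin p → ℕ) : ℝ :=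
  (t n (m + 1) - t n (m - 1)) / (2 * ∏ i, ((α i).factorial : ℝ)) *
    ∫ x in voronoi N z n, ∏ i, (x i - z n i) ^ (2 * α i)

/-- The family `F 0, …, F k` consists of a function `F 0` in the Sobolev space `H^k(a,b)` (in its
continuous version on `[a,b]`) and of its derivatives: `F j` is absolutely continuous with
derivative `F (j+1)` for `j < k`, and `F k` is square-integrable. -/
structure IsSobolevJet (k : ℕ) (a b : ℝ) (F : ℕ → ℝ → ℂ) : Prop where
  memLp_top : MemLp (F k) 2 (volume.restrict (Icc a b))
  primitive : ∀ j < k, ∀ x ∈ Icc a b, F j x = F j a + ∫ s in a..x, F (j + 1) s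

/-- The minimal constant `c_k` in the higher-order Wirtinger inequality
`∫_a^b |f|² ≤ c_k^{2k} (b-a)^{2k} ∫_a^b |f^{(k)}|²` for `f ∈ H^k(a,b)` vanishing together with
its first `k-1` derivatives at `a`, or at `b`. -/
def wirtingerConst (k : ℕ) : ℝ :=
  sInf {c : ℝ | 0 < c ∧ ∀ a b : ℝ, a < b → ∀ F : ℕ → ℝ → ℂ, IsSobolevJet k a b F →
    ((∀ j < k, F j a = 0) ∨ (∀ j < k, F j b = 0)) →
    ∫ x in a..b, ‖F 0 x‖ ^ 2 ≤ c ^ (2 * k) * (b - a) ^ (2 * k) * ∫ x in a..b, ‖F k x‖ ^ 2}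

/-- `R_k(z) = exp z - ∑_{r ≤ k} z^r / r!`. -/
def expRemainder (k : ℕ) (z : ℝ) : ℝ :=
  Real.exp z - ∑ r ∈ Finset.range (k + 1), z ^ r / (r.factorial : ℝ)

/-- `σ*_d(z) = (z + √(z (d + z))) / d`. -/
def sigmaStar (d : ℕ) (z : ℝ) : ℝ := (z + Real.sqrt (z * (d + z))) / d

/-- `h_k(z) = exp(z) R_k(z)`. -/
def hFun (k : ℕ) (z : ℝ) : ℝ := Real.exp z * expRemainder k z

/-- `g_{k,d}(z) = (1 + 2 σ*_d(z))^{d/2} exp(z / σ*_d(z)) R_k(z)`. -/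
def gFun (k d : ℕ) (z : ℝ) : ℝ :=
  (1 + 2 * sigmaStar d z) ^ ((d : ℝ) / 2) * Real.exp (z / sigmaStar d z) * expRemainder k z

/-- The inverse function `H_k` of `h_k` on `(0, ∞)`. -/
def hInv (k : ℕ) : ℝ → ℝ := Function.invFunOn (hFun k) (Ioi 0)

/-- The inverse function `G_{k,d}` of `g_{k,d}` on `(0, ∞)`. -/
def gInv (k d : ℕ) : ℝ → ℝ := Function.invFunOn (gFun k d) (Ioi 0)

/-- The density constant `C(k,d)`. -/
def densityConst (k d : ℕ) : ℝ :=
  if d = 2 then 1 / wirtingerConst (k + 1) else max (hInv k 1) (gInv k d 1)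

/-- The lower spatial bound as a function of `θ = m_{Ω_z} b δ_z`. -/
def spatialLower (k d : ℕ) (θ : ℝ) : ℝ :=
  if d = 2 then Real.exp (-1) * (1 - (wirtingerConst (k + 1) * θ) ^ (k + 1)) ^ 2
  else Real.exp (-(d : ℝ)) * (1 - min (hFun k θ) (gFun k d θ)) ^ 2

/-- The upper spatial bound as a function of `θ = m_{Ω_z} b δ_z`. -/
def spatialUpper (d : ℕ) (θ : ℝ) : ℝ :=
  if d = 2 then (1 + 2 * θ / Real.pi) ^ 2 * Real.exp (θ ^ 2)
  else Real.exp (2 * θ + θ ^ 2)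

/-- `φ` is a frame for the inner product space `H` with frame bounds `A` and `B`. -/
structure IsFrameWithBounds {ι H : Type*} [NormedAddCommGroup H] [InnerProductSpace ℂ H]
    (φ : ι → H) (A B : ℝ) : Prop where
  lower_pos : 0 < A
  upper_pos : 0 < B
  summable : ∀ f : H, Summable fun i => ‖inner ℂ (φ i) f‖ ^ 2
  lower_le : ∀ f : H, A * ‖f‖ ^ 2 ≤ ∑' i, ‖inner ℂ (φ i) f‖ ^ 2
  le_upper : ∀ f : H, ∑' i, ‖inner ℂ (φ i) f‖ ^ 2 ≤ B * ‖f‖ ^ 2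

end LineSampling

end

open LineSampling

/-! Write `f` as the inverse Fourier integral of a square-integrable density `g` vanishing off the
compact set of frequencies `ξ` with `2πξ ∈ Ω`. Derivatives then become multiplications by
polynomials in `ξ`, and Plancherel turns bounds for these polynomials into Bernstein inequalities
with constants `m_{Ω_z}` and `m_{Ω_t}`. The weight `μ` is the length of a time cell between
midpoints times a moment of `V_n`, so the estimate separates into time and space.

Time: each `t ↦ D_z^α f(z_n, t)` is band-limited to `Ω_t`. Replace it by its sampled value on each
midpoint cell. Wirtinger's inequality with constant `2/π` on both halves of a cell, followed by
Bernstein, bounds the relative `L²` error by `2 δ_t m_{Ω_t} / π`; the triangle inequality gives the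
two time factors (`time_sampling`). What remains is `spatialForm`, the spatial sum with the samples
integrated over `t`.

Space, lower bound: on `V_n × ℝ` replace `f` by its Taylor polynomial of order `k` about `z_n`. If
the relative `L²` error is `η < 1`, the polynomials carry at least `(1 - η)²‖f‖²`, and
Cauchy–Schwarz with `∑ 1/α! ≤ e^(d-1)` bounds them by `e^(d-1)` times `spatialForm`
(`spatialForm_lower`). With `θ = m_{Ω_z} b δ_z`, two ways to obtain `η` are used. For `d = 2` the
cells are star-shaped subsets of a line, and Wirtinger's inequality of order `k + 1` gives `(c_{k+1}
θ)^(k+1)`. For `d ≥ 3` the Taylor tail is dominated by local maximal functions of the derivative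
tensors: an `L²` bound `κ` for the maximal function gives `η = κ R_k(θ)`
(`MaxBound.taylor_remainder_le`). Expanding in a Taylor series yields `κ = e^θ`, hence `h_k`;
averaging over balls first yields a bound at least as good as `g_{k,d}`.

Space, upper bound: on `V_n`, `(x - z_n)^(2α)` is at most `(bδ_z)^(2|α|)`, so it suffices to sample
values of each `D_z^α f`. This costs `(1 + 2θ/π)²` or `e^(2θ)`; summing over `α` on the frequency
side costs `e^(θ²)` (`spatialForm_upper`).

The frame statement is the same inequality: pairing `f` with an atom gives, up to sign, `√μ D_z^α
f(x_{n,m})`. -/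

noncomputable section

namespace LineSampling

set_option linter.unusedSectionVars false

/-! ### Inverse Fourier integrals of compactly supported densities; Plancherel. -/

section Synthesis

variable {V H : Type*} [NormedAddCommGroup V] [InnerProductSpace ℝ V] [FiniteDimensional ℝ V]
  [MeasurableSpace V] [BorelSpace V] [NormedAddCommGroup H] [InnerProductSpace ℂ H]

/-- Square-integrable frequency densities vanishing off `K`. -/
structure BandFun (K : Set V) (g : V → H) : Prop where
  memLp : MemLp g 2 volume
  zero_off : ∀ ξ ∉ K, g ξ = 0

variable {K : Set V} {g : V → H}

theorem BandFun.integrable (hK : IsCompact K) (hg : BandFun K g) : Integrable g :=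
  memLp_one_iff_integrable.1 (hg.memLp.mono_exponent_of_measure_support_ne_top hg.zero_off
    hK.measure_lt_top.ne (by norm_num))

/-- A continuous multiplier is bounded on the compact set `K` and irrelevant off it, so
differentiation and translation never leave the class. -/
theorem BandFun.smul (hK : IsCompact K) (hg : BandFun K g) {a : V → ℂ} (ha : Continuous a) :
    BandFun K (fun ξ => a ξ • g ξ) := by
  obtain ⟨C, hC⟩ := hK.exists_bound_of_continuousOn ha.continuousOn
  refine ⟨hg.memLp.of_le_mul (c := C) (ha.aestronglyMeasurable.smul hg.memLp.1)
    (.of_forall fun ξ => ?_), fun ξ hξ => by simp [hg.zero_off ξ hξ]⟩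
  by_cases hξ : ξ ∈ K
  · rw [norm_smul]
    exact mul_le_mul_of_nonneg_right (hC ξ hξ) (norm_nonneg _)
  · simp [hg.zero_off ξ hξ]

theorem BandFun.integrable_norm_pow (hK : IsCompact K) (hg : BandFun K g) (n : ℕ) :
    Integrable (fun ξ => ‖ξ‖ ^ n * ‖g ξ‖) := by
  have h := ((hg.smul hK (a := fun ξ => ((‖ξ‖ ^ n : ℝ) : ℂ)) (by fun_prop)).integrable hK).norm
  refine h.congr (.of_forall fun ξ => ?_)
  simp [norm_smul]

theorem contDiff_fourierInv [CompleteSpace H] (hK : IsCompact K) (hg : BandFun K g) :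
    ContDiff ℝ (⊤ : ℕ∞) (𝓕⁻ g) := by
  have h : 𝓕⁻ g = fun x => 𝓕 g (-x) := by
    ext x
    exact Real.fourierInv_eq_fourier_neg g x
  rw [h]
  exact (Real.contDiff_fourier fun n _ => hg.integrable_norm_pow hK n).comp contDiff_neg

theorem continuous_fourierInv [CompleteSpace H] (hK : IsCompact K) (hg : BandFun K g) :
    Continuous (𝓕⁻ g) :=
  (contDiff_fourierInv hK hg).continuous

/-- The symbol of the derivative in the direction `v`. -/
def dirSymbol (v ξ : V) : ℂ := 2 * Real.pi * Complex.I * (inner ℝ ξ v : ℝ)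

@[fun_prop]
theorem continuous_dirSymbol (v : V) : Continuous (dirSymbol v) := by
  unfold dirSymbol
  fun_prop

theorem norm_dirSymbol (v ξ : V) : ‖dirSymbol v ξ‖ = 2 * Real.pi * |inner ℝ ξ v| := by
  simp [dirSymbol, abs_of_pos Real.pi_pos]

theorem fourierChar_inner_add (ξ x y : V) :
    ((Real.fourierChar (inner ℝ ξ (x + y)) : Circle) : ℂ) =
      Complex.exp (dirSymbol y ξ) * (Real.fourierChar (inner ℝ ξ x) : Circle) := by
  rw [Real.fourierChar_apply, Real.fourierChar_apply, ← Complex.exp_add, dirSymbol, inner_add_right]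
  congr 1
  push_cast
  ring

theorem hasDerivAt_fourierInv [CompleteSpace H] (hK : IsCompact K) (hg : BandFun K g)
    (x v : V) (s : ℝ) :
    HasDerivAt (fun s : ℝ => 𝓕⁻ g (x + s • v))
      (𝓕⁻ (fun ξ => dirSymbol v ξ • g ξ) (x + s • v)) s := by
  have h1 := VectorFourier.hasFDerivAt_fourierIntegral (μ := volume) (-innerSL ℝ)
    (hg.integrable hK) (by simpa using hg.integrable_norm_pow hK 1) (x + s • v)
  have hl : HasDerivAt (fun s : ℝ => x + s • v) v s := by
    simpa using ((hasDerivAt_id s).smul_const v).const_add x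
  have h2 := h1.comp_hasDerivAt s hl
  refine h2.congr_deriv ?_
  rw [VectorFourier.fourierIntegral, ContinuousLinearMap.integral_apply]
  · rw [Real.fourierInv_eq]
    refine integral_congr_ae (.of_forall fun ξ => ?_)
    have e : -((-innerSL ℝ : V →L[ℝ] V →L[ℝ] ℝ) ξ (x + s • v)) = inner ℝ ξ (x + s • v) :=
      neg_neg _
    have key : -(2 * Real.pi * Complex.I) • ((-innerSL ℝ : V →L[ℝ] V →L[ℝ] ℝ) ξ v) • g ξ =
        dirSymbol v ξ • g ξ := by
      have e' : ((-innerSL ℝ : V →L[ℝ] V →L[ℝ] ℝ) ξ v) = -inner ℝ ξ v := rfl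
      rw [e', ← Complex.coe_smul (-inner ℝ ξ v), smul_smul, dirSymbol]
      congr 1
      push_cast
      ring
    change Real.fourierChar (-((-innerSL ℝ : V →L[ℝ] V →L[ℝ] ℝ) ξ (x + s • v))) •
      (-(2 * Real.pi * Complex.I) • ((-innerSL ℝ : V →L[ℝ] V →L[ℝ] ℝ) ξ v) • g ξ) = _
    rw [e, key]
  · refine (VectorFourier.fourierIntegral_convergent_iff Real.continuous_fourierChar ?_ _).2 ?_
    · exact (-innerSL ℝ : V →L[ℝ] V →L[ℝ] ℝ).continuous₂
    · refine (((hg.integrable_norm_pow hK 1)).const_mul (2 * Real.pi * ‖(-innerSL ℝ :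
        V →L[ℝ] V →L[ℝ] ℝ)‖)).mono' hg.memLp.1.fourierSMulRight (.of_forall fun ξ => ?_)
      refine (VectorFourier.norm_fourierSMulRight_le _ _ _).trans (le_of_eq ?_)
      ring

/-- Taylor expansion of a band-limited function. -/
theorem hasSum_fourierInv_add [CompleteSpace H] (hK : IsCompact K) (hg : BandFun K g) (x v : V) :
    HasSum (fun l : ℕ => 𝓕⁻ (fun ξ => (dirSymbol v ξ ^ l / (l.factorial : ℂ)) • g ξ) x)
      (𝓕⁻ g (x + v)) := by
  simp only [Real.fourierInv_eq]
  obtain ⟨C, hC⟩ := hK.exists_bound_of_continuousOn (continuous_dirSymbol v).continuousOn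
  refine hasSum_integral_of_dominated_convergence
    (fun l ξ => C ^ l / l.factorial * ‖g ξ‖) (fun l => ?_) (fun l => .of_forall fun ξ => ?_)
    (.of_forall fun ξ => ?_) ?_ (.of_forall fun ξ => ?_)
  · refine AEStronglyMeasurable.smul (𝕜 := Circle) ?_ ?_
    · exact (by fun_prop : Continuous fun ξ : V =>
        Real.fourierChar (inner ℝ ξ x)).aestronglyMeasurable
    · exact (by fun_prop : Continuous fun ξ : V =>
        dirSymbol v ξ ^ l / (l.factorial : ℂ)).aestronglyMeasurable.smul hg.memLp.1
  · rw [Circle.norm_smul, norm_smul]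
    by_cases hξ : ξ ∈ K
    · refine mul_le_mul_of_nonneg_right ?_ (norm_nonneg _)
      rw [norm_div, norm_pow, Complex.norm_natCast]
      have := hC ξ hξ
      gcongr
    · simp [hg.zero_off ξ hξ]
  · exact (Real.summable_pow_div_factorial C).mul_right _
  · simp_rw [tsum_mul_right]
    exact (hg.integrable hK).norm.const_mul _
  · simp only [Circle.smul_def, smul_smul]
    rw [fourierChar_inner_add, mul_comm (Complex.exp _)]
    refine HasSum.smul_const ?_ _
    refine HasSum.mul_left _ ?_
    rw [Complex.exp_eq_exp_ℂ]
    exact NormedSpace.expSeries_div_hasSum_exp (dirSymbol v ξ)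

theorem continuous_neg_innerₗ : Continuous fun p : V × V => (-innerₗ V) p.1 p.2 := by
  simp only [LinearMap.neg_apply, innerₗ_apply_apply]
  fun_prop

/-- The integral transform represents the Plancherel transform. -/
theorem fourierInv_toLp_ae [CompleteSpace H] (hg1 : Integrable g) (hg2 : MemLp g 2) :
    ((𝓕⁻ (hg2.toLp g) : Lp (α := V) H 2 volume) : V → H) =ᵐ[volume] 𝓕⁻ g := by
  have hcont : Continuous (𝓕⁻ g) :=
    VectorFourier.fourierIntegral_continuous (L := -innerₗ V) Real.continuous_fourierChar
      continuous_neg_innerₗ hg1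
  -- Both sides are tested against smooth compactly supported functions: the distributional
  -- definition moves the transform onto the test function, and Fubini moves it back onto `g`.
  refine ae_eq_of_integral_contDiff_smul_eq
    ((Lp.memLp _).locallyIntegrable (by norm_num)) hcont.locallyIntegrable fun φ hφ hφc => ?_
  have hφ1 : HasCompactSupport (Complex.ofRealCLM ∘ φ) := hφc.comp_left rfl
  have hφ2 : ContDiff ℝ (⊤ : ℕ∞) (Complex.ofRealCLM ∘ φ) := by fun_prop
  set ψ := hφ1.toSchwartzMap hφ2 with hψ
  have h1 := congrArg (fun T => T ψ) (Lp.fourierInv_toTemperedDistribution_eq (hg2.toLp g))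
  simp only [TemperedDistribution.fourierInv_apply, Lp.toTemperedDistribution_apply] at h1
  have h2 : ∫ x, φ x • (𝓕⁻ (hg2.toLp g) : Lp (α := V) H 2 volume) x =
      ∫ x, ψ x • (𝓕⁻ (hg2.toLp g) : Lp (α := V) H 2 volume) x := by
    refine integral_congr_ae (.of_forall fun x => ?_)
    simp [hψ]
  have h3 : ∫ x, φ x • 𝓕⁻ g x = ∫ x, ψ x • 𝓕⁻ g x := by
    refine integral_congr_ae (.of_forall fun x => ?_)
    simp [hψ]
  rw [h2, h3, ← h1]
  have h4 : ∫ x, (𝓕⁻ ψ) x • (hg2.toLp g) x = ∫ x, (𝓕⁻ ψ) x • g x := by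
    refine integral_congr_ae ?_
    filter_upwards [hg2.coeFn_toLp] with x hx
    rw [hx]
  rw [h4, SchwartzMap.fourierInv_coe]
  have h5 := VectorFourier.integral_fourierIntegral_smul_eq_flip (L := -innerₗ V) (μ := volume)
    (ν := volume) (f := ψ) (g := g) Real.continuous_fourierChar
    continuous_neg_innerₗ ψ.integrable hg1
  have hflip : (-innerₗ V).flip = -innerₗ V := by
    ext x y
    simp [real_inner_comm]
  rw [hflip] at h5
  exact h5

theorem eLpNorm_two_sq {X : Type*} [MeasurableSpace X] {μ : Measure X} (f : X → H) :
    eLpNorm f 2 μ ^ 2 = ∫⁻ x, ‖f x‖ₑ ^ 2 ∂μ := by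
  rw [eLpNorm_eq_lintegral_rpow_enorm_toReal (by norm_num) (by norm_num)]
  simp only [ENNReal.toReal_ofNat, ENNReal.rpow_ofNat]
  rw [← ENNReal.rpow_natCast, ← ENNReal.rpow_mul]
  norm_num

/-- Plancherel's identity. -/
theorem lintegral_fourierInv [CompleteSpace H] (hg1 : Integrable g) (hg2 : MemLp g 2) :
    ∫⁻ x, ‖𝓕⁻ g x‖ₑ ^ 2 = ∫⁻ ξ, ‖g ξ‖ₑ ^ 2 := by
  rw [← eLpNorm_two_sq, ← eLpNorm_two_sq, ← eLpNorm_congr_ae (fourierInv_toLp_ae hg1 hg2),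
    ← eLpNorm_congr_ae hg2.coeFn_toLp]
  have h : ‖(𝓕⁻ (hg2.toLp g) : Lp (α := V) H 2 volume)‖ₑ = ‖hg2.toLp g‖ₑ := by
    rw [← ofReal_norm, ← ofReal_norm]
    congr 1
    exact (Lp.fourierTransformₗᵢ V H).symm.norm_map _
  rw [Lp.enorm_def, Lp.enorm_def] at h
  rw [h]

theorem BandFun.lintegral_lt_top (hg : BandFun K g) : ∫⁻ ξ, ‖g ξ‖ₑ ^ 2 ≠ ⊤ := by
  rw [← eLpNorm_two_sq]
  exact ENNReal.pow_ne_top hg.memLp.2.ne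

/-- Together with `lintegral_fourierInv` this is Bernstein's inequality: a derivative costs the
supremum of its symbol on `K`. -/
theorem BandFun.lintegral_smul_le (hg : BandFun K g) {a : V → ℂ} {C : ℝ}
    (ha : ∀ ξ ∈ K, ‖a ξ‖ ≤ C) :
    ∫⁻ ξ, ‖a ξ • g ξ‖ₑ ^ 2 ≤ ENNReal.ofReal C ^ 2 * ∫⁻ ξ, ‖g ξ‖ₑ ^ 2 := by
  rw [← lintegral_const_mul' _ _ (by finiteness)]
  refine lintegral_mono fun ξ => ?_
  by_cases hξ : ξ ∈ K
  · rw [enorm_smul, mul_pow]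
    gcongr
    rw [← ofReal_norm]
    exact ENNReal.ofReal_le_ofReal (ha ξ hξ)
  · simp [hg.zero_off ξ hξ]

end Synthesis

/-! ### Symbols of the spatial derivatives. -/

section SpaceTimeSymbols

variable {d : ℕ}

theorem inner_point (ξ : SpaceTime d) (z : Space d) (t : ℝ) :
    inner ℝ ξ (point z t) = inner ℝ ξ.fst z + ξ.snd * t := by
  simp [point, WithLp.prod_inner_apply, mul_comm]

theorem point_add (z h : Space d) (t s : ℝ) : point (z + h) (t + s) = point z t + point h s := rfl

theorem point_smul (s : ℝ) (z : Space d) (t : ℝ) : point (s • z) (s * t) = s • point z t := rfl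

theorem point_add_smul (z v : Space d) (t s : ℝ) :
    point (z + s • v) t = point z t + s • point v 0 := by
  rw [← point_smul, ← point_add, mul_zero, add_zero]

theorem point_add_smul_time (z : Space d) (t s : ℝ) :
    point z (t + s) = point z t + s • point 0 1 := by
  rw [← point_smul, ← point_add, smul_zero, add_zero, mul_one]

@[fun_prop]
theorem continuous_point : Continuous fun q : Space d × ℝ => point q.1 q.2 :=
  WithLp.prod_continuous_toLp 2 _ _

theorem lintegral_spaceTime (f : SpaceTime d → ENNReal) :
    ∫⁻ x, f x = ∫⁻ q : Space d × ℝ, f (point q.1 q.2) :=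
  ((WithLp.volume_preserving_toLp (Space d) ℝ).lintegral_comp_emb
    (MeasurableEquiv.toLp 2 (Space d × ℝ)).measurableEmbedding f).symm

/-- The symbol of the spatial derivative `D_z^α`. -/
def spatialSymbol (α : Fin (d - 1) → ℕ) (ξ : SpaceTime d) : ℂ :=
  ∏ i, dirSymbol (point (EuclideanSpace.single i 1) 0) ξ ^ α i

@[fun_prop]
theorem continuous_spatialSymbol (α : Fin (d - 1) → ℕ) :
    Continuous (spatialSymbol α : SpaceTime d → ℂ) := by
  unfold spatialSymbol
  fun_prop

theorem dirSymbol_point_space (v : Space d) (ξ : SpaceTime d) :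
    dirSymbol (point v 0) ξ = 2 * Real.pi * Complex.I * (inner ℝ ξ.fst v : ℝ) := by
  rw [dirSymbol, inner_point]
  simp

theorem dirSymbol_point_single (i : Fin (d - 1)) (ξ : SpaceTime d) :
    dirSymbol (point (EuclideanSpace.single i 1) 0) ξ =
      2 * Real.pi * Complex.I * (ξ.fst i : ℝ) := by
  rw [dirSymbol_point_space]
  simp [EuclideanSpace.inner_single_right]

theorem dirSymbol_point_eq_sum (v : Space d) (ξ : SpaceTime d) :
    dirSymbol (point v 0) ξ =
      ∑ i, (v i : ℂ) * dirSymbol (point (EuclideanSpace.single i 1) 0) ξ := by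
  simp_rw [dirSymbol_point_single]
  rw [dirSymbol_point_space, PiLp.inner_apply]
  push_cast
  rw [Finset.mul_sum]
  refine Finset.sum_congr rfl fun i _ => ?_
  simp
  ring

variable {K : Set (SpaceTime d)} {g : SpaceTime d → ℂ}

theorem lineDeriv_fourierInv_point (hK : IsCompact K) (hg : BandFun K g) (z v : Space d) (t : ℝ) :
    lineDeriv ℝ (fun z => 𝓕⁻ g (point z t)) z v =
      𝓕⁻ (fun ξ => dirSymbol (point v 0) ξ • g ξ) (point z t) := by
  have h := hasDerivAt_fourierInv hK hg (point z t) (point v 0) 0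
  simp only [← point_add_smul] at h
  rw [lineDeriv, h.deriv]
  simp

theorem iterate_lineDeriv_fourierInv_point (hK : IsCompact K) (hg : BandFun K g) (v : Space d)
    (t : ℝ) (n : ℕ) :
    (fun (u : Space d → ℂ) x => lineDeriv ℝ u x v)^[n] (fun z => 𝓕⁻ g (point z t)) =
      fun z => 𝓕⁻ (fun ξ => dirSymbol (point v 0) ξ ^ n • g ξ) (point z t) := by
  induction n with
  | zero => simp
  | succ n ih =>
    rw [Function.iterate_succ_apply', ih]
    ext z
    rw [lineDeriv_fourierInv_point hK (hg.smul hK (by fun_prop))]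
    simp only [smul_smul, pow_succ']

/-- Each directional derivative contributes one factor to the symbol; induction along the list of
coordinates collects them into `spatialSymbol`. -/
theorem spatialDeriv_fourierInv (hK : IsCompact K) (hg : BandFun K g) (α : Fin (d - 1) → ℕ)
    (x : SpaceTime d) :
    spatialDeriv α (𝓕⁻ g) x = 𝓕⁻ (fun ξ => spatialSymbol α ξ • g ξ) x := by
  have key : ∀ L : List (Fin (d - 1)),
      (L.foldr (fun i u => (fun v x => lineDeriv ℝ v x (EuclideanSpace.single i 1))^[α i] u)
        (fun z : Space d => 𝓕⁻ g (point z x.snd))) =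
      fun z => 𝓕⁻ (fun ξ => (L.map fun i =>
        dirSymbol (point (EuclideanSpace.single i 1) 0) ξ ^ α i).prod • g ξ) (point z x.snd) := by
    intro L
    induction L with
    | nil => simp
    | cons i L ih =>
      rw [List.foldr_cons, ih]
      have hc : Continuous fun ξ : SpaceTime d => (L.map fun i =>
          dirSymbol (point (EuclideanSpace.single i 1) 0) ξ ^ α i).prod := by
        refine continuous_list_prod _ fun i _ => ?_
        fun_prop
      rw [iterate_lineDeriv_fourierInv_point hK (hg.smul hK hc)]
      simp only [List.map_cons, List.prod_cons, smul_smul]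
  have h := congrFun (key (List.finRange (d - 1))) x.fst
  rw [spatialDeriv, multiDeriv, h]
  have hs : ∀ ξ : SpaceTime d, ((List.finRange (d - 1)).map fun i =>
      dirSymbol (point (EuclideanSpace.single i 1) 0) ξ ^ α i).prod = spatialSymbol α ξ := by
    intro ξ
    rw [← List.ofFn_eq_map, List.prod_ofFn, spatialSymbol]
  simp_rw [hs]
  rfl

end SpaceTimeSymbols

/-! ### Triangle inequalities in `L²`, phrased for extended nonnegative integrals. -/

section ENNRealTools

variable {X : Type*} [MeasurableSpace X]

/-- Minkowski's inequality for series of functions with `L²` norms at most `c l * √A`. -/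
theorem lintegral_tsum_sq_le {μ : Measure X} {f : ℕ → X → ENNReal} (hf : ∀ l, AEMeasurable (f l) μ)
    {c : ℕ → ENNReal} {A : ENNReal} (h : ∀ l, ∫⁻ x, f l x ^ 2 ∂μ ≤ c l ^ 2 * A) :
    ∫⁻ x, (∑' l, f l x) ^ 2 ∂μ ≤ (∑' l, c l) ^ 2 * A := by
  have h1 : ∀ x, (∑' l, f l x) ^ 2 = ∑' l, ∑' j, f l x * f j x := by
    intro x
    rw [sq, ← ENNReal.tsum_mul_right]
    simp_rw [ENNReal.tsum_mul_left]
  have h2 : (∑' l, c l) ^ 2 * A = ∑' l, ∑' j, c l * c j * A := by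
    rw [sq, ← ENNReal.tsum_mul_right, ← ENNReal.tsum_mul_right]
    refine tsum_congr fun l => ?_
    rw [← ENNReal.tsum_mul_left, ← ENNReal.tsum_mul_right]
  simp_rw [h1]
  rw [h2, lintegral_tsum fun l => AEMeasurable.tsum fun j => (hf l).fun_mul (hf j)]
  refine ENNReal.tsum_le_tsum fun l => ?_
  rw [lintegral_tsum fun j => (hf l).fun_mul (hf j)]
  refine ENNReal.tsum_le_tsum fun j => ?_
  refine (ENNReal.lintegral_mul_le_Lp_mul_Lq μ Real.HolderConjugate.two_two (hf l) (hf j)).trans ?_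
  have hs : ∀ i, (∫⁻ x, f i x ^ (2 : ℝ) ∂μ) ^ (1 / 2 : ℝ) ≤ c i * A ^ (1 / 2 : ℝ) := by
    intro i
    have := ENNReal.rpow_le_rpow (h i) (by norm_num : (0 : ℝ) ≤ 1 / 2)
    rw [ENNReal.mul_rpow_of_nonneg _ _ (by norm_num), ← ENNReal.rpow_natCast,
      ← ENNReal.rpow_mul] at this
    simpa using this
  calc _ ≤ (c l * A ^ (1 / 2 : ℝ)) * (c j * A ^ (1 / 2 : ℝ)) := mul_le_mul' (hs l) (hs j)
    _ = c l * c j * (A ^ (1 / 2 : ℝ) * A ^ (1 / 2 : ℝ)) := by ring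
    _ = c l * c j * A := by
      rw [← ENNReal.rpow_add_of_nonneg _ _ (by norm_num) (by norm_num)]
      norm_num

/-- The optimal choice is `ε = c / b`, for which the right-hand side is `(b + c)²`. Adding `η / 2`
to `b` and `c` avoids dividing by zero. -/
theorem sqrt_le_add_of_forall {a b c : ℝ} (hb : 0 ≤ b) (hc : 0 ≤ c)
    (h : ∀ ε : ℝ, 0 < ε → a ^ 2 ≤ (1 + ε) * b ^ 2 + (1 + 1 / ε) * c ^ 2) : a ≤ b + c := by
  refine le_of_forall_pos_le_add fun η hη => ?_
  have hb' : 0 < b + η / 2 := by positivity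
  have hc' : 0 < c + η / 2 := by positivity
  have h1 := h ((c + η / 2) / (b + η / 2)) (by positivity)
  have h2 : a ^ 2 ≤ (b + η / 2 + (c + η / 2)) ^ 2 := by
    refine h1.trans ?_
    calc _ ≤ (1 + (c + η / 2) / (b + η / 2)) * (b + η / 2) ^ 2 +
          (1 + 1 / ((c + η / 2) / (b + η / 2))) * (c + η / 2) ^ 2 := by
          gcongr <;> linarith
      _ = _ := by field_simp; ring
  have := abs_le_of_sq_le_sq' h2 (by positivity)
  linarith [this.2]

/-- The triangle inequality in the form that a family of Young inequalities provides. -/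
theorem toReal_sqrt_le_of_forall {A D Q : ENNReal} (hD : D ≠ ⊤) (hQ : Q ≠ ⊤)
    (h : ∀ ε : ℝ, 0 < ε → A ≤ ENNReal.ofReal (1 + ε) * D + ENNReal.ofReal (1 + 1 / ε) * Q) :
    √A.toReal ≤ √D.toReal + √Q.toReal := by
  refine sqrt_le_add_of_forall (by positivity) (by positivity) fun ε hε => ?_
  rw [Real.sq_sqrt (by positivity), Real.sq_sqrt (by positivity), Real.sq_sqrt (by positivity)]
  have h1 := ENNReal.toReal_mono (by finiteness) (h ε hε)
  rw [ENNReal.toReal_add (by finiteness) (by finiteness), ENNReal.toReal_mul, ENNReal.toReal_mul,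
    ENNReal.toReal_ofReal (by positivity), ENNReal.toReal_ofReal (by positivity)] at h1
  exact h1

/-- `A` and `Q` are squared norms and `D` is the squared distance, so `h1` and `h2` encode the
triangle inequality in both directions: `√Q` lies within `√D ≤ η√A` of `√A`. Finiteness of `Q` comes
out of `h2`. -/
theorem perturbed_bounds {A D Q : ENNReal} {η : ℝ} (hη : 0 ≤ η) (hA : A ≠ ⊤)
    (hD : D ≤ ENNReal.ofReal (η ^ 2) * A)
    (h1 : ∀ ε : ℝ, 0 < ε → A ≤ ENNReal.ofReal (1 + ε) * D + ENNReal.ofReal (1 + 1 / ε) * Q)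
    (h2 : ∀ ε : ℝ, 0 < ε → Q ≤ ENNReal.ofReal (1 + ε) * D + ENNReal.ofReal (1 + 1 / ε) * A) :
    (η ≤ 1 → ENNReal.ofReal ((1 - η) ^ 2) * A ≤ Q) ∧ Q ≤ ENNReal.ofReal ((1 + η) ^ 2) * A := by
  have hDt : D ≠ ⊤ := ne_top_of_le_ne_top (by finiteness) hD
  have hQt : Q ≠ ⊤ := ne_top_of_le_ne_top (by finiteness) (h2 1 one_pos)
  have h3 := toReal_sqrt_le_of_forall hDt hQt h1
  have h4 := toReal_sqrt_le_of_forall hDt hA h2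
  have h5 : √D.toReal ≤ η * √A.toReal := by
    have := ENNReal.toReal_mono (by finiteness) hD
    rw [ENNReal.toReal_mul, ENNReal.toReal_ofReal (by positivity)] at this
    calc √D.toReal ≤ √(η ^ 2 * A.toReal) := Real.sqrt_le_sqrt this
      _ = η * √A.toReal := by rw [Real.sqrt_mul (by positivity), Real.sqrt_sq hη]
  have hAe : A = ENNReal.ofReal (√A.toReal ^ 2) := by
    rw [Real.sq_sqrt (by positivity), ENNReal.ofReal_toReal hA]
  have hQe : Q = ENNReal.ofReal (√Q.toReal ^ 2) := by
    rw [Real.sq_sqrt (by positivity), ENNReal.ofReal_toReal hQt]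
  constructor
  · intro hη1
    rw [hAe, hQe, ← ENNReal.ofReal_mul (by positivity), ← mul_pow]
    refine ENNReal.ofReal_le_ofReal (pow_le_pow_left₀ ?_ (by linarith) 2)
    exact mul_nonneg (by linarith) (by positivity)
  · rw [hAe, hQe, ← ENNReal.ofReal_mul (by positivity), ← mul_pow]
    exact ENNReal.ofReal_le_ofReal (pow_le_pow_left₀ (by positivity) (by linarith) 2)

theorem enorm_sq_le_young (a b : ℂ) {ε : ℝ} (hε : 0 < ε) :
    ‖a‖ₑ ^ 2 ≤ ENNReal.ofReal (1 + ε) * ‖a - b‖ₑ ^ 2 + ENNReal.ofReal (1 + 1 / ε) * ‖b‖ₑ ^ 2 := by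
  simp only [← ofReal_norm]
  rw [← ENNReal.ofReal_pow (by positivity), ← ENNReal.ofReal_pow (by positivity),
    ← ENNReal.ofReal_pow (by positivity), ← ENNReal.ofReal_mul (by positivity),
    ← ENNReal.ofReal_mul (by positivity), ← ENNReal.ofReal_add (by positivity) (by positivity)]
  refine ENNReal.ofReal_le_ofReal ?_
  have h1 : ‖a‖ ≤ ‖a - b‖ + ‖b‖ := by simpa using norm_add_le (a - b) b
  have h2 : (‖a - b‖ + ‖b‖) ^ 2 ≤ (1 + ε) * ‖a - b‖ ^ 2 + (1 + 1 / ε) * ‖b‖ ^ 2 := by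
    have : (1 + ε) * ‖a - b‖ ^ 2 + (1 + 1 / ε) * ‖b‖ ^ 2 - (‖a - b‖ + ‖b‖) ^ 2 =
        (ε * ‖a - b‖ - ‖b‖) ^ 2 / ε := by field_simp; ring
    have : 0 ≤ (ε * ‖a - b‖ - ‖b‖) ^ 2 / ε := by positivity
    linarith
  exact (pow_le_pow_left₀ (norm_nonneg _) h1 2).trans h2

theorem tsum_lintegral_young {I : Type*} (μ : I → Measure X) {f g : I → X → ℂ}
    (hf : ∀ n, Measurable (f n)) (hg : ∀ n, Measurable (g n)) {ε : ℝ} (hε : 0 < ε) :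
    ∑' n, ∫⁻ x, ‖f n x‖ₑ ^ 2 ∂μ n ≤
      ENNReal.ofReal (1 + ε) * ∑' n, ∫⁻ x, ‖f n x - g n x‖ₑ ^ 2 ∂μ n +
        ENNReal.ofReal (1 + 1 / ε) * ∑' n, ∫⁻ x, ‖g n x‖ₑ ^ 2 ∂μ n := by
  rw [← ENNReal.tsum_mul_left, ← ENNReal.tsum_mul_left, ← ENNReal.tsum_add]
  refine ENNReal.tsum_le_tsum fun n => ?_
  rw [← lintegral_const_mul' _ _ (by finiteness), ← lintegral_const_mul' _ _ (by finiteness),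
    ← lintegral_add_left (by have := hf n; have := hg n; fun_prop)]
  exact lintegral_mono fun x => enorm_sq_le_young _ _ hε

/-- If `g` approximates `f` up to the relative error `η`, the square norms are comparable. -/
theorem tsum_lintegral_perturbed {I : Type*} (μ : I → Measure X) {f g : I → X → ℂ}
    (hf : ∀ n, Measurable (f n)) (hg : ∀ n, Measurable (g n)) {η : ℝ} (hη : 0 ≤ η) {A : ENNReal}
    (hA : A ≠ ⊤) (hfA : ∑' n, ∫⁻ x, ‖f n x‖ₑ ^ 2 ∂μ n = A)
    (hD : ∑' n, ∫⁻ x, ‖f n x - g n x‖ₑ ^ 2 ∂μ n ≤ ENNReal.ofReal (η ^ 2) * A) :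
    (η ≤ 1 → ENNReal.ofReal ((1 - η) ^ 2) * A ≤ ∑' n, ∫⁻ x, ‖g n x‖ₑ ^ 2 ∂μ n) ∧
      ∑' n, ∫⁻ x, ‖g n x‖ₑ ^ 2 ∂μ n ≤ ENNReal.ofReal ((1 + η) ^ 2) * A := by
  subst hfA
  refine perturbed_bounds hη hA hD (fun ε hε => tsum_lintegral_young μ hf hg hε) fun ε hε => ?_
  have h := tsum_lintegral_young μ hg hf hε
  simp_rw [← enorm_neg (g _ _ - f _ _), neg_sub] at h
  exact h

end ENNRealTools

/-! ### Wirtinger inequalities and one-dimensional Taylor remainders. -/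

section Wirtinger

/-- The higher-order Wirtinger inequality with constant `c`, for smooth functions. -/
def SmoothWirtinger (c : ℝ) (n : ℕ) : Prop :=
  ∀ a b : ℝ, a < b → ∀ F : ℕ → ℝ → ℂ, (∀ j < n, ∀ x, HasDerivAt (F j) (F (j + 1) x) x) →
    Continuous (F n) → ((∀ j < n, F j a = 0) ∨ (∀ j < n, F j b = 0)) →
    ∫ x in a..b, ‖F 0 x‖ ^ 2 ≤ c ^ (2 * n) * (b - a) ^ (2 * n) * ∫ x in a..b, ‖F n x‖ ^ 2

/-- Integrate `0 ≤ |u' - w u|²`. By the Riccati equation for `w`, the derivative of `|u|² w` is at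
most `|u'|² - κ²|u|²`, and its integral vanishes by the boundary condition. -/
theorem wirtinger_of_riccati {a b κ : ℝ} (hab : a ≤ b) {u u' : ℝ → ℂ} {w : ℝ → ℝ}
    (hu : ∀ x, HasDerivAt u (u' x) x) (hu' : Continuous u')
    (hw : ∀ x ∈ Icc a b, HasDerivAt w (-κ ^ 2 - w x ^ 2) x)
    (hbd : ‖u b‖ ^ 2 * w b = ‖u a‖ ^ 2 * w a) :
    κ ^ 2 * ∫ x in a..b, ‖u x‖ ^ 2 ≤ ∫ x in a..b, ‖u' x‖ ^ 2 := by
  have huc : Continuous u := continuous_iff_continuousAt.2 fun x => (hu x).continuousAt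
  have hwc : ContinuousOn w (uIcc a b) := by
    rw [uIcc_of_le hab]
    exact fun x hx => (hw x hx).continuousAt.continuousWithinAt
  set p : ℝ → ℝ := fun x => 2 * inner ℝ (u x) (u' x) * w x + ‖u x‖ ^ 2 * (-κ ^ 2 - w x ^ 2)
  have hp : ∫ x in a..b, p x = 0 := by
    rw [intervalIntegral.integral_eq_sub_of_hasDerivAt (f := fun x => ‖u x‖ ^ 2 * w x)]
    · rw [hbd, sub_self]
    · intro x hx
      rw [uIcc_of_le hab] at hx
      exact (hu x).norm_sq.mul (hw x hx)
    · apply ContinuousOn.intervalIntegrable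
      fun_prop
  have hi1 : IntervalIntegrable (fun x => ‖u' x‖ ^ 2) volume a b :=
    (by fun_prop : Continuous fun x => ‖u' x‖ ^ 2).intervalIntegrable _ _
  have hi2 : IntervalIntegrable (fun x => ‖u x‖ ^ 2) volume a b :=
    (by fun_prop : Continuous fun x => ‖u x‖ ^ 2).intervalIntegrable _ _
  have hle : ∫ x in a..b, p x ≤ ∫ x in a..b, (‖u' x‖ ^ 2 - κ ^ 2 * ‖u x‖ ^ 2) := by
    refine intervalIntegral.integral_mono_on hab ?_ (hi1.sub (hi2.const_mul _)) fun x _ => ?_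
    · apply ContinuousOn.intervalIntegrable
      fun_prop
    · have h := sq_nonneg ‖u' x - w x • u x‖
      rw [norm_sub_sq_real, inner_smul_right, norm_smul, mul_pow, Real.norm_eq_abs, sq_abs,
        real_inner_comm] at h
      simp only [p]
      linarith
  rw [hp, intervalIntegral.integral_sub hi1 (hi2.const_mul _),
    intervalIntegral.integral_const_mul] at hle
  linarith

theorem hasDerivAt_tan_affine {κ x y : ℝ} (h : Real.cos (κ * (x - y)) ≠ 0) :
    HasDerivAt (fun x => -κ * Real.tan (κ * (x - y)))
      (-κ ^ 2 - (-κ * Real.tan (κ * (x - y))) ^ 2) x := by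
  have h1 : HasDerivAt (fun x => κ * (x - y)) κ x := by
    simpa using ((hasDerivAt_id x).sub_const y).const_mul κ
  refine (((Real.hasDerivAt_tan h).comp x h1).const_mul (-κ)).congr_deriv ?_
  rw [Real.tan_eq_sin_div_cos]
  field_simp
  linear_combination κ ^ 2 * Real.sin_sq_add_cos_sq (κ * (x - y))

/-- The Riccati solution is `w = -κ tan(κ(x - y))`, with `y` the endpoint where `u` is not assumed
to vanish: at that end `w = 0`, at the other `u = 0`. It is regular on the closed interval for `κ <
π / (2(b - a))`, and the constant follows by letting `κ` tend to this value. -/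
theorem smoothWirtinger_two_div_pi : SmoothWirtinger (2 / Real.pi) 1 := by
  intro a b hab F hF hFc hbd
  have hL : 0 < b - a := sub_pos.2 hab
  have hπ := Real.pi_pos
  have key : ∀ κ : ℝ, 0 ≤ κ → κ * (b - a) < Real.pi / 2 →
      κ ^ 2 * ∫ x in a..b, ‖F 0 x‖ ^ 2 ≤ ∫ x in a..b, ‖F 1 x‖ ^ 2 := by
    intro κ hκ hκL
    have hcos : ∀ x ∈ Icc a b, ∀ y ∈ Icc a b, Real.cos (κ * (x - y)) ≠ 0 := by
      intro x hx y hy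
      have h1 : |κ * (x - y)| ≤ κ * (b - a) := by
        rw [abs_mul, abs_of_nonneg hκ]
        exact mul_le_mul_of_nonneg_left (abs_le.2 ⟨by linarith [hx.1, hy.2], by
          linarith [hx.2, hy.1]⟩) hκ
      have h2 := abs_lt.1 (h1.trans_lt hκL)
      exact (Real.cos_pos_of_mem_Ioo ⟨by linarith [h2.1], h2.2⟩).ne'
    rcases hbd with h | h
    · refine wirtinger_of_riccati hab.le (hF 0 one_pos) hFc
        (fun x hx => hasDerivAt_tan_affine (hcos x hx b (right_mem_Icc.2 hab.le))) ?_
      simp [h 0 one_pos]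
    · refine wirtinger_of_riccati hab.le (hF 0 one_pos) hFc
        (fun x hx => hasDerivAt_tan_affine (hcos x hx a (left_mem_Icc.2 hab.le))) ?_
      simp [h 0 one_pos]
  set I0 := ∫ x in a..b, ‖F 0 x‖ ^ 2
  set I1 := ∫ x in a..b, ‖F 1 x‖ ^ 2
  have hlim : (Real.pi / (2 * (b - a))) ^ 2 * I0 ≤ I1 := by
    have ht : Filter.Tendsto (fun κ : ℝ => κ ^ 2 * I0)
        (nhdsWithin (Real.pi / (2 * (b - a))) (Iio (Real.pi / (2 * (b - a)))))
        (nhds ((Real.pi / (2 * (b - a))) ^ 2 * I0)) :=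
      ((by fun_prop : Continuous fun κ : ℝ => κ ^ 2 * I0).tendsto _).mono_left nhdsWithin_le_nhds
    refine le_of_tendsto ht ?_
    have hpos : 0 < Real.pi / (2 * (b - a)) := by positivity
    filter_upwards [Ioo_mem_nhdsLT hpos] with κ hκ
    refine key κ hκ.1.le ?_
    calc κ * (b - a) < Real.pi / (2 * (b - a)) * (b - a) := by gcongr; exact hκ.2
      _ = Real.pi / 2 := by field_simp
  calc I0 = (2 / Real.pi) ^ (2 * 1) * (b - a) ^ (2 * 1) *
        ((Real.pi / (2 * (b - a))) ^ 2 * I0) := by rw [mul_one]; field_simp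
    _ ≤ _ := by gcongr

theorem isSobolevJet_of_hasDerivAt {n : ℕ} {F : ℕ → ℝ → ℂ}
    (hF : ∀ j < n, ∀ x, HasDerivAt (F j) (F (j + 1) x) x) (hFc : Continuous (F n)) (a b : ℝ) :
    IsSobolevJet n a b F := by
  have hc : ∀ j ≤ n, Continuous (F j) := by
    intro j hj
    rcases hj.eq_or_lt with rfl | hj
    · exact hFc
    · exact continuous_iff_continuousAt.2 fun x => (hF j hj x).continuousAt
  refine ⟨?_, fun j hj x hx => ?_⟩
  · obtain ⟨C, hC⟩ := isCompact_Icc.exists_bound_of_continuousOn (s := Icc a b) hFc.continuousOn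
    exact MemLp.of_bound hFc.aestronglyMeasurable C
      ((ae_restrict_iff' measurableSet_Icc).2 (.of_forall hC))
  · rw [intervalIntegral.integral_eq_sub_of_hasDerivAt (fun y _ => hF j hj y)
      ((hc (j + 1) hj).intervalIntegrable _ _)]
    ring

/-- For fixed data the admissible constants form a closed set, so the infimum is admissible as well.
The hypothesis `≠ 0` excludes an empty set of constants, whose `sInf` is `0` by convention. -/
theorem smoothWirtinger_wirtingerConst {n : ℕ} (h : wirtingerConst n ≠ 0) :
    SmoothWirtinger (wirtingerConst n) n := by
  intro a b hab F hF hFc hbd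
  set S : Set ℝ := {c : ℝ | 0 < c ∧ ∀ a b : ℝ, a < b → ∀ F : ℕ → ℝ → ℂ, IsSobolevJet n a b F →
    ((∀ j < n, F j a = 0) ∨ (∀ j < n, F j b = 0)) →
    ∫ x in a..b, ‖F 0 x‖ ^ 2 ≤ c ^ (2 * n) * (b - a) ^ (2 * n) * ∫ x in a..b, ‖F n x‖ ^ 2} with hS
  have hw : wirtingerConst n = sInf S := rfl
  have hne : S.Nonempty := by
    by_contra he
    rw [not_nonempty_iff_eq_empty] at he
    exact h (by rw [hw, he, Real.sInf_empty])
  have hbdd : BddBelow S := ⟨0, fun c hc => hc.1.le⟩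
  have hmem : sInf S ∈ closure S := csInf_mem_closure hne hbdd
  have hclosed : IsClosed {c : ℝ | ∫ x in a..b, ‖F 0 x‖ ^ 2 ≤
      c ^ (2 * n) * (b - a) ^ (2 * n) * ∫ x in a..b, ‖F n x‖ ^ 2} :=
    isClosed_le continuous_const (by fun_prop)
  rw [hw]
  exact hclosed.closure_subset_iff.2
    (fun c hc => hc.2 a b hab F (isSobolevJet_of_hasDerivAt hF hFc a b) hbd) hmem

theorem wirtingerConst_nonneg (n : ℕ) : 0 ≤ wirtingerConst n :=
  Real.sInf_nonneg fun _ hc => hc.1.le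

theorem lintegral_Icc_enorm_sq {a b : ℝ} (hab : a ≤ b) {f : ℝ → ℂ} (hf : Continuous f) :
    ∫⁻ x in Icc a b, ‖f x‖ₑ ^ 2 = ENNReal.ofReal (∫ x in a..b, ‖f x‖ ^ 2) := by
  rw [intervalIntegral.integral_of_le hab, ← integral_Icc_eq_integral_Ioc,
    ofReal_integral_eq_lintegral_ofReal
      ((by fun_prop : Continuous fun x => ‖f x‖ ^ 2).continuousOn.integrableOn_Icc)
      (.of_forall fun x => by positivity)]
  refine lintegral_congr fun x => ?_
  rw [ENNReal.ofReal_pow (norm_nonneg _), ofReal_norm]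

theorem SmoothWirtinger.lintegral_le {c : ℝ} {n : ℕ} (hW : SmoothWirtinger c n) (hc : 0 ≤ c)
    {F : ℕ → ℝ → ℂ} (hF : ∀ j < n, ∀ x, HasDerivAt (F j) (F (j + 1) x) x)
    (hF0 : Continuous (F 0)) (hFc : Continuous (F n)) {a b r : ℝ} (hab : a ≤ b) (hr : b - a ≤ r)
    (h0 : (∀ j < n, F j a = 0) ∨ (∀ j < n, F j b = 0)) :
    ∫⁻ x in Icc a b, ‖F 0 x‖ₑ ^ 2 ≤
      ENNReal.ofReal ((c * r) ^ (2 * n)) * ∫⁻ x in Icc a b, ‖F n x‖ₑ ^ 2 := by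
  rcases hab.eq_or_lt with rfl | hlt
  · simp
  rw [lintegral_Icc_enorm_sq hab hF0, lintegral_Icc_enorm_sq hab hFc,
    ← ENNReal.ofReal_mul ((even_two_mul n).pow_nonneg _)]
  refine ENNReal.ofReal_le_ofReal ((hW a b hlt F hF hFc h0).trans ?_)
  rw [← mul_pow]
  have hi : 0 ≤ ∫ x in a..b, ‖F n x‖ ^ 2 :=
    intervalIntegral.integral_nonneg hab fun x _ => by positivity
  have : 0 ≤ b - a := by linarith
  gcongr

theorem ae_eq_Icc_of_subset {T : Set ℝ} {a b : ℝ} (h1 : Ioo a b ⊆ T) (h2 : T ⊆ Icc a b) :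
    T =ᵐ[volume] Icc a b :=
  Filter.EventuallyLE.antisymm h2.eventuallyLE (Ioo_ae_eq_Icc.symm.le.trans h1.eventuallyLE)

/-- Wirtinger's inequality on a set which is star-shaped about `0`. -/
theorem SmoothWirtinger.lintegral_starShaped_le {c : ℝ} {n : ℕ} (hW : SmoothWirtinger c n)
    (hc : 0 ≤ c) {F : ℕ → ℝ → ℂ} (hF : ∀ j < n, ∀ x, HasDerivAt (F j) (F (j + 1) x) x)
    (hF0 : Continuous (F 0)) (hFc : Continuous (F n)) (h0 : ∀ j < n, F j 0 = 0)
    {S : Set ℝ} (hS : MeasurableSet S) {r : ℝ} (hSr : S ⊆ Icc (-r) r)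
    (hstar : ∀ s ∈ S, ∀ τ ∈ Icc (0 : ℝ) 1, τ * s ∈ S) :
    ∫⁻ x in S, ‖F 0 x‖ₑ ^ 2 ≤ ENNReal.ofReal ((c * r) ^ (2 * n)) * ∫⁻ x in S, ‖F n x‖ₑ ^ 2 := by
  rcases S.eq_empty_or_nonempty with rfl | ⟨s₀, hs₀⟩
  · simp
  have h0S : (0 : ℝ) ∈ S := by simpa using hstar s₀ hs₀ 0 (by simp)
  -- Up to endpoints, `S` is an interval containing `0`. Each half has length at most `r` and has
  -- `0`, where the jet vanishes, as an endpoint.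
  have hpos : (S ∩ Ici 0 : Set ℝ) =ᵐ[volume] Icc 0 (sSup S) := by
    have hbdd : BddAbove S := ⟨r, fun s hs => (hSr hs).2⟩
    refine ae_eq_Icc_of_subset (fun x hx => ⟨?_, hx.1.le⟩) fun x hx => ⟨hx.2, le_csSup hbdd hx.1⟩
    obtain ⟨s, hs, hxs⟩ := exists_lt_of_lt_csSup ⟨0, h0S⟩ hx.2
    have hs0 : 0 < s := hx.1.trans hxs
    have := hstar s hs (x / s) ⟨by have := hx.1.le; positivity, (div_le_one hs0).2 hxs.le⟩
    rwa [div_mul_cancel₀ _ hs0.ne'] at this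
  have hneg : (S ∩ Iio 0 : Set ℝ) =ᵐ[volume] Icc (sInf S) 0 := by
    have hbdd : BddBelow S := ⟨-r, fun s hs => (hSr hs).1⟩
    refine ae_eq_Icc_of_subset (fun x hx => ⟨?_, hx.2⟩) fun x hx => ⟨csInf_le hbdd hx.1, hx.2.le⟩
    obtain ⟨s, hs, hxs⟩ := exists_lt_of_csInf_lt ⟨0, h0S⟩ hx.1
    have hs0 : s < 0 := hxs.trans hx.2
    have := hstar s hs (x / s) ⟨div_nonneg_of_nonpos hx.2.le hs0.le,
      (div_le_one_of_neg hs0).2 hxs.le⟩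
    rwa [div_mul_cancel₀ _ hs0.ne] at this
  have hSup : 0 ≤ sSup S ∧ sSup S ≤ r :=
    ⟨le_csSup ⟨r, fun s hs => (hSr hs).2⟩ h0S, csSup_le ⟨0, h0S⟩ fun s hs => (hSr hs).2⟩
  have hInf : sInf S ≤ 0 ∧ -r ≤ sInf S :=
    ⟨csInf_le ⟨-r, fun s hs => (hSr hs).1⟩ h0S, le_csInf ⟨0, h0S⟩ fun s hs => (hSr hs).1⟩
  have hsplit : ∀ f : ℝ → ENNReal, ∫⁻ x in S, f x =
      (∫⁻ x in Icc 0 (sSup S), f x) + ∫⁻ x in Icc (sInf S) 0, f x := by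
    intro f
    rw [← lintegral_inter_add_sdiff f S (measurableSet_Ici (a := (0 : ℝ))),
      ← setLIntegral_congr hpos, ← setLIntegral_congr hneg]
    congr 2
    congr 1
    ext x
    simp
  rw [hsplit, hsplit, mul_add]
  exact add_le_add
    (hW.lintegral_le hc hF hF0 hFc hSup.1 (by linarith [hSup.2]) (.inl h0))
    (hW.lintegral_le hc hF hF0 hFc hInf.1 (by linarith [hInf.2]) (.inr h0))

theorem hasDerivAt_sum_pow_div_factorial (a : ℕ → ℂ) (N : ℕ) (x : ℝ) :
    HasDerivAt (fun s : ℝ => ∑ l ∈ Finset.range (N + 1), ((s : ℂ) ^ l / (l.factorial : ℂ)) * a l)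
      (∑ l ∈ Finset.range N, ((x : ℂ) ^ l / (l.factorial : ℂ)) * a (l + 1)) x := by
  have h1 : ∀ l : ℕ, HasDerivAt (fun s : ℝ => ((s : ℂ) ^ (l + 1) / ((l + 1).factorial : ℂ)) *
      a (l + 1)) (((x : ℂ) ^ l / (l.factorial : ℂ)) * a (l + 1)) x := by
    intro l
    have h := (((hasDerivAt_id x).ofReal_comp.pow (l + 1)).div_const
      ((l + 1).factorial : ℂ)).mul_const (a (l + 1))
    refine h.congr_deriv ?_
    rw [Nat.factorial_succ]
    have h2 : (l.factorial : ℂ) ≠ 0 := Nat.cast_ne_zero.2 (Nat.factorial_ne_zero l)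
    have h3 : ((l : ℂ) + 1) ≠ 0 := by exact_mod_cast Nat.succ_ne_zero l
    push_cast
    simp only [id, mul_one]
    field_simp
  simp_rw [Finset.sum_range_succ']
  simpa using (HasDerivAt.fun_sum (u := Finset.range N) fun l _ => h1 l).add_const (a 0)

/-- The error of Taylor approximation on a set which is star-shaped about `0`. -/
theorem SmoothWirtinger.taylor_le {c : ℝ} {k : ℕ} (hW : SmoothWirtinger c (k + 1))
    (hc : 0 ≤ c) {u : ℕ → ℝ → ℂ} (hu : ∀ j x, HasDerivAt (u j) (u (j + 1) x) x)
    {S : Set ℝ} (hS : MeasurableSet S) {r : ℝ} (hSr : S ⊆ Icc (-r) r)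
    (hstar : ∀ s ∈ S, ∀ τ ∈ Icc (0 : ℝ) 1, τ * s ∈ S) :
    ∫⁻ s in S, ‖u 0 s - ∑ l ∈ Finset.range (k + 1), ((s : ℂ) ^ l / (l.factorial : ℂ)) * u l 0‖ₑ ^ 2
      ≤ ENNReal.ofReal ((c * r) ^ (2 * (k + 1))) * ∫⁻ s in S, ‖u (k + 1) s‖ₑ ^ 2 := by
  -- Subtracting from `u j` its Taylor polynomial of degree `k - j` at `0` preserves the chain of
  -- derivatives and makes every entry below `k + 1` vanish at `0`. For `j = k + 1` the sum is
  -- empty, so the top entry is `u (k + 1)` itself.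
  set F : ℕ → ℝ → ℂ := fun j s => u j s - ∑ l ∈ Finset.range (k + 1 - j),
    ((s : ℂ) ^ l / (l.factorial : ℂ)) * u (l + j) 0 with hFdef
  have huc : ∀ j, Continuous (u j) := fun j =>
    continuous_iff_continuousAt.2 fun x => (hu j x).continuousAt
  have hF : ∀ j < k + 1, ∀ x, HasDerivAt (F j) (F (j + 1) x) x := by
    intro j hj x
    obtain ⟨N, hN⟩ := Nat.exists_eq_add_of_lt hj
    have e1 : k + 1 - j = N + 1 := by omega
    have e2 : k + 1 - (j + 1) = N := by omega
    simp only [hFdef, e1, e2]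
    have h := (hu j x).sub (hasDerivAt_sum_pow_div_factorial (fun l => u (l + j) 0) N x)
    refine h.congr_deriv ?_
    simp only [add_right_comm _ 1 j, add_assoc]
  have hFn : F (k + 1) = u (k + 1) := by
    ext s
    simp [hFdef]
  have hF0 : ∀ j < k + 1, F j 0 = 0 := by
    intro j hj
    obtain ⟨N, hN⟩ := Nat.exists_eq_add_of_lt hj
    have e1 : k + 1 - j = N + 1 := by omega
    simp only [hFdef, e1]
    rw [Finset.sum_range_succ']
    simp
  have h := hW.lintegral_starShaped_le hc hF (by simp only [hFdef]; fun_prop)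
    (by rw [hFn]; exact huc _) hF0 hS hSr hstar
  rw [hFn] at h
  simpa [hFdef] using h

end Wirtinger

/-! ### Restriction of band-limited functions to lines parallel to the time axis. -/

section Slices

theorem sq_lintegral_le {X : Type*} [MeasurableSpace X] {μ : Measure X} {f : X → ENNReal}
    (hf : AEMeasurable f μ) : (∫⁻ x, f x ∂μ) ^ 2 ≤ μ univ * ∫⁻ x, f x ^ 2 ∂μ := by
  have h := ENNReal.lintegral_mul_le_Lp_mul_Lq μ Real.HolderConjugate.two_two
    (aemeasurable_const (b := (1 : ENNReal))) hf
  simp only [Pi.mul_apply, one_mul, ENNReal.one_rpow, lintegral_const] at h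
  refine (pow_le_pow_left₀ zero_le h 2).trans (le_of_eq ?_)
  rw [mul_pow, ← ENNReal.rpow_natCast, ← ENNReal.rpow_natCast, ← ENNReal.rpow_mul,
    ← ENNReal.rpow_mul]
  norm_num

variable {d : ℕ} {K : Set (SpaceTime d)} {g : SpaceTime d → ℂ}

theorem measurable_point_right (z : Space d) : Measurable fun t : ℝ => point z t :=
  (continuous_point.comp (by fun_prop : Continuous fun t : ℝ => (z, t))).measurable

/-- For fixed `z`, the function `t ↦ f (z, t)` is band-limited. -/
theorem exists_slice (hK : IsCompact K) (hg : BandFun K g) (z : Space d) :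
    ∃ G : ℝ → ℂ, BandFun ((fun ξ : SpaceTime d => ξ.snd) '' K) G ∧
      ∀ t, 𝓕⁻ G t = 𝓕⁻ g (point z t) := by
  set B : Set (Space d) := (fun ξ : SpaceTime d => ξ.fst) '' K
  -- The density of the slice is the partial integral of `g` over the spatial frequencies. These lie
  -- in the compact set `B`, so Cauchy–Schwarz on `B` keeps the slice density square-integrable.
  have hB : IsCompact B := hK.image (WithLp.prod_continuous_ofLp 2 _ _ |>.fst)
  have hB0 : ∀ (ζ : Space d) (τ : ℝ), ζ ∉ B → g (point ζ τ) = 0 := fun ζ τ h =>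
    hg.zero_off _ fun hmem => h ⟨_, hmem, rfl⟩
  have hmp := (WithLp.volume_preserving_toLp (Space d) ℝ)
  have hmeas : AEStronglyMeasurable (fun q : Space d × ℝ => g (point q.1 q.2)) volume :=
    hg.memLp.1.comp_measurePreserving hmp
  have hsw : AEStronglyMeasurable (fun q : ℝ × Space d => g (point q.2 q.1)) volume :=
    hmeas.comp_measurePreserving Measure.measurePreserving_swap
  have hchar : Continuous fun q : ℝ × Space d => Real.fourierChar (inner ℝ q.2 z) := by fun_prop
  set G : ℝ → ℂ := fun τ => ∫ ζ : Space d, Real.fourierChar (inner ℝ ζ z) • g (point ζ τ)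
  have hGm : AEStronglyMeasurable G volume :=
    (hchar.aestronglyMeasurable.smul hsw).integral_prod_right'
  have hGb : ∀ᵐ τ : ℝ, ‖G τ‖ₑ ^ 2 ≤ volume B * ∫⁻ ζ : Space d, ‖g (point ζ τ)‖ₑ ^ 2 := by
    filter_upwards [hsw.prodMk_left] with τ hτ
    have h1 : ‖G τ‖ₑ ≤ ∫⁻ ζ in B, ‖g (point ζ τ)‖ₑ := by
      refine (enorm_integral_le_lintegral_enorm _).trans (le_of_eq ?_)
      rw [← lintegral_indicator hB.measurableSet]
      refine lintegral_congr fun ζ => ?_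
      rw [Circle.smul_def, enorm_smul, ← ofReal_norm (_ : ℂ), Circle.norm_coe, ENNReal.ofReal_one,
        one_mul]
      by_cases hζ : ζ ∈ B
      · rw [indicator_of_mem hζ]
      · rw [indicator_of_notMem hζ, hB0 ζ τ hζ, enorm_zero]
    refine (pow_le_pow_left₀ zero_le h1 2).trans
      ((sq_lintegral_le (hτ.restrict.enorm)).trans ?_)
    rw [Measure.restrict_apply_univ]
    gcongr
    exact Measure.restrict_le_self
  refine ⟨G, ⟨⟨hGm, ?_⟩, fun τ hτ => ?_⟩, fun t => ?_⟩
  · have h1 : eLpNorm G 2 ^ 2 ≠ ⊤ := by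
      rw [eLpNorm_two_sq]
      refine ne_top_of_le_ne_top ?_ (lintegral_mono_ae hGb)
      rw [lintegral_const_mul' _ _ hB.measure_lt_top.ne]
      refine ENNReal.mul_ne_top hB.measure_lt_top.ne ?_
      have h2 := lintegral_prod_symm (μ := (volume : Measure (Space d))) (ν := (volume : Measure ℝ))
        (fun q : Space d × ℝ => ‖g (point q.1 q.2)‖ₑ ^ 2) (hmeas.enorm.pow_const 2)
      rw [← h2]
      have h3 := lintegral_spaceTime fun x : SpaceTime d => ‖g x‖ₑ ^ 2
      exact ne_of_eq_of_ne h3.symm hg.lintegral_lt_top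
    exact lt_top_iff_ne_top.2 fun h => h1 (by rw [h]; rfl)
  · have h0 : ∀ ζ : Space d, g (point ζ τ) = 0 := fun ζ =>
      hg.zero_off _ fun hmem => hτ ⟨_, hmem, rfl⟩
    simp [G, h0]
  · rw [Real.fourierInv_eq, Real.fourierInv_eq]
    have hint : Integrable fun ξ : SpaceTime d =>
        Real.fourierChar (inner ℝ ξ (point z t)) • g ξ := by
      have h := (hg.integrable hK).norm
      refine h.mono' ?_ (.of_forall fun ξ => by rw [Circle.norm_smul])
      exact (by fun_prop : Continuous fun ξ : SpaceTime d =>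
        Real.fourierChar (inner ℝ ξ (point z t))).aestronglyMeasurable.smul hg.memLp.1
    have h1 := hmp.integral_comp (MeasurableEquiv.toLp 2 (Space d × ℝ)).measurableEmbedding
      (fun ξ : SpaceTime d => Real.fourierChar (inner ℝ ξ (point z t)) • g ξ)
    have hint' : Integrable (fun q : Space d × ℝ =>
        Real.fourierChar (inner ℝ (point q.1 q.2) (point z t)) • g (point q.1 q.2)) :=
      hmp.integrable_comp_of_integrable hint
    rw [← h1]
    have h2 := integral_prod_symm (μ := (volume : Measure (Space d)))
      (ν := (volume : Measure ℝ)) _ hint'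
    refine Eq.trans ?_ h2.symm
    refine integral_congr_ae (.of_forall fun τ => ?_)
    simp only [G]
    rw [Circle.smul_def, ← integral_smul]
    refine integral_congr_ae (.of_forall fun ζ => ?_)
    simp only [smul_smul, Circle.smul_def, Real.fourierChar_apply, inner_point]
    rw [← Complex.exp_add]
    congr 2
    simp [point]
    ring

/-- Both sides are the `t`-derivative of the same function, so uniqueness of the derivative replaces
a second Fubini argument. -/
theorem fourierInv_slice_deriv (hK : IsCompact K) (hg : BandFun K g) {z : Space d} {G : ℝ → ℂ}
    (hG : BandFun ((fun ξ : SpaceTime d => ξ.snd) '' K) G)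
    (h : ∀ t, 𝓕⁻ G t = 𝓕⁻ g (point z t)) (t : ℝ) :
    𝓕⁻ (fun ξ => dirSymbol (point 0 1) ξ • g ξ) (point z t) =
      𝓕⁻ (fun τ => dirSymbol (1 : ℝ) τ • G τ) t := by
  have hK' : IsCompact ((fun ξ : SpaceTime d => ξ.snd) '' K) :=
    hK.image (WithLp.prod_continuous_ofLp 2 _ _ |>.snd)
  have h1 := hasDerivAt_fourierInv hK hg (point z t) (point 0 1) 0
  have h2 := hasDerivAt_fourierInv hK' hG t 1 0
  simp only [← point_add_smul_time] at h1
  simp only [h, smul_eq_mul, mul_one] at h2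
  simpa using h1.unique h2

theorem lintegral_slice_ne_top (hK : IsCompact K) (hg : BandFun K g) (z : Space d) :
    ∫⁻ t, ‖𝓕⁻ g (point z t)‖ₑ ^ 2 ≠ ⊤ := by
  obtain ⟨G, hG, hGe⟩ := exists_slice hK hg z
  have hK' : IsCompact ((fun ξ : SpaceTime d => ξ.snd) '' K) :=
    hK.image (WithLp.prod_continuous_ofLp 2 _ _ |>.snd)
  simp_rw [← hGe]
  rw [lintegral_fourierInv (hG.integrable hK') hG.memLp]
  exact hG.lintegral_lt_top

/-- Bernstein's inequality in the time variable. -/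
theorem lintegral_slice_deriv_le (hK : IsCompact K) (hg : BandFun K g) (z : Space d) {M : ℝ}
    (hM : ∀ ξ ∈ K, 2 * Real.pi * |ξ.snd| ≤ M) :
    ∫⁻ t, ‖𝓕⁻ (fun ξ => dirSymbol (point 0 1) ξ • g ξ) (point z t)‖ₑ ^ 2 ≤
      ENNReal.ofReal M ^ 2 * ∫⁻ t, ‖𝓕⁻ g (point z t)‖ₑ ^ 2 := by
  obtain ⟨G, hG, hGe⟩ := exists_slice hK hg z
  have hK' : IsCompact ((fun ξ : SpaceTime d => ξ.snd) '' K) :=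
    hK.image (WithLp.prod_continuous_ofLp 2 _ _ |>.snd)
  have hG' := hG.smul hK' (a := dirSymbol (1 : ℝ)) (by fun_prop)
  simp_rw [fourierInv_slice_deriv hK hg hG hGe, ← hGe]
  rw [lintegral_fourierInv (hG.integrable hK') hG.memLp,
    lintegral_fourierInv (hG'.integrable hK') hG'.memLp]
  refine hG.lintegral_smul_le ?_
  rintro _ ⟨ξ, hξ, rfl⟩
  rw [norm_dirSymbol]
  simpa using hM ξ hξ

end Slices

/-! ### Sampling in the time variable. -/

section TimeSampling

/-- The midpoint between consecutive points of a sequence. -/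
def midPoint (τ : ℤ → ℝ) (m : ℤ) : ℝ := (τ (m - 1) + τ m) / 2

/-- The set of the points closest to `τ m`. -/
def timeCell (τ : ℤ → ℝ) (m : ℤ) : Set ℝ := Ioc (midPoint τ m) (midPoint τ (m + 1))

variable {τ : ℤ → ℝ}

theorem monotone_midPoint (hτ : StrictMono τ) : Monotone (midPoint τ) := by
  intro a b hab
  have h1 := hτ.monotone hab
  have h2 := hτ.monotone (sub_le_sub_right hab 1)
  unfold midPoint
  linarith

theorem iUnion_timeCell (hτ : StrictMono τ) (hu : ∀ x, ∃ m, x < τ m) (hl : ∀ x, ∃ m, τ m < x) :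
    ⋃ m, timeCell τ m = univ := by
  refine eq_univ_of_forall fun x => ?_
  obtain ⟨a, ha⟩ := hl x
  have ha' : midPoint τ a < x := by
    have := hτ (sub_one_lt a)
    unfold midPoint
    linarith
  have hnb : ¬BddAbove (midPoint τ '' Ici a) := by
    rintro ⟨C, hC⟩
    obtain ⟨m, hm⟩ := hu (max C (τ a))
    have ham : a < m := hτ.lt_iff_lt.1 ((le_max_right _ _).trans_lt hm)
    have h1 := hC ⟨m + 1, mem_Ici.2 (by omega), rfl⟩
    have h2 := hτ (lt_add_one m)
    have h3 := (le_max_left C (τ a)).trans_lt hm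
    simp only [midPoint, add_sub_cancel_right] at h1
    linarith
  have hU := biUnion_Ici_Ioc_map_succ (f := midPoint τ) (a := a)
    (fun i hi => monotone_midPoint hτ hi) hnb
  have hx : x ∈ Ioi (midPoint τ a) := ha'
  rw [← hU] at hx
  simp only [mem_iUnion] at hx ⊢
  obtain ⟨i, _, hi⟩ := hx
  exact ⟨i, hi⟩

theorem pairwise_disjoint_timeCell (hτ : StrictMono τ) :
    Pairwise fun m m' => Disjoint (timeCell τ m) (timeCell τ m') :=
  (monotone_midPoint hτ).pairwise_disjoint_on_Ioc_succ

theorem volume_timeCell (m : ℤ) :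
    volume (timeCell τ m) = ENNReal.ofReal ((τ (m + 1) - τ (m - 1)) / 2) := by
  rw [timeCell, Real.volume_Ioc, midPoint, midPoint, add_sub_cancel_right]
  congr 1
  ring

theorem lintegral_eq_tsum_timeCell (hτ : StrictMono τ) (hu : ∀ x, ∃ m, x < τ m)
    (hl : ∀ x, ∃ m, τ m < x) (f : ℝ → ENNReal) :
    ∫⁻ t, f t = ∑' m, ∫⁻ t in timeCell τ m, f t := by
  rw [← lintegral_iUnion (s := timeCell τ) (fun m => measurableSet_Ioc)
    (pairwise_disjoint_timeCell hτ), iUnion_timeCell hτ hu hl, Measure.restrict_univ]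

variable {d : ℕ} {K : Set (SpaceTime d)} {g : SpaceTime d → ℂ}

/-- Translated by `-τ m`, the cell is an interval about `0` reaching half a gap, hence at most `δ`,
to either side; this is the Taylor estimate of order `0` with Wirtinger constant `2/π`. -/
theorem lintegral_timeCell_sub_le (hK : IsCompact K) (hg : BandFun K g) (z : Space d)
    (hτ : StrictMono τ) {δ : ℝ} (hgap : ∀ m, τ (m + 1) - τ m ≤ 2 * δ) (m : ℤ) :
    ∫⁻ t in timeCell τ m, ‖𝓕⁻ g (point z t) - 𝓕⁻ g (point z (τ m))‖ₑ ^ 2 ≤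
      ENNReal.ofReal ((2 / Real.pi * δ) ^ 2) * ∫⁻ t in timeCell τ m,
        ‖𝓕⁻ (fun ξ => dirSymbol (point 0 1) ξ • g ξ) (point z t)‖ₑ ^ 2 := by
  set u : ℕ → ℝ → ℂ := fun j s => 𝓕⁻ (fun ξ => dirSymbol (point 0 1) ξ ^ j • g ξ)
    (point z (τ m + s)) with hu
  have hderiv : ∀ j s, HasDerivAt (u j) (u (j + 1) s) s := by
    intro j s
    have h := hasDerivAt_fourierInv hK (hg.smul hK (a := fun ξ => dirSymbol (point 0 1) ξ ^ j)
      (by fun_prop)) (point z (τ m)) (point 0 1) s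
    simp only [← point_add_smul_time, smul_smul, ← pow_succ'] at h
    exact h
  set S : Set ℝ := (fun s => τ m + s) ⁻¹' timeCell τ m with hS
  have hmp : MeasurePreserving (fun s : ℝ => τ m + s) := measurePreserving_add_left volume (τ m)
  have htr : ∀ f : ℝ → ENNReal, ∫⁻ t in timeCell τ m, f t = ∫⁻ s in S, f (τ m + s) := fun f =>
    (hmp.setLIntegral_comp_preimage_emb (measurableEmbedding_addLeft (τ m)) f _).symm
  have hSm : MeasurableSet S := hmp.measurable measurableSet_Ioc
  have h1 := hgap m
  have h2 := hgap (m - 1)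
  have h3 := hτ (lt_add_one m)
  have h4 := hτ (sub_one_lt m)
  rw [sub_add_cancel] at h2
  have hmem : ∀ s, s ∈ S ↔ (τ (m - 1) - τ m) / 2 < s ∧ s ≤ (τ (m + 1) - τ m) / 2 := by
    intro s
    simp only [hS, timeCell, midPoint, mem_preimage, mem_Ioc, add_sub_cancel_right]
    constructor <;> rintro ⟨ha, hb⟩ <;> constructor <;> linarith
  have h := smoothWirtinger_two_div_pi.taylor_le (k := 0) (by positivity) hderiv hSm (r := δ)
    (fun s hs => by
      rw [hmem] at hs
      exact ⟨by linarith, by linarith⟩)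
    (fun s hs θ hθ => by
      rw [hmem] at hs ⊢
      rcases le_total 0 s with h0 | h0
      · constructor
        · have := mul_nonneg hθ.1 h0
          linarith
        · exact (mul_le_of_le_one_left h0 hθ.2).trans hs.2
      · constructor
        · have : s ≤ θ * s := by nlinarith [hθ.2]
          linarith
        · have := mul_nonpos_of_nonneg_of_nonpos hθ.1 h0
          linarith)
  rw [htr, htr]
  simpa [hu] using h

/-- The sampling inequality on the line `{z} × ℝ`. -/
theorem time_sampling (hK : IsCompact K) (hg : BandFun K g) (z : Space d)
    (hτ : StrictMono τ) (hu : ∀ x, ∃ m, x < τ m) (hl : ∀ x, ∃ m, τ m < x) {δ M : ℝ}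
    (hM : ∀ ξ ∈ K, 2 * Real.pi * |ξ.snd| ≤ M) (hM0 : 0 ≤ M)
    (hgap : ∀ m, τ (m + 1) - τ m ≤ 2 * δ) :
    (2 * δ * M / Real.pi ≤ 1 → ENNReal.ofReal ((1 - 2 * δ * M / Real.pi) ^ 2) *
        ∫⁻ t, ‖𝓕⁻ g (point z t)‖ₑ ^ 2 ≤
      ∑' m, ENNReal.ofReal ((τ (m + 1) - τ (m - 1)) / 2) * ‖𝓕⁻ g (point z (τ m))‖ₑ ^ 2) ∧
    ∑' m, ENNReal.ofReal ((τ (m + 1) - τ (m - 1)) / 2) * ‖𝓕⁻ g (point z (τ m))‖ₑ ^ 2 ≤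
      ENNReal.ofReal ((1 + 2 * δ * M / Real.pi) ^ 2) * ∫⁻ t, ‖𝓕⁻ g (point z t)‖ₑ ^ 2 := by
  have hδ : 0 ≤ δ := by linarith [hgap 0, hτ (lt_add_one (0 : ℤ))]
  have hπ := Real.pi_pos
  have hm : Measurable fun t : ℝ => 𝓕⁻ g (point z t) :=
    (continuous_fourierInv hK hg).measurable.comp (measurable_point_right z)
  have h := tsum_lintegral_perturbed (fun m : ℤ => (volume : Measure ℝ).restrict (timeCell τ m))
    (f := fun _ t => 𝓕⁻ g (point z t)) (g := fun m _ => 𝓕⁻ g (point z (τ m)))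
    (fun _ => hm) (fun _ => measurable_const) (η := 2 * δ * M / Real.pi) (by positivity)
    (lintegral_slice_ne_top hK hg z) (lintegral_eq_tsum_timeCell hτ hu hl _).symm ?_
  · simp only [lintegral_const, Measure.restrict_apply_univ, volume_timeCell] at h
    simp_rw [mul_comm (ENNReal.ofReal _) (‖_‖ₑ ^ 2)]
    exact h
  · calc _ ≤ ∑' m, ENNReal.ofReal ((2 / Real.pi * δ) ^ 2) * ∫⁻ t in timeCell τ m,
          ‖𝓕⁻ (fun ξ => dirSymbol (point 0 1) ξ • g ξ) (point z t)‖ₑ ^ 2 :=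
        ENNReal.tsum_le_tsum fun m => lintegral_timeCell_sub_le hK hg z hτ hgap m
      _ = ENNReal.ofReal ((2 / Real.pi * δ) ^ 2) * ∫⁻ t,
          ‖𝓕⁻ (fun ξ => dirSymbol (point 0 1) ξ • g ξ) (point z t)‖ₑ ^ 2 := by
        rw [ENNReal.tsum_mul_left, ← lintegral_eq_tsum_timeCell hτ hu hl]
      _ ≤ ENNReal.ofReal ((2 / Real.pi * δ) ^ 2) * (ENNReal.ofReal M ^ 2 *
          ∫⁻ t, ‖𝓕⁻ g (point z t)‖ₑ ^ 2) := by
        gcongr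
        exact lintegral_slice_deriv_le hK hg z hM
      _ = _ := by
        rw [← mul_assoc, ← ENNReal.ofReal_pow hM0, ← ENNReal.ofReal_mul (by positivity)]
        congr 2
        ring

end TimeSampling

/-! ### Derivative tensors indexed by words of coordinate directions. -/

section WordDerivatives

variable {d : ℕ} {H : Type} [NormedAddCommGroup H] [InnerProductSpace ℂ H]

/-- The symbol of the iterated spatial derivative along a word of coordinate directions. -/
def wordSymbol {l : ℕ} (s : Fin l → Fin (d - 1)) (ξ : SpaceTime d) : ℂ :=
  ∏ a, dirSymbol (point (EuclideanSpace.single (s a) 1) 0) ξ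

@[fun_prop]
theorem continuous_wordSymbol {l : ℕ} (s : Fin l → Fin (d - 1)) :
    Continuous (wordSymbol s : SpaceTime d → ℂ) := by
  unfold wordSymbol
  fun_prop

/-- The frequency density of the tensor of all spatial derivatives of order `l`. -/
def tensorDensity (l : ℕ) (g : SpaceTime d → H) (ξ : SpaceTime d) :
    PiLp 2 (fun _ : Fin l → Fin (d - 1) => H) :=
  WithLp.toLp 2 fun s => wordSymbol s ξ • g ξ

theorem sum_prod_sq_word {p l : ℕ} (x : Fin p → ℝ) :
    ∑ s : Fin l → Fin p, ∏ a, x (s a) ^ 2 = (∑ i, x i ^ 2) ^ l :=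
  (Fintype.sum_pow (fun i => x i ^ 2) l).symm

/-- Words count a multi-index `α` of order `l` exactly `l!/α!` times, which makes the sum of squares
collapse to a power of `‖ξ.fst‖` without a dimensional constant. -/
theorem norm_tensorDensity (l : ℕ) (g : SpaceTime d → H) (ξ : SpaceTime d) :
    ‖tensorDensity l g ξ‖ = (2 * Real.pi * ‖ξ.fst‖) ^ l * ‖g ξ‖ := by
  have hπ := Real.pi_pos
  rw [← sq_eq_sq₀ (norm_nonneg _) (by positivity), PiLp.norm_sq_eq_of_L2]
  have h : ∀ s : Fin l → Fin (d - 1), ‖wordSymbol s ξ • g ξ‖ ^ 2 =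
      (∏ a, (2 * Real.pi * ξ.fst (s a)) ^ 2) * ‖g ξ‖ ^ 2 := by
    intro s
    rw [norm_smul, mul_pow, wordSymbol, norm_prod, ← Finset.prod_pow]
    congr 1
    refine Finset.prod_congr rfl fun a _ => ?_
    rw [dirSymbol_point_single]
    simp [abs_of_pos hπ, mul_pow]
  simp only [tensorDensity, h]
  rw [← Finset.sum_mul, sum_prod_sq_word (fun i => 2 * Real.pi * ξ.fst i), mul_pow, ← pow_mul,
    mul_comm l, pow_mul, mul_pow (2 * Real.pi), EuclideanSpace.real_norm_sq_eq, Finset.mul_sum]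
  simp only [mul_pow]

variable {K : Set (SpaceTime d)} {g : SpaceTime d → H}

theorem BandFun.tensorDensity (hK : IsCompact K) (hg : BandFun K g) (l : ℕ) :
    BandFun K (tensorDensity l g) := by
  have hΦ : Continuous fun q : ((Fin l → Fin (d - 1)) → ℂ) × H =>
      (WithLp.toLp 2 fun s => q.1 s • q.2 : PiLp 2 (fun _ : Fin l → Fin (d - 1) => H)) :=
    (PiLp.continuous_toLp 2 _).comp (by fun_prop)
  have hω : Continuous fun (ξ : SpaceTime d) (s : Fin l → Fin (d - 1)) => wordSymbol s ξ := by
    fun_prop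
  have hm : AEStronglyMeasurable (LineSampling.tensorDensity l g) volume :=
    hΦ.comp_aestronglyMeasurable (hω.aestronglyMeasurable.prodMk hg.memLp.1)
  have hc : Continuous fun ξ : SpaceTime d => (((2 * Real.pi * ‖ξ.fst‖) ^ l : ℝ) : ℂ) := by
    have : Continuous fun ξ : SpaceTime d => ξ.fst := WithLp.prod_continuous_ofLp 2 _ _ |>.fst
    fun_prop
  refine ⟨(hg.smul hK hc).memLp.of_le hm (.of_forall fun ξ => ?_), fun ξ hξ => ?_⟩
  · rw [norm_tensorDensity, norm_smul, Complex.norm_real, Real.norm_of_nonneg]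
    have := Real.pi_pos
    positivity
  · rw [← norm_eq_zero, norm_tensorDensity, hg.zero_off ξ hξ, norm_zero, mul_zero]

theorem lintegral_tensorDensity_le (hg : BandFun K g) {M : ℝ}
    (hM : ∀ ξ ∈ K, 2 * Real.pi * ‖ξ.fst‖ ≤ M) (l : ℕ) :
    ∫⁻ ξ, ‖tensorDensity l g ξ‖ₑ ^ 2 ≤ ENNReal.ofReal (M ^ l) ^ 2 * ∫⁻ ξ, ‖g ξ‖ₑ ^ 2 := by
  rw [← lintegral_const_mul' _ _ (by finiteness)]
  refine lintegral_mono fun ξ => ?_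
  rw [← mul_pow]
  refine pow_le_pow_left₀ zero_le ?_ 2
  have hπ := Real.pi_pos
  by_cases hξ : ξ ∈ K
  · rw [← ofReal_norm, norm_tensorDensity, ENNReal.ofReal_mul (by positivity), ofReal_norm]
    gcongr
    exact hM ξ hξ
  · rw [← ofReal_norm, norm_tensorDensity, hg.zero_off ξ hξ]
    simp

/-- Contraction of a tensor of order `l` with `h ⊗ ⋯ ⊗ h`. -/
def contraction (H : Type) [NormedAddCommGroup H] [InnerProductSpace ℂ H] (l : ℕ) (h : Space d) :
    PiLp 2 (fun _ : Fin l → Fin (d - 1) => H) →L[ℂ] H :=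
  ∑ s : Fin l → Fin (d - 1), ((∏ a, h (s a) : ℝ) : ℂ) • PiLp.proj 2 (fun _ => H) s

theorem contraction_apply (l : ℕ) (h : Space d) (v : PiLp 2 (fun _ : Fin l → Fin (d - 1) => H)) :
    contraction H l h v = ∑ s : Fin l → Fin (d - 1), ((∏ a, h (s a) : ℝ) : ℂ) • v s := by
  simp [contraction]

/-- Cauchy–Schwarz over words, the squares `∏ h(s a)²` summing to `‖h‖^(2l)`. -/
theorem norm_contraction_le (l : ℕ) (h : Space d)
    (v : PiLp 2 (fun _ : Fin l → Fin (d - 1) => H)) :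
    ‖contraction H l h v‖ ≤ ‖h‖ ^ l * ‖v‖ := by
  rw [contraction_apply]
  have h1 : ‖∑ s : Fin l → Fin (d - 1), ((∏ a, h (s a) : ℝ) : ℂ) • v s‖ ≤
      ∑ s : Fin l → Fin (d - 1), |∏ a, h (s a)| * ‖v s‖ := by
    refine (norm_sum_le _ _).trans (le_of_eq (Finset.sum_congr rfl fun s _ => ?_))
    rw [norm_smul, Complex.norm_real, Real.norm_eq_abs]
  refine h1.trans (le_of_sq_le_sq ?_ (by positivity))
  refine (Finset.sum_mul_sq_le_sq_mul_sq _ _ _).trans (le_of_eq ?_)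
  rw [mul_pow, ← PiLp.norm_sq_eq_of_L2, ← pow_mul, mul_comm l, pow_mul,
    EuclideanSpace.real_norm_sq_eq, ← sum_prod_sq_word (fun i => h i)]
  simp only [sq_abs, Finset.prod_pow]

theorem contraction_tensorDensity (l : ℕ) (h : Space d) (ξ : SpaceTime d) :
    contraction H l h (tensorDensity l g ξ) = dirSymbol (point h 0) ξ ^ l • g ξ := by
  rw [contraction_apply, dirSymbol_point_eq_sum, Fintype.sum_pow, Finset.sum_smul]
  refine Finset.sum_congr rfl fun s _ => ?_
  simp only [tensorDensity, wordSymbol, smul_smul, Finset.prod_mul_distrib]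
  push_cast
  rfl

variable [CompleteSpace H]

theorem fourierInv_dirSymbol_pow (hK : IsCompact K) (hg : BandFun K g) (l : ℕ) (h : Space d)
    (x : SpaceTime d) :
    𝓕⁻ (fun ξ => dirSymbol (point h 0) ξ ^ l • g ξ) x =
      contraction H l h (𝓕⁻ (tensorDensity l g) x) := by
  rw [Real.fourierInv_eq, Real.fourierInv_eq, ← ContinuousLinearMap.integral_comp_comm]
  · refine integral_congr_ae (.of_forall fun ξ => ?_)
    simp only [Circle.smul_def]
    rw [map_smul, contraction_tensorDensity]
  · have hD := hg.tensorDensity hK l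
    refine ((hD.integrable hK).norm).mono' ?_ (.of_forall fun ξ => by rw [Circle.norm_smul])
    exact (by fun_prop : Continuous fun ξ : SpaceTime d =>
      Real.fourierChar (inner ℝ ξ x)).aestronglyMeasurable.smul hD.memLp.1

/-- The `l`-th Taylor term in the direction `h` is the derivative tensor contracted with `h ⊗ ⋯ ⊗
h`. The bound is uniform over `‖h‖ ≤ r`, as the maximal functions require. -/
theorem enorm_fourierInv_dirSymbol_pow_le (hK : IsCompact K) (hg : BandFun K g) (l : ℕ)
    {h : Space d} {r : ℝ} (hr : ‖h‖ ≤ r) (x : SpaceTime d) :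
    ‖𝓕⁻ (fun ξ => (dirSymbol (point h 0) ξ ^ l / (l.factorial : ℂ)) • g ξ) x‖ₑ ≤
      ENNReal.ofReal (r ^ l / l.factorial) * ‖𝓕⁻ (tensorDensity l g) x‖ₑ := by
  have e : (fun ξ => (dirSymbol (point h 0) ξ ^ l / (l.factorial : ℂ)) • g ξ) =
      fun ξ => ((l.factorial : ℂ)⁻¹) • (dirSymbol (point h 0) ξ ^ l • g ξ) := by
    ext ξ
    rw [smul_smul, div_eq_inv_mul]
  have e2 : 𝓕⁻ (fun ξ => ((l.factorial : ℂ)⁻¹) • (dirSymbol (point h 0) ξ ^ l • g ξ)) x =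
      ((l.factorial : ℂ)⁻¹) • contraction H l h (𝓕⁻ (tensorDensity l g) x) := by
    rw [← fourierInv_dirSymbol_pow hK hg, Real.fourierInv_eq, Real.fourierInv_eq, ← integral_smul]
    refine integral_congr_ae (.of_forall fun ξ => ?_)
    simp only [Circle.smul_def]
    rw [smul_comm]
  have h0 : 0 ≤ r := (norm_nonneg h).trans hr
  rw [e, e2, ← ofReal_norm, ← ofReal_norm, ← ENNReal.ofReal_mul (by positivity)]
  refine ENNReal.ofReal_le_ofReal ?_
  rw [norm_smul, norm_inv, Complex.norm_natCast, div_eq_inv_mul, mul_assoc]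
  gcongr
  refine (norm_contraction_le l h _).trans ?_
  gcongr

end WordDerivatives

/-! ### `L²` bounds for the local maximal function in space. -/

section MaximalBounds

variable {d : ℕ}

/-- The local maximal function over balls of radius `r` in space is bounded by `κ` on the functions
with frequencies in `K`. -/
def MaxBound (K : Set (SpaceTime d)) (r κ : ℝ) : Prop :=
  ∀ (H : Type) [NormedAddCommGroup H] [InnerProductSpace ℂ H] [CompleteSpace H]
    (g : SpaceTime d → H), BandFun K g → ∃ W : Space d × ℝ → ENNReal, Measurable W ∧
      (∀ (z : Space d) (t : ℝ) (h : Space d), ‖h‖ ≤ r → ‖𝓕⁻ g (point (z + h) t)‖ₑ ≤ W (z, t)) ∧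
      ∫⁻ q, W q ^ 2 ≤ ENNReal.ofReal κ ^ 2 * ∫⁻ ξ, ‖g ξ‖ₑ ^ 2

theorem hasSum_pow_div_factorial (x : ℝ) :
    HasSum (fun n : ℕ => x ^ n / n.factorial) (Real.exp x) := by
  rw [Real.exp_eq_exp_ℝ]
  exact NormedSpace.expSeries_div_hasSum_exp x

theorem hasSum_expRemainder (k : ℕ) (x : ℝ) :
    HasSum (fun n : ℕ => x ^ (n + (k + 1)) / (n + (k + 1)).factorial) (expRemainder k x) :=
  (hasSum_nat_add_iff' (k + 1)).2 (hasSum_pow_div_factorial x)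

variable {K : Set (SpaceTime d)} {M r : ℝ}

theorem lintegral_fourierInv_point {H : Type} [NormedAddCommGroup H] [InnerProductSpace ℂ H]
    [CompleteSpace H] {g : SpaceTime d → H} (hK : IsCompact K) (hg : BandFun K g) :
    ∫⁻ q : Space d × ℝ, ‖𝓕⁻ g (point q.1 q.2)‖ₑ ^ 2 = ∫⁻ ξ, ‖g ξ‖ₑ ^ 2 := by
  rw [← lintegral_fourierInv (hg.integrable hK) hg.memLp,
    lintegral_spaceTime fun x => ‖𝓕⁻ g x‖ₑ ^ 2]

theorem continuous_fourierInv_point {H : Type} [NormedAddCommGroup H] [InnerProductSpace ℂ H]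
    [CompleteSpace H] {g : SpaceTime d → H} (hK : IsCompact K) (hg : BandFun K g) :
    Continuous fun q : Space d × ℝ => 𝓕⁻ g (point q.1 q.2) :=
  (continuous_fourierInv hK hg).comp continuous_point

/-- Expanding in `h`, the majorant `W` is the series of `r^l / l!` times the norm of the `l`-th
derivative tensor. By Minkowski and Bernstein its `L²` norm is at most `∑ (rM)^l / l!` times that of
`g`. -/
theorem maxBound_exp (hK : IsCompact K) (hr : 0 ≤ r) (hM0 : 0 ≤ M)
    (hM : ∀ ξ ∈ K, 2 * Real.pi * ‖ξ.fst‖ ≤ M) : MaxBound K r (Real.exp (r * M)) := by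
  intro H _ _ _ g hg
  have hmeas : ∀ l : ℕ, Measurable fun q : Space d × ℝ => ENNReal.ofReal (r ^ l / l.factorial) *
      ‖𝓕⁻ (tensorDensity l g) (point q.1 q.2)‖ₑ := fun l =>
    (continuous_fourierInv_point hK (hg.tensorDensity hK l)).enorm.measurable.const_mul _
  refine ⟨fun q => ∑' l : ℕ, ENNReal.ofReal (r ^ l / l.factorial) *
    ‖𝓕⁻ (tensorDensity l g) (point q.1 q.2)‖ₑ, Measurable.tsum hmeas,
    fun z t h hh => ?_, ?_⟩
  · have hsum := hasSum_fourierInv_add hK hg (point z t) (point h 0)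
    rw [← point_add, add_zero] at hsum
    rw [← hsum.tsum_eq]
    exact enorm_tsum_le_tsum_enorm.trans
      (ENNReal.tsum_le_tsum fun l => enorm_fourierInv_dirSymbol_pow_le hK hg l hh _)
  · refine (lintegral_tsum_sq_le (c := fun l => ENNReal.ofReal ((r * M) ^ l / l.factorial))
      (A := ∫⁻ ξ, ‖g ξ‖ₑ ^ 2) (fun l => (hmeas l).aemeasurable) fun l => ?_).trans (le_of_eq ?_)
    · simp_rw [mul_pow]
      rw [lintegral_const_mul' _ _ (by finiteness),
        lintegral_fourierInv_point hK (hg.tensorDensity hK l)]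
      refine (mul_le_mul_right (lintegral_tensorDensity_le hg hM l) _).trans (le_of_eq ?_)
      rw [← mul_assoc, ← mul_pow, ← ENNReal.ofReal_mul (by positivity)]
      congr 3
      ring
    · rw [← ENNReal.ofReal_tsum_of_nonneg (fun l => by positivity)
        (hasSum_pow_div_factorial _).summable, (hasSum_pow_div_factorial _).tsum_eq]

/-- Every `y` within `ρ` of `z + h` has `|f(z + h)| ≤ W(y)`, with `W` the majorant for radius `ρ`.
Hence `|f(z + h)|²` is at most the integral of `W²` over the ball of radius `r + ρ` about `z`,
divided by the volume of a ball of radius `ρ`. Integrating in `z` leaves the ratio of the two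
volumes, and `ρ` remains free. -/
theorem maxBound_ball (hK : IsCompact K) (hr : 0 ≤ r) (hM0 : 0 ≤ M)
    (hM : ∀ ξ ∈ K, 2 * Real.pi * ‖ξ.fst‖ ≤ M) {ρ κ : ℝ} (hρ : 0 < ρ)
    (hκ0 : 0 ≤ κ) (hκ : κ ^ 2 = ((r + ρ) / ρ) ^ (d - 1) * Real.exp (ρ * M) ^ 2) :
    MaxBound K r κ := by
  intro H _ _ _ g hg
  obtain ⟨W, hWm, hW, hWi⟩ := maxBound_exp hK hρ.le hM0 hM H g hg
  set b : ENNReal := volume (Metric.closedBall (0 : Space d) ρ) with hb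
  have hb0 : b ≠ 0 := (Metric.measure_closedBall_pos _ _ hρ).ne'
  have hbt : b ≠ ⊤ := measure_closedBall_lt_top.ne
  set f : (Space d × ℝ) → Space d → ENNReal := fun q y =>
    (Metric.closedBall q.1 (r + ρ)).indicator (fun y => W (y, q.2) ^ 2) y with hf
  have hfm : Measurable (Function.uncurry f) := by
    have hs : MeasurableSet {p : (Space d × ℝ) × Space d | dist p.2 p.1.1 ≤ r + ρ} :=
      measurableSet_le (by fun_prop) (by fun_prop)
    have : Function.uncurry f = {p : (Space d × ℝ) × Space d | dist p.2 p.1.1 ≤ r + ρ}.indicator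
        fun p => W (p.2, p.1.2) ^ 2 := by
      ext p
      simp [f, Function.uncurry, indicator, Metric.mem_closedBall]
    rw [this]
    exact Measurable.indicator (by fun_prop) hs
  have hsq : ∀ x : ENNReal, (x ^ (1 / 2 : ℝ)) ^ 2 = x := fun x => by
    rw [← ENNReal.rpow_natCast, ← ENNReal.rpow_mul]
    norm_num
  refine ⟨fun q => (b⁻¹ * ∫⁻ y, f q y) ^ (1 / 2 : ℝ),
    (hfm.lintegral_prod_right.const_mul _).pow_const _, fun z t h hh => ?_, ?_⟩
  · have h1 : ‖𝓕⁻ g (point (z + h) t)‖ₑ ^ 2 ≤ b⁻¹ * ∫⁻ y, f (z, t) y := by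
      rw [← ENNReal.div_eq_inv_mul, ENNReal.le_div_iff_mul_le (.inl hb0) (.inl hbt)]
      have hbb : b = volume (Metric.closedBall (z + h) ρ) := by
        rw [hb, Measure.addHaar_closedBall_center volume (z + h)]
      rw [hbb, ← setLIntegral_const]
      simp only [f]
      rw [lintegral_indicator Metric.isClosed_closedBall.measurableSet]
      refine (setLIntegral_mono (by fun_prop) fun y hy => ?_).trans (lintegral_mono_set ?_)
      · refine pow_le_pow_left₀ zero_le ?_ 2
        have := hW y t (z + h - y) (by rwa [← dist_eq_norm, dist_comm])
        rwa [add_sub_cancel] at this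
      · refine Metric.closedBall_subset_closedBall' ?_
        rw [dist_eq_norm, add_sub_cancel_left]
        linarith
    calc ‖𝓕⁻ g (point (z + h) t)‖ₑ = (‖𝓕⁻ g (point (z + h) t)‖ₑ ^ 2) ^ (1 / 2 : ℝ) := by
          rw [← ENNReal.rpow_natCast, ← ENNReal.rpow_mul]
          norm_num
      _ ≤ _ := ENNReal.rpow_le_rpow h1 (by norm_num)
  · simp_rw [hsq]
    rw [lintegral_const_mul' _ _ (ENNReal.inv_ne_top.2 hb0)]
    -- By Tonelli, for fixed `y` the admissible `z` again form a ball of radius `r + ρ`, now about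
    -- `y`.
    have h1 : ∫⁻ q : Space d × ℝ, ∫⁻ y, f q y =
        volume (Metric.closedBall (0 : Space d) (r + ρ)) * ∫⁻ q, W q ^ 2 := by
      rw [lintegral_lintegral_swap hfm.aemeasurable]
      have h2 : ∀ y, ∫⁻ q : Space d × ℝ, f q y =
          ∫⁻ t, volume (Metric.closedBall (0 : Space d) (r + ρ)) * W (y, t) ^ 2 := by
        intro y
        have := lintegral_prod_symm (μ := (volume : Measure (Space d)))
          (ν := (volume : Measure ℝ)) (fun q => f q y) (by
            exact (hfm.comp (by fun_prop : Measurable fun q : Space d × ℝ => (q, y))).aemeasurable)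
        refine this.trans (lintegral_congr fun t => ?_)
        have h3 : ∀ z : Space d, f (z, t) y =
            (Metric.closedBall y (r + ρ)).indicator (fun _ => W (y, t) ^ 2) z := by
          intro z
          simp only [f, indicator, Metric.mem_closedBall, dist_comm]
        simp_rw [h3]
        rw [lintegral_indicator_const Metric.isClosed_closedBall.measurableSet,
          Measure.addHaar_closedBall_center volume y, mul_comm]
      simp_rw [h2]
      have h4 := lintegral_prod (μ := (volume : Measure (Space d))) (ν := (volume : Measure ℝ))
        (fun q : Space d × ℝ => volume (Metric.closedBall (0 : Space d) (r + ρ)) * W q ^ 2)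
        (by fun_prop)
      rw [← h4, lintegral_const_mul _ (by fun_prop)]
      rfl
    rw [h1]
    have hvol : volume (Metric.closedBall (0 : Space d) (r + ρ)) =
        ENNReal.ofReal (((r + ρ) / ρ) ^ (d - 1)) * b := by
      rw [hb, Measure.addHaar_closedBall _ _ (by positivity), Measure.addHaar_closedBall _ _ hρ.le,
        ← mul_assoc, ← ENNReal.ofReal_mul (by positivity), finrank_euclideanSpace_fin, ← mul_pow,
        div_mul_cancel₀ _ hρ.ne']
    rw [hvol]
    calc _ = (b⁻¹ * b) * (ENNReal.ofReal (((r + ρ) / ρ) ^ (d - 1)) * ∫⁻ q, W q ^ 2) := by ring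
      _ = ENNReal.ofReal (((r + ρ) / ρ) ^ (d - 1)) * ∫⁻ q, W q ^ 2 := by
        rw [ENNReal.inv_mul_cancel hb0 hbt, one_mul]
      _ ≤ ENNReal.ofReal (((r + ρ) / ρ) ^ (d - 1)) *
          (ENNReal.ofReal (Real.exp (ρ * M)) ^ 2 * ∫⁻ ξ, ‖g ξ‖ₑ ^ 2) := by gcongr
      _ = _ := by
        rw [← mul_assoc, ← ENNReal.ofReal_pow (by positivity), ← ENNReal.ofReal_mul (by positivity),
          ← hκ, ENNReal.ofReal_pow hκ0]

end MaximalBounds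

/-! ### Multinomial identities for truncated exponentials. -/

section MultiIndices

instance instFiniteMultiIndex (n k : ℕ) : Finite (MultiIndex n k) := by
  refine Finite.of_injective (β := Fin n → Fin (k + 1))
    (fun α i => ⟨α.1 i, Nat.lt_succ_of_le ((Finset.single_le_sum (f := α.1)
      (fun _ _ => Nat.zero_le _) (Finset.mem_univ i)).trans α.2)⟩) fun α β h => ?_
  ext i
  simpa using congrArg Fin.val (congrFun h i)

instance instFintypeMultiIndex (n k : ℕ) : Fintype (MultiIndex n k) := Fintype.ofFinite _

theorem sum_piAntidiag_prod_pow_div {𝕜 : Type*} [Field 𝕜] [CharZero 𝕜] {n : ℕ} (x : Fin n → 𝕜)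
    (l : ℕ) : ∑ α ∈ Finset.piAntidiag Finset.univ l, ∏ i, (x i ^ α i / ((α i).factorial : 𝕜)) =
      (∑ i, x i) ^ l / (l.factorial : 𝕜) := by
  have h0 : ∀ m : ℕ, (m.factorial : 𝕜) ≠ 0 := fun m => Nat.cast_ne_zero.2 m.factorial_ne_zero
  rw [Finset.sum_pow_eq_sum_piAntidiag, Finset.sum_div]
  refine Finset.sum_congr rfl fun α hα => ?_
  have hsum := (Finset.mem_piAntidiag.1 hα).1
  have hspec := Nat.multinomial_spec Finset.univ α
  rw [hsum] at hspec
  rw [Finset.prod_div_distrib, ← hspec]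
  push_cast
  have h1 : (∏ i, ((α i).factorial : 𝕜)) ≠ 0 := Finset.prod_ne_zero_iff.2 fun i _ => h0 _
  have h2 : (Nat.multinomial Finset.univ α : 𝕜) ≠ 0 := by
    intro h
    have := h0 l
    rw [← hspec] at this
    push_cast at this
    exact this (by rw [h, mul_zero])
  field_simp

/-- The multinomial theorem for truncated exponential series. -/
theorem sum_multiIndex_prod_pow_div {𝕜 : Type*} [Field 𝕜] [CharZero 𝕜] {n : ℕ} (k : ℕ)
    (x : Fin n → 𝕜) : ∑ α : MultiIndex n k, ∏ i, (x i ^ α.1 i / ((α.1 i).factorial : 𝕜)) =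
      ∑ l ∈ Finset.range (k + 1), (∑ i, x i) ^ l / (l.factorial : 𝕜) := by
  classical
  simp_rw [← sum_piAntidiag_prod_pow_div]
  rw [← Finset.sum_biUnion]
  · refine (Finset.sum_subtype _ (fun α => ?_)
      fun α : Fin n → ℕ => ∏ i, (x i ^ α i / ((α i).factorial : 𝕜))).symm
    simp [Finset.mem_piAntidiag]
  · intro a _ b _ hab
    rw [Function.onFun, Finset.disjoint_left]
    intro α ha hb
    exact hab ((Finset.mem_piAntidiag.1 ha).1.symm.trans (Finset.mem_piAntidiag.1 hb).1)

theorem sum_multiIndex_le_exp {n : ℕ} (k : ℕ) {x : Fin n → ℝ} (hx : ∀ i, 0 ≤ x i) :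
    ∑ α : MultiIndex n k, ∏ i, (x i ^ α.1 i / ((α.1 i).factorial : ℝ)) ≤
      Real.exp (∑ i, x i) := by
  rw [sum_multiIndex_prod_pow_div]
  have h0 : 0 ≤ ∑ i, x i := Finset.sum_nonneg fun i _ => hx i
  exact sum_le_hasSum _ (fun l _ => by positivity) (hasSum_pow_div_factorial _)

end MultiIndices

/-! ### Linearity of the synthesis in the symbol. -/

section LinearCombinations

variable {V : Type*} [NormedAddCommGroup V] [InnerProductSpace ℝ V] [FiniteDimensional ℝ V]
  [MeasurableSpace V] [BorelSpace V] {K : Set V} {g : V → ℂ}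

theorem BandFun.integrable_fourierChar_smul (hK : IsCompact K) (hg : BandFun K g) (x : V) :
    Integrable fun ξ => Real.fourierChar (inner ℝ ξ x) • g ξ := by
  refine ((hg.integrable hK).norm).mono' ?_ (.of_forall fun ξ => by rw [Circle.norm_smul])
  exact (by fun_prop : Continuous fun ξ : V =>
    Real.fourierChar (inner ℝ ξ x)).aestronglyMeasurable.smul hg.memLp.1

theorem fourierInv_sum_smul (hK : IsCompact K) (hg : BandFun K g) {ι : Type*} (s : Finset ι)
    {a : ι → V → ℂ} (ha : ∀ i, Continuous (a i)) (x : V) :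
    𝓕⁻ (fun ξ => (∑ i ∈ s, a i ξ) • g ξ) x = ∑ i ∈ s, 𝓕⁻ (fun ξ => a i ξ • g ξ) x := by
  simp only [Real.fourierInv_eq]
  rw [← integral_finsetSum]
  · simp only [Finset.sum_smul, Finset.smul_sum]
  · exact fun i _ => (hg.smul hK (ha i)).integrable_fourierChar_smul hK x

theorem fourierInv_const_mul_smul (c : ℂ) (a : V → ℂ) (x : V) :
    𝓕⁻ (fun ξ => (c * a ξ) • g ξ) x = c * 𝓕⁻ (fun ξ => a ξ • g ξ) x := by
  simp only [Real.fourierInv_eq]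
  rw [← integral_const_mul]
  refine integral_congr_ae (.of_forall fun ξ => ?_)
  simp only [Circle.smul_def, smul_eq_mul]
  ring

end LinearCombinations

/-! ### Taylor polynomials on the cells and the spatial quadratic form. -/

section Cells

variable {d : ℕ} {I : Type*}

/-- A partition of space up to null sets into star-shaped cells of radius at most `r`. -/
structure CellSystem (V : I → Set (Space d)) (z : I → Space d) (r : ℝ) : Prop where
  meas : ∀ n, MeasurableSet (V n)
  cover : ∀ᵐ x : Space d, x ∈ ⋃ n, V n
  disjoint : Pairwise fun n n' => volume (V n ∩ V n') = 0
  norm_le : ∀ n, ∀ x ∈ V n, ‖x - z n‖ ≤ r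
  star : ∀ n, ∀ x ∈ V n, ∀ τ ∈ Icc (0 : ℝ) 1, z n + τ • (x - z n) ∈ V n

/-- Lebesgue measure on `V n × ℝ`. -/
def cellMeasure (V : I → Set (Space d)) (n : I) : Measure (Space d × ℝ) :=
  volume.restrict (V n ×ˢ univ)

theorem cellMeasure_eq_prod (V : I → Set (Space d)) (n : I) :
    cellMeasure V n = ((volume : Measure (Space d)).restrict (V n)).prod (volume : Measure ℝ) := by
  rw [cellMeasure, Measure.volume_eq_prod, ← Measure.prod_restrict, Measure.restrict_univ]

variable {V : I → Set (Space d)} {z : I → Space d} {r : ℝ}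

theorem CellSystem.tsum_lintegral [Countable I] (hV : CellSystem V z r)
    (f : Space d × ℝ → ENNReal) : ∑' n, ∫⁻ q, f q ∂cellMeasure V n = ∫⁻ q, f q := by
  have h1 : ∀ n, NullMeasurableSet (V n ×ˢ (univ : Set ℝ)) (volume : Measure (Space d × ℝ)) :=
    fun n => ((hV.meas n).prod MeasurableSet.univ).nullMeasurableSet
  have h2 : Pairwise (Function.onFun (AEDisjoint (volume : Measure (Space d × ℝ)))
      fun n => V n ×ˢ (univ : Set ℝ)) := by
    intro n n' hn
    rw [Function.onFun, AEDisjoint, Set.prod_inter_prod, Measure.volume_eq_prod,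
      Measure.prod_prod, hV.disjoint hn, zero_mul]
  simp only [cellMeasure]
  rw [← lintegral_iUnion₀ h1 h2]
  have h3 : (⋃ n, V n ×ˢ (univ : Set ℝ)) =ᵐ[volume] (univ : Set (Space d × ℝ)) := by
    rw [← Set.iUnion_prod_const]
    refine Filter.eventuallyEq_univ.2 ?_
    filter_upwards [Measure.quasiMeasurePreserving_fst.ae hV.cover] with q hq
    exact ⟨hq, mem_univ _⟩
  rw [setLIntegral_congr h3, Measure.restrict_univ]

/-- The Taylor polynomial of order `k` in space about the centre of the cell `n`. -/
def taylorPoly (k : ℕ) (g : SpaceTime d → ℂ) (z : I → Space d) (n : I) (q : Space d × ℝ) : ℂ :=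
  ∑ α : MultiIndex (d - 1) k, (∏ i, (((q.1 i - z n i : ℝ) : ℂ) ^ α.1 i / ((α.1 i).factorial : ℂ))) *
    𝓕⁻ (fun ξ => spatialSymbol α.1 ξ • g ξ) (point (z n) q.2)

/-- `∫_{V_n} (x - z_n)^{2α} / α! dx`. -/
def cellWeight (V : I → Set (Space d)) (z : I → Space d) (n : I) (α : Fin (d - 1) → ℕ) : ENNReal :=
  ∫⁻ x in V n, ENNReal.ofReal (∏ i, ((x i - z n i) ^ 2) ^ α i / ((α i).factorial : ℝ))

/-- The square sum of the spatial samples, integrated over time. -/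
def spatialForm (V : I → Set (Space d)) (z : I → Space d) (k : ℕ) (g : SpaceTime d → ℂ) : ENNReal :=
  ∑' n, ∑ α : MultiIndex (d - 1) k, cellWeight V z n α.1 *
    ∫⁻ t, ‖𝓕⁻ (fun ξ => spatialSymbol α.1 ξ • g ξ) (point (z n) t)‖ₑ ^ 2

variable {K : Set (SpaceTime d)} {g : SpaceTime d → ℂ} {k : ℕ}

/-- By the multinomial theorem the sum over multi-indices regroups into powers of the symbol in
direction `q.1 - z n`, matching the partial sums of `hasSum_fourierInv_add`. -/
theorem taylorPoly_eq (hK : IsCompact K) (hg : BandFun K g) (n : I) (q : Space d × ℝ) :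
    taylorPoly k g z n q = ∑ l ∈ Finset.range (k + 1),
      𝓕⁻ (fun ξ => (dirSymbol (point (q.1 - z n) 0) ξ ^ l / (l.factorial : ℂ)) • g ξ)
        (point (z n) q.2) := by
  rw [taylorPoly, ← fourierInv_sum_smul hK hg _ (fun l => by fun_prop)]
  have e := dirSymbol_point_eq_sum (q.1 - z n)
  simp_rw [e, ← sum_multiIndex_prod_pow_div]
  rw [fourierInv_sum_smul hK hg _ (fun α => by fun_prop)]
  refine Finset.sum_congr rfl fun α _ => ?_
  rw [← fourierInv_const_mul_smul]
  refine congrArg (fun u : SpaceTime d → ℂ => 𝓕⁻ u (point (z n) q.2)) (funext fun ξ => ?_)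
  rw [spatialSymbol, ← Finset.prod_mul_distrib]
  congr 1
  refine Finset.prod_congr rfl fun i _ => ?_
  rw [mul_pow]
  simp
  ring

theorem continuous_fourierInv_time (hK : IsCompact K) (hg : BandFun K g) (w : Space d) :
    Continuous fun q : Space d × ℝ => 𝓕⁻ g (point w q.2) :=
  (continuous_fourierInv hK hg).comp
    (continuous_point.comp (by fun_prop : Continuous fun q : Space d × ℝ => (w, q.2)))

theorem measurable_taylorPoly (hK : IsCompact K) (hg : BandFun K g) (n : I) :
    Measurable (taylorPoly k g z n) := by
  unfold taylorPoly
  refine Finset.measurable_sum _ fun α _ => Measurable.mul ?_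
    (continuous_fourierInv_time hK (hg.smul hK (by fun_prop)) (z n)).measurable
  exact (by fun_prop : Continuous fun q : Space d × ℝ =>
    ∏ i, (((q.1 i - z n i : ℝ) : ℂ) ^ α.1 i / ((α.1 i).factorial : ℂ))).measurable

theorem lintegral_cellMeasure_mul {a : Space d → ENNReal} {b : ℝ → ENNReal} (ha : Measurable a)
    (hb : Measurable b) (n : I) :
    ∫⁻ q, a q.1 * b q.2 ∂cellMeasure V n = (∫⁻ x in V n, a x) * ∫⁻ t, b t := by
  rw [cellMeasure_eq_prod, lintegral_prod_mul ha.aemeasurable hb.aemeasurable]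

theorem spatialForm_eq (hK : IsCompact K) (hg : BandFun K g) :
    spatialForm V z k g = ∑' n, ∫⁻ q, ∑ α : MultiIndex (d - 1) k,
      ENNReal.ofReal (∏ i, ((q.1 i - z n i) ^ 2) ^ α.1 i / ((α.1 i).factorial : ℝ)) *
        ‖𝓕⁻ (fun ξ => spatialSymbol α.1 ξ • g ξ) (point (z n) q.2)‖ₑ ^ 2 ∂cellMeasure V n := by
  rw [spatialForm]
  refine tsum_congr fun n => ?_
  have hm1 : ∀ α : MultiIndex (d - 1) k, Measurable fun x : Space d =>
      ENNReal.ofReal (∏ i, ((x i - z n i) ^ 2) ^ α.1 i / ((α.1 i).factorial : ℝ)) := fun α =>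
    ENNReal.measurable_ofReal.comp (by fun_prop : Continuous fun x : Space d =>
      ∏ i, ((x i - z n i) ^ 2) ^ α.1 i / ((α.1 i).factorial : ℝ)).measurable
  have hm2 : ∀ α : MultiIndex (d - 1) k, Measurable fun t : ℝ =>
      ‖𝓕⁻ (fun ξ => spatialSymbol α.1 ξ • g ξ) (point (z n) t)‖ₑ ^ 2 := fun α =>
    (((continuous_fourierInv hK (hg.smul hK (continuous_spatialSymbol α.1))).measurable.comp
      (measurable_point_right (z n))).enorm).pow_const 2
  have hm3 : ∀ α : MultiIndex (d - 1) k, Measurable fun q : Space d × ℝ =>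
      ENNReal.ofReal (∏ i, ((q.1 i - z n i) ^ 2) ^ α.1 i / ((α.1 i).factorial : ℝ)) *
        ‖𝓕⁻ (fun ξ => spatialSymbol α.1 ξ • g ξ) (point (z n) q.2)‖ₑ ^ 2 := fun α =>
    ((hm1 α).comp measurable_fst).mul ((hm2 α).comp measurable_snd)
  rw [lintegral_finsetSum _ fun α _ => hm3 α]
  exact Finset.sum_congr rfl fun α _ => (lintegral_cellMeasure_mul (hm1 α) (hm2 α) n).symm

/-- Cauchy–Schwarz after splitting `1/α!` as `(1/√α!)²`: one factor contributes `∑ 1/α! ≤ e^(d-1)`,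
the other leaves exactly the weights of `spatialForm`. -/
theorem enorm_taylorPoly_sq_le (n : I) (q : Space d × ℝ) :
    ‖taylorPoly k g z n q‖ₑ ^ 2 ≤ ENNReal.ofReal (Real.exp (d - 1 : ℕ)) *
      ∑ α : MultiIndex (d - 1) k,
        ENNReal.ofReal (∏ i, ((q.1 i - z n i) ^ 2) ^ α.1 i / ((α.1 i).factorial : ℝ)) *
          ‖𝓕⁻ (fun ξ => spatialSymbol α.1 ξ • g ξ) (point (z n) q.2)‖ₑ ^ 2 := by
  set T : MultiIndex (d - 1) k → ℂ := fun α =>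
    𝓕⁻ (fun ξ => spatialSymbol α.1 ξ • g ξ) (point (z n) q.2)
  set h : Fin (d - 1) → ℝ := fun i => q.1 i - z n i
  have hpos : ∀ α : MultiIndex (d - 1) k,
      0 ≤ ∏ i, (h i ^ 2) ^ α.1 i / ((α.1 i).factorial : ℝ) := fun α =>
    Finset.prod_nonneg fun i _ => by positivity
  have h1 : ‖taylorPoly k g z n q‖ ≤ ∑ α : MultiIndex (d - 1) k,
      √(∏ i, ((1 : ℝ) ^ α.1 i / ((α.1 i).factorial : ℝ))) *
        (√(∏ i, (h i ^ 2) ^ α.1 i / ((α.1 i).factorial : ℝ)) * ‖T α‖) := by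
    refine (norm_sum_le _ _).trans (le_of_eq (Finset.sum_congr rfl fun α _ => ?_))
    rw [norm_mul, ← mul_assoc, ← Real.sqrt_mul (Finset.prod_nonneg fun i _ => by positivity),
      ← Finset.prod_mul_distrib]
    congr 1
    rw [eq_comm, Real.sqrt_eq_iff_mul_self_eq (Finset.prod_nonneg fun i _ => by positivity)
      (norm_nonneg _), norm_prod, ← Finset.prod_mul_distrib]
    refine Finset.prod_congr rfl fun i _ => ?_
    have e : (h i ^ 2) ^ α.1 i = |h i| ^ α.1 i * |h i| ^ α.1 i := by
      rw [← mul_pow, ← sq, sq_abs]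
    rw [norm_div, norm_pow, Complex.norm_real, Complex.norm_natCast, one_pow, Real.norm_eq_abs, e]
    ring
  have h2 : ‖taylorPoly k g z n q‖ ^ 2 ≤ Real.exp (d - 1 : ℕ) * ∑ α : MultiIndex (d - 1) k,
      (∏ i, (h i ^ 2) ^ α.1 i / ((α.1 i).factorial : ℝ)) * ‖T α‖ ^ 2 := by
    refine (pow_le_pow_left₀ (norm_nonneg _) h1 2).trans
      ((Finset.sum_mul_sq_le_sq_mul_sq _ _ _).trans ?_)
    refine mul_le_mul ?_ (le_of_eq ?_) (Finset.sum_nonneg fun _ _ => sq_nonneg _)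
      (Real.exp_pos _).le
    · have := sum_multiIndex_le_exp k (n := d - 1) (x := fun _ => 1) fun _ => zero_le_one
      simp only [Finset.sum_const, Finset.card_univ, Fintype.card_fin, nsmul_eq_mul,
        mul_one] at this
      refine le_trans (le_of_eq (Finset.sum_congr rfl fun α _ => ?_)) this
      exact Real.sq_sqrt (Finset.prod_nonneg fun i _ => by positivity)
    · refine Finset.sum_congr rfl fun α _ => ?_
      rw [mul_pow, Real.sq_sqrt (hpos α)]
  have h3 : ∑ α : MultiIndex (d - 1) k,
        ENNReal.ofReal (∏ i, (h i ^ 2) ^ α.1 i / ((α.1 i).factorial : ℝ)) * ‖T α‖ₑ ^ 2 =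
      ENNReal.ofReal (∑ α : MultiIndex (d - 1) k,
        (∏ i, (h i ^ 2) ^ α.1 i / ((α.1 i).factorial : ℝ)) * ‖T α‖ ^ 2) := by
    rw [ENNReal.ofReal_sum_of_nonneg fun α _ => mul_nonneg (hpos α) (by positivity)]
    refine Finset.sum_congr rfl fun α _ => ?_
    rw [ENNReal.ofReal_mul (hpos α), ENNReal.ofReal_pow (norm_nonneg _), ofReal_norm]
  change _ ≤ _ * ∑ α : MultiIndex (d - 1) k,
    ENNReal.ofReal (∏ i, (h i ^ 2) ^ α.1 i / ((α.1 i).factorial : ℝ)) * ‖T α‖ₑ ^ 2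
  rw [h3, ← ENNReal.ofReal_mul (Real.exp_pos _).le, ← ofReal_norm,
    ← ENNReal.ofReal_pow (norm_nonneg _)]
  exact ENNReal.ofReal_le_ofReal h2

/-- The lower spatial sampling bound from an estimate of the Taylor remainder. -/
theorem spatialForm_lower [Countable I] (hV : CellSystem V z r) (hK : IsCompact K)
    (hg : BandFun K g) {η : ℝ} (hη : 0 ≤ η) (hη1 : η ≤ 1)
    (hD : ∑' n, ∫⁻ q, ‖𝓕⁻ g (point q.1 q.2) - taylorPoly k g z n q‖ₑ ^ 2 ∂cellMeasure V n ≤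
      ENNReal.ofReal (η ^ 2) * ∫⁻ ξ, ‖g ξ‖ₑ ^ 2) :
    ENNReal.ofReal (Real.exp (-(d - 1 : ℕ)) * (1 - η) ^ 2) * ∫⁻ ξ, ‖g ξ‖ₑ ^ 2 ≤
      spatialForm V z k g := by
  have h1 := (tsum_lintegral_perturbed (cellMeasure V) (f := fun _ q => 𝓕⁻ g (point q.1 q.2))
    (fun _ => (continuous_fourierInv_point hK hg).measurable)
    (fun n => measurable_taylorPoly hK hg n) hη hg.lintegral_lt_top
    (by rw [hV.tsum_lintegral, lintegral_fourierInv_point hK hg]) hD).1 hη1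
  have h2 : ∑' n, ∫⁻ q, ‖taylorPoly k g z n q‖ₑ ^ 2 ∂cellMeasure V n ≤
      ENNReal.ofReal (Real.exp (d - 1 : ℕ)) * spatialForm V z k g := by
    rw [spatialForm_eq hK hg, ← ENNReal.tsum_mul_left]
    refine ENNReal.tsum_le_tsum fun n => ?_
    rw [← lintegral_const_mul' _ _ (by finiteness)]
    exact lintegral_mono fun q => enorm_taylorPoly_sq_le n q
  rw [ENNReal.ofReal_mul (Real.exp_pos _).le, mul_assoc]
  refine (mul_le_mul_right (h1.trans h2) _).trans (le_of_eq ?_)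
  rw [← mul_assoc, ← ENNReal.ofReal_mul (Real.exp_pos _).le, ← Real.exp_add]
  simp

/-- The sum is a truncated exponential series in `r² ∑ (2π ξ_i)²`, which is at most `(rM)²`. -/
theorem sum_norm_spatialSymbol_le {M : ℝ} (hr : 0 ≤ r) {ξ : SpaceTime d}
    (hM : 2 * Real.pi * ‖ξ.fst‖ ≤ M) :
    ∑ α : MultiIndex (d - 1) k, (∏ i, (r ^ 2) ^ α.1 i / ((α.1 i).factorial : ℝ)) *
      ‖spatialSymbol α.1 ξ‖ ^ 2 ≤ Real.exp ((r * M) ^ 2) := by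
  have hπ := Real.pi_pos
  have h := sum_multiIndex_le_exp k (x := fun i => r ^ 2 * (2 * Real.pi * ξ.fst i) ^ 2)
    fun i => by positivity
  refine le_trans (le_of_eq (Finset.sum_congr rfl fun α _ => ?_)) (h.trans ?_)
  · rw [spatialSymbol, norm_prod, ← Finset.prod_pow, ← Finset.prod_mul_distrib]
    refine Finset.prod_congr rfl fun i _ => ?_
    rw [norm_pow, dirSymbol_point_single]
    have : ‖(2 * Real.pi * Complex.I * (ξ.fst i : ℝ) : ℂ)‖ = |2 * Real.pi * ξ.fst i| := by
      simp [abs_mul, abs_of_pos hπ]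
    rw [this, ← pow_mul |_|, mul_comm _ 2, pow_mul |_|, sq_abs, mul_pow (r ^ 2)]
    ring
  · refine Real.exp_le_exp.2 ?_
    rw [← Finset.mul_sum]
    simp_rw [mul_pow (2 * Real.pi)]
    rw [← Finset.mul_sum, ← EuclideanSpace.real_norm_sq_eq, ← mul_pow, ← mul_pow]
    gcongr

/-- The upper spatial sampling bound from a bound for sampling of function values. -/
theorem spatialForm_upper [Countable I] (hV : CellSystem V z r) (hr : 0 ≤ r) (hK : IsCompact K)
    (hg : BandFun K g) {M κ : ℝ} (hM : ∀ ξ ∈ K, 2 * Real.pi * ‖ξ.fst‖ ≤ M)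
    (hκ : ∀ u : SpaceTime d → ℂ, BandFun K u →
      ∑' n, ∫⁻ q, ‖𝓕⁻ u (point (z n) q.2)‖ₑ ^ 2 ∂cellMeasure V n ≤
        ENNReal.ofReal (κ ^ 2) * ∫⁻ ξ, ‖u ξ‖ₑ ^ 2) :
    spatialForm V z k g ≤
      ENNReal.ofReal (κ ^ 2 * Real.exp ((r * M) ^ 2)) * ∫⁻ ξ, ‖g ξ‖ₑ ^ 2 := by
  -- On `V n` each coordinate of `x - z n` is at most `r` in modulus, so `cellWeight` is at most `c
  -- α` times the volume of `V n`.
  set c : MultiIndex (d - 1) k → ℝ := fun α => ∏ i, (r ^ 2) ^ α.1 i / ((α.1 i).factorial : ℝ)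
  have hc : ∀ α, 0 ≤ c α := fun α => Finset.prod_nonneg fun i _ => by positivity
  have hgα : ∀ α : MultiIndex (d - 1) k, BandFun K fun ξ => spatialSymbol α.1 ξ • g ξ :=
    fun α => hg.smul hK (by fun_prop)
  have h1 : spatialForm V z k g ≤ ∑' n, ∑ α : MultiIndex (d - 1) k, ENNReal.ofReal (c α) *
      ∫⁻ q, ‖𝓕⁻ (fun ξ => spatialSymbol α.1 ξ • g ξ) (point (z n) q.2)‖ₑ ^ 2 ∂cellMeasure V n := by
    refine ENNReal.tsum_le_tsum fun n => Finset.sum_le_sum fun α _ => ?_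
    have hm2 : Measurable fun t : ℝ =>
        ‖𝓕⁻ (fun ξ => spatialSymbol α.1 ξ • g ξ) (point (z n) t)‖ₑ ^ 2 :=
      (((continuous_fourierInv hK (hgα α)).measurable.comp
        (measurable_point_right (z n))).enorm).pow_const 2
    have h2 := lintegral_cellMeasure_mul (V := V) (a := fun _ => 1) measurable_const hm2 n
    simp only [one_mul] at h2
    rw [h2, ← mul_assoc]
    gcongr
    rw [cellWeight, ← lintegral_const_mul' _ _ (by finiteness)]
    refine setLIntegral_mono' (hV.meas n) fun x hx => ?_
    rw [mul_one]
    refine ENNReal.ofReal_le_ofReal (Finset.prod_le_prod (fun i _ => by positivity) fun i _ => ?_)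
    have h3 : |x i - z n i| ≤ r := (PiLp.norm_apply_le (x - z n) i).trans (hV.norm_le n x hx)
    have h4 : (x i - z n i) ^ 2 ≤ r ^ 2 := sq_le_sq' (abs_le.1 h3).1 (abs_le.1 h3).2
    gcongr
  refine h1.trans ?_
  rw [Summable.tsum_finsetSum fun _ _ => ENNReal.summable]
  simp_rw [ENNReal.tsum_mul_left]
  have h5 : ∀ α : MultiIndex (d - 1) k, AEMeasurable fun ξ => ENNReal.ofReal (c α) *
      ‖spatialSymbol α.1 ξ • g ξ‖ₑ ^ 2 := fun α =>
    ((hgα α).memLp.1.enorm.pow_const 2).const_mul _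
  calc _ ≤ ∑ α : MultiIndex (d - 1) k, ENNReal.ofReal (c α) *
        (ENNReal.ofReal (κ ^ 2) * ∫⁻ ξ, ‖spatialSymbol α.1 ξ • g ξ‖ₑ ^ 2) := by
        gcongr with α
        exact hκ _ (hgα α)
    _ = ENNReal.ofReal (κ ^ 2) * ∫⁻ ξ, ∑ α : MultiIndex (d - 1) k, ENNReal.ofReal (c α) *
        ‖spatialSymbol α.1 ξ • g ξ‖ₑ ^ 2 := by
        rw [lintegral_finsetSum' _ fun α _ => h5 α, Finset.mul_sum]
        refine Finset.sum_congr rfl fun α _ => ?_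
        rw [lintegral_const_mul' _ _ (by finiteness)]
        ring
    _ ≤ ENNReal.ofReal (κ ^ 2) * ∫⁻ ξ, ENNReal.ofReal (Real.exp ((r * M) ^ 2)) * ‖g ξ‖ₑ ^ 2 := by
        gcongr with ξ
        by_cases hξ : ξ ∈ K
        · have h6 : ∑ α : MultiIndex (d - 1) k, ENNReal.ofReal (c α) *
              ‖spatialSymbol α.1 ξ • g ξ‖ₑ ^ 2 = ENNReal.ofReal (∑ α : MultiIndex (d - 1) k, c α *
                ‖spatialSymbol α.1 ξ‖ ^ 2) * ‖g ξ‖ₑ ^ 2 := by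
            rw [ENNReal.ofReal_sum_of_nonneg fun α _ => mul_nonneg (hc α) (by positivity),
              Finset.sum_mul]
            refine Finset.sum_congr rfl fun α _ => ?_
            rw [ENNReal.ofReal_mul (hc α), ENNReal.ofReal_pow (norm_nonneg _), ofReal_norm,
              enorm_smul, mul_pow, mul_assoc]
          rw [h6]
          gcongr
          exact sum_norm_spatialSymbol_le hr (hM ξ hξ)
        · simp [hg.zero_off ξ hξ]
    _ = _ := by
        rw [lintegral_const_mul' _ _ (by finiteness), ← mul_assoc,
          ← ENNReal.ofReal_mul (by positivity)]

end Cells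

/-! ### Consequences of a maximal-function bound. -/

section SpatialEstimates

variable {d : ℕ} {I : Type*} [Countable I] {V : I → Set (Space d)} {z : I → Space d} {r : ℝ}
  {K : Set (SpaceTime d)} {g : SpaceTime d → ℂ} {k : ℕ}

/-- Seen from any `q` in the cell, the centre is a displacement of length at most `r`, so the value
there is at most `W q`. -/
theorem MaxBound.tsum_lintegral_le {κ : ℝ} (hmax : MaxBound K r κ) (hκ : 0 ≤ κ)
    (hV : CellSystem V z r) (hg : BandFun K g) :
    ∑' n, ∫⁻ q, ‖𝓕⁻ g (point (z n) q.2)‖ₑ ^ 2 ∂cellMeasure V n ≤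
      ENNReal.ofReal (κ ^ 2) * ∫⁻ ξ, ‖g ξ‖ₑ ^ 2 := by
  obtain ⟨W, -, hW, hWi⟩ := hmax ℂ g hg
  rw [ENNReal.ofReal_pow hκ]
  refine le_trans ?_ hWi
  rw [← hV.tsum_lintegral]
  refine ENNReal.tsum_le_tsum fun n => ?_
  refine setLIntegral_mono' ((hV.meas n).prod MeasurableSet.univ) fun q hq => ?_
  refine pow_le_pow_left₀ zero_le ?_ 2
  have := hW q.1 q.2 (z n - q.1) (by rw [norm_sub_rev]; exact hV.norm_le n _ hq.1)
  rwa [add_sub_cancel] at this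

/-- The Taylor remainder in terms of the local maximal function. -/
theorem MaxBound.taylor_remainder_le {κ M : ℝ} (hmax : MaxBound K r κ) (hκ : 0 ≤ κ) (hr : 0 ≤ r)
    (hM0 : 0 ≤ M) (hM : ∀ ξ ∈ K, 2 * Real.pi * ‖ξ.fst‖ ≤ M)
    (hV : CellSystem V z r) (hK : IsCompact K) (hg : BandFun K g) :
    ∑' n, ∫⁻ q, ‖𝓕⁻ g (point q.1 q.2) - taylorPoly k g z n q‖ₑ ^ 2 ∂cellMeasure V n ≤
      ENNReal.ofReal ((κ * expRemainder k (r * M)) ^ 2) * ∫⁻ ξ, ‖g ξ‖ₑ ^ 2 := by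
  -- `MaxBound` covers all Hilbert-space-valued functions so that it applies to the derivative
  -- tensors of every order. The Taylor terms live at the centre `z n`, and the maximal function
  -- transfers them to the running point `q`, where Plancherel is available.
  choose W hWm hW hWi using fun l : ℕ => hmax _ (tensorDensity l g) (hg.tensorDensity hK l)
  set c : ℕ → ENNReal := fun l => ENNReal.ofReal (r ^ (l + (k + 1)) / (l + (k + 1)).factorial)
  have hpt : ∀ n, ∀ q : Space d × ℝ, q.1 ∈ V n →
      ‖𝓕⁻ g (point q.1 q.2) - taylorPoly k g z n q‖ₑ ≤ ∑' l, c l * W (l + (k + 1)) q := by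
    intro n q hq
    have hsum := hasSum_fourierInv_add hK hg (point (z n) q.2) (point (q.1 - z n) 0)
    rw [← point_add, add_zero, add_sub_cancel] at hsum
    have htail := (hasSum_nat_add_iff' (k + 1)).2 hsum
    rw [taylorPoly_eq hK hg, ← htail.tsum_eq]
    refine enorm_tsum_le_tsum_enorm.trans (ENNReal.tsum_le_tsum fun l => ?_)
    refine (enorm_fourierInv_dirSymbol_pow_le hK hg _ (hV.norm_le n _ hq) _).trans ?_
    refine mul_le_mul_right ?_ _
    have := hW (l + (k + 1)) q.1 q.2 (z n - q.1)
      (by rw [norm_sub_rev]; exact hV.norm_le n _ hq)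
    rwa [add_sub_cancel] at this
  calc _ ≤ ∑' n, ∫⁻ q, (∑' l, c l * W (l + (k + 1)) q) ^ 2 ∂cellMeasure V n :=
        ENNReal.tsum_le_tsum fun n => setLIntegral_mono'
          ((hV.meas n).prod MeasurableSet.univ) fun q hq =>
          pow_le_pow_left₀ zero_le (hpt n q hq.1) 2
    _ = ∫⁻ q, (∑' l, c l * W (l + (k + 1)) q) ^ 2 := hV.tsum_lintegral _
    _ ≤ (∑' l : ℕ, ENNReal.ofReal (κ * ((r * M) ^ (l + (k + 1)) / (l + (k + 1)).factorial))) ^ 2 *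
          ∫⁻ ξ, ‖g ξ‖ₑ ^ 2 := by
        refine lintegral_tsum_sq_le (fun l => ((hWm _).const_mul _).aemeasurable) fun l => ?_
        simp_rw [mul_pow]
        rw [lintegral_const_mul' _ _ (by finiteness)]
        refine (mul_le_mul_right ((hWi _).trans
          (mul_le_mul_right (lintegral_tensorDensity_le hg hM _) _)) _).trans (le_of_eq ?_)
        rw [← mul_assoc, ← mul_assoc, ← mul_pow, ← mul_pow, ← ENNReal.ofReal_mul (by positivity),
          ← ENNReal.ofReal_mul (by positivity)]
        congr 3
        ring
    _ = _ := by
        rw [← ENNReal.ofReal_tsum_of_nonneg (fun l => by positivity)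
          ((hasSum_expRemainder k (r * M)).mul_left κ).summable,
          ((hasSum_expRemainder k (r * M)).mul_left κ).tsum_eq, ENNReal.ofReal_pow]
        exact mul_nonneg hκ ((hasSum_expRemainder k (r * M)).nonneg fun l => by positivity)

end SpatialEstimates

/-! ### One spatial dimension. -/

section OneDimensional

theorem measurePreserving_smul_single :
    MeasurePreserving fun s : ℝ => s • (EuclideanSpace.single 0 1 : EuclideanSpace ℝ (Fin 1)) := by
  have h1 : MeasurePreserving (MeasurableEquiv.funUnique (Fin 1) ℝ).symm volume volume := by
    convert! (volume_preserving_funUnique (Fin 1) ℝ).symm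
  have h2 := (PiLp.volume_preserving_toLp (Fin 1)).comp h1
  convert! h2 using 1
  ext s i
  obtain rfl := Subsingleton.elim i 0
  simp [MeasurableEquiv.funUnique]

variable {d : ℕ}

/-- When `d = 2` space is an isometric copy of `ℝ`, so cell integrals become integrals over subsets
of the line. -/
theorem exists_unit_vector (hd : d = 2) : ∃ e : Space d, ‖e‖ = 1 ∧
    MeasurePreserving (fun s : ℝ => s • e) ∧ MeasurableEmbedding (fun s : ℝ => s • e) := by
  subst hd
  change ∃ e : EuclideanSpace ℝ (Fin 1), ‖e‖ = 1 ∧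
    MeasurePreserving (fun s : ℝ => s • e) ∧ MeasurableEmbedding (fun s : ℝ => s • e)
  have he : ‖(EuclideanSpace.single 0 1 : EuclideanSpace ℝ (Fin 1))‖ = 1 := by simp
  refine ⟨_, he, measurePreserving_smul_single, ?_⟩
  exact (isClosedEmbedding_smul_left
    (norm_ne_zero_iff.1 (by rw [he]; exact one_ne_zero))).measurableEmbedding

variable {I : Type*} [Countable I] {V : I → Set (Space d)} {z : I → Space d} {r : ℝ}
  {K : Set (SpaceTime d)} {g : SpaceTime d → ℂ} {k : ℕ}

/-- At fixed time the cell is a star-shaped subset of a line, so the one-dimensional remainder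
estimate applies; after summing over cells, Bernstein bounds the derivative of order `k + 1` by
`M^(k+1)`. -/
theorem lintegral_cellMeasure_taylor_le (hd : d = 2) {c M : ℝ} (hW : SmoothWirtinger c (k + 1))
    (hc : 0 ≤ c) (hM : ∀ ξ ∈ K, 2 * Real.pi * ‖ξ.fst‖ ≤ M) (hM0 : 0 ≤ M) (hr : 0 ≤ r)
    (hV : CellSystem V z r) (hK : IsCompact K) (hg : BandFun K g) :
    ∑' n, ∫⁻ q, ‖𝓕⁻ g (point q.1 q.2) - taylorPoly k g z n q‖ₑ ^ 2 ∂cellMeasure V n ≤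
      ENNReal.ofReal (((c * (r * M)) ^ (k + 1)) ^ 2) * ∫⁻ ξ, ‖g ξ‖ₑ ^ 2 := by
  obtain ⟨e, he, hmp, hemb⟩ := exists_unit_vector hd
  set a : SpaceTime d → ℂ := dirSymbol (point e 0)
  have hac : Continuous a := continuous_dirSymbol _
  have hgj : ∀ j : ℕ, BandFun K fun ξ => a ξ ^ j • g ξ := fun j => hg.smul hK (by fun_prop)
  have htr : ∀ (n : I) (f : Space d × ℝ → ENNReal), Measurable f →
      ∫⁻ q, f q ∂cellMeasure V n =
        ∫⁻ t, ∫⁻ s in (fun s : ℝ => z n + s • e) ⁻¹' V n, f (z n + s • e, t) := by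
    intro n f hf
    rw [cellMeasure_eq_prod, lintegral_prod_symm _ hf.aemeasurable]
    refine lintegral_congr fun t => ?_
    have hmp' : MeasurePreserving fun s : ℝ => z n + s • e :=
      (measurePreserving_add_left volume (z n)).comp hmp
    exact (hmp'.setLIntegral_comp_preimage_emb
      ((measurableEmbedding_addLeft (z n)).comp hemb) _ _).symm
  have hm1 : ∀ n, Measurable fun q : Space d × ℝ =>
      ‖𝓕⁻ g (point q.1 q.2) - taylorPoly k g z n q‖ₑ ^ 2 := fun n =>
    (((continuous_fourierInv_point hK hg).measurable.sub
      (measurable_taylorPoly hK hg n)).enorm).pow_const 2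
  have hm2 : Measurable fun q : Space d × ℝ =>
      ‖𝓕⁻ (fun ξ => a ξ ^ (k + 1) • g ξ) (point q.1 q.2)‖ₑ ^ 2 :=
    ((continuous_fourierInv_point hK (hgj _)).measurable.enorm).pow_const 2
  have hcell : ∀ n, ∫⁻ q, ‖𝓕⁻ g (point q.1 q.2) - taylorPoly k g z n q‖ₑ ^ 2 ∂cellMeasure V n ≤
      ENNReal.ofReal ((c * r) ^ (2 * (k + 1))) *
        ∫⁻ q, ‖𝓕⁻ (fun ξ => a ξ ^ (k + 1) • g ξ) (point q.1 q.2)‖ₑ ^ 2 ∂cellMeasure V n := by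
    intro n
    rw [htr n _ (hm1 n), htr n _ hm2, ← lintegral_const_mul' _ _ (by finiteness)]
    refine lintegral_mono fun t => ?_
    set u : ℕ → ℝ → ℂ := fun j s => 𝓕⁻ (fun ξ => a ξ ^ j • g ξ) (point (z n + s • e) t) with hu
    have hderiv : ∀ j s, HasDerivAt (u j) (u (j + 1) s) s := by
      intro j s
      have h := hasDerivAt_fourierInv hK (hgj j) (point (z n) t) (point e 0) s
      simp only [← point_add_smul, smul_smul] at h
      simpa only [hu, pow_succ'] using h
    have hS : MeasurableSet ((fun s : ℝ => z n + s • e) ⁻¹' V n) :=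
      (by fun_prop : Measurable fun s : ℝ => z n + s • e) (hV.meas n)
    have h := hW.taylor_le hc hderiv hS (r := r) (fun s hs => by
        have := hV.norm_le n _ hs
        rw [add_sub_cancel_left, norm_smul, he, mul_one] at this
        exact abs_le.1 this)
      (fun s hs τ hτ => by
        have := hV.star n _ hs τ hτ
        rwa [add_sub_cancel_left, smul_smul] at this)
    refine le_trans (le_of_eq ?_) h
    refine lintegral_congr fun s => ?_
    rw [taylorPoly_eq hK hg]
    simp only [hu, pow_zero, one_smul, zero_smul, add_zero, add_sub_cancel_left]
    congr 4 with l
    rw [← fourierInv_const_mul_smul]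
    refine congrArg (fun u : SpaceTime d → ℂ => 𝓕⁻ u (point (z n) t)) (funext fun ξ => ?_)
    have : dirSymbol (point (s • e) 0) ξ = s * a ξ := by
      simp only [a, dirSymbol_point_space, inner_smul_right]
      push_cast
      ring
    rw [this, mul_pow]
    congr 1
    ring
  calc _ ≤ ∑' n, ENNReal.ofReal ((c * r) ^ (2 * (k + 1))) *
        ∫⁻ q, ‖𝓕⁻ (fun ξ => a ξ ^ (k + 1) • g ξ) (point q.1 q.2)‖ₑ ^ 2 ∂cellMeasure V n :=
        ENNReal.tsum_le_tsum hcell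
    _ = ENNReal.ofReal ((c * r) ^ (2 * (k + 1))) * ∫⁻ ξ, ‖a ξ ^ (k + 1) • g ξ‖ₑ ^ 2 := by
        rw [ENNReal.tsum_mul_left, hV.tsum_lintegral, lintegral_fourierInv_point hK (hgj _)]
    _ ≤ ENNReal.ofReal ((c * r) ^ (2 * (k + 1))) *
        (ENNReal.ofReal (M ^ (k + 1)) ^ 2 * ∫⁻ ξ, ‖g ξ‖ₑ ^ 2) := by
        gcongr
        refine hg.lintegral_smul_le fun ξ hξ => ?_
        rw [norm_pow]
        gcongr
        rw [norm_dirSymbol, inner_point]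
        refine le_trans ?_ (hM ξ hξ)
        have := abs_real_inner_le_norm ξ.fst e
        rw [he, mul_one] at this
        have hπ := Real.pi_pos
        simp only [mul_zero, add_zero]
        gcongr
    _ = _ := by
        rw [← mul_assoc, ← ENNReal.ofReal_pow (by positivity), ← ENNReal.ofReal_mul (by positivity)]
        congr 2
        ring

/-- This is the case `k = 0` with constant `2/π`: the Taylor polynomial is the value at the centre,
and the triangle inequality concludes. -/
theorem tsum_lintegral_center_le (hd : d = 2) {M : ℝ}
    (hM : ∀ ξ ∈ K, 2 * Real.pi * ‖ξ.fst‖ ≤ M) (hM0 : 0 ≤ M) (hr : 0 ≤ r)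
    (hV : CellSystem V z r) (hK : IsCompact K) (hg : BandFun K g) :
    ∑' n, ∫⁻ q, ‖𝓕⁻ g (point (z n) q.2)‖ₑ ^ 2 ∂cellMeasure V n ≤
      ENNReal.ofReal ((1 + 2 * (r * M) / Real.pi) ^ 2) * ∫⁻ ξ, ‖g ξ‖ₑ ^ 2 := by
  have hπ := Real.pi_pos
  have h0 : ∀ n q, taylorPoly 0 g z n q = 𝓕⁻ g (point (z n) q.2) := by
    intro n q
    rw [taylorPoly_eq hK hg]
    simp
  have hD := lintegral_cellMeasure_taylor_le (k := 0) hd smoothWirtinger_two_div_pi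
    (by positivity) hM hM0 hr hV hK hg
  have e : 2 / Real.pi * (r * M) = 2 * (r * M) / Real.pi := by ring
  simp only [h0, zero_add, pow_one, e] at hD
  exact (tsum_lintegral_perturbed (cellMeasure V) (f := fun _ q => 𝓕⁻ g (point q.1 q.2))
    (g := fun n q => 𝓕⁻ g (point (z n) q.2))
    (fun _ => (continuous_fourierInv_point hK hg).measurable)
    (fun n => (continuous_fourierInv_time hK hg (z n)).measurable) (by positivity)
    hg.lintegral_lt_top (by rw [hV.tsum_lintegral, lintegral_fourierInv_point hK hg]) hD).2

end OneDimensional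

/-! ### The functions `h_k`, `g_{k,d}` and their inverses at `1`. -/

section Constants

theorem expRemainder_nonneg (k : ℕ) {x : ℝ} (hx : 0 ≤ x) : 0 ≤ expRemainder k x :=
  (hasSum_expRemainder k x).nonneg fun n => by positivity

theorem expRemainder_zero (k : ℕ) : expRemainder k 0 = 0 := by
  rw [expRemainder, Finset.sum_range_succ']
  simp

theorem expRemainder_eq_add (k : ℕ) (x : ℝ) :
    expRemainder k x = x ^ (k + 1) / (k + 1).factorial + expRemainder (k + 1) x := by
  rw [expRemainder, expRemainder, Finset.sum_range_succ _ (k + 1)]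
  ring

theorem continuous_expRemainder (k : ℕ) : Continuous (expRemainder k) := by
  unfold expRemainder
  fun_prop

theorem expRemainder_mono (k : ℕ) {x y : ℝ} (hx : 0 ≤ x) (hxy : x ≤ y) :
    expRemainder k x ≤ expRemainder k y :=
  hasSum_le (fun n => by gcongr) (hasSum_expRemainder k x) (hasSum_expRemainder k y)

theorem expRemainder_strictMono (k : ℕ) {x y : ℝ} (hx : 0 ≤ x) (hxy : x < y) :
    expRemainder k x < expRemainder k y := by
  rw [expRemainder_eq_add k x, expRemainder_eq_add k y]
  refine add_lt_add_of_lt_of_le ?_ (expRemainder_mono _ hx hxy.le)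
  gcongr

/-- The first term of the tail is already at least `1` here. The point serves as right endpoint for
the intermediate value theorem. -/
theorem one_le_expRemainder_factorial (k : ℕ) : 1 ≤ expRemainder k (k + 1).factorial := by
  have h1 : (1 : ℝ) ≤ (k + 1).factorial := by exact_mod_cast Nat.factorial_pos (k + 1)
  rw [expRemainder_eq_add]
  have h2 := expRemainder_nonneg (k + 1) (zero_le_one.trans h1)
  have h3 : (1 : ℝ) ≤ ((k + 1).factorial : ℝ) ^ (k + 1) / (k + 1).factorial := by
    rw [le_div_iff₀ (by positivity), one_mul]
    exact le_self_pow₀ h1 k.succ_ne_zero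
  linarith

/-- A product `A · R_k` stays below `1` to the left of the value of its inverse function at `1`. -/
theorem lt_one_of_lt_invFunOn {k : ℕ} {A φ : ℝ → ℝ} (hA1 : ∀ x, 0 ≤ x → 1 ≤ A x)
    (hAm : MonotoneOn A (Ici 0)) (hAc : ContinuousOn A (Ioi 0))
    (hφ : ∀ x, φ x = A x * expRemainder k x) {θ : ℝ} (hθ : 0 ≤ θ)
    (h : θ < Function.invFunOn φ (Ioi 0) 1) : φ θ < 1 := by
  -- `Function.invFunOn` returns an arbitrary value unless a preimage exists, so one is produced by
  -- the intermediate value theorem. Near `0` monotonicity replaces `A` by `A 1`, so no continuity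
  -- of `A` at `0` is needed.
  have hex : ∃ y ∈ Ioi (0 : ℝ), φ y = 1 := by
    have hB1 : (1 : ℝ) ≤ (k + 1).factorial := by exact_mod_cast Nat.factorial_pos (k + 1)
    have hlim : Filter.Tendsto (fun x => A 1 * expRemainder k x) (nhdsWithin 0 (Ioi 0))
        (nhds (A 1 * expRemainder k 0)) :=
      ((continuous_const.mul (continuous_expRemainder k)).tendsto 0).mono_left nhdsWithin_le_nhds
    rw [expRemainder_zero, mul_zero] at hlim
    obtain ⟨ε, hε1, hε⟩ := ((hlim.eventually_lt_const one_pos).and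
      (Ioo_mem_nhdsGT (one_pos : (0 : ℝ) < 1))).exists
    have hεB : ε ≤ (k + 1).factorial := hε.2.le.trans hB1
    have hφε : φ ε ≤ 1 := by
      rw [hφ]
      exact (mul_le_mul_of_nonneg_right (hAm hε.1.le (mem_Ici.2 zero_le_one) hε.2.le)
        (expRemainder_nonneg k hε.1.le)).trans hε1.le
    have hφB : 1 ≤ φ (k + 1).factorial := by
      rw [hφ]
      exact one_le_mul_of_one_le_of_one_le (hA1 _ (by positivity)) (one_le_expRemainder_factorial k)
    have hc : ContinuousOn φ (Icc ε (k + 1).factorial) := by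
      rw [funext hφ]
      exact (hAc.mono fun x hx => hε.1.trans_le hx.1).mul (continuous_expRemainder k).continuousOn
    obtain ⟨y, hy, hy1⟩ := intermediate_value_Icc hεB hc ⟨hφε, hφB⟩
    exact ⟨y, hε.1.trans_le hy.1, hy1⟩
  have h1 := Function.invFunOn_eq hex
  rw [← h1, hφ, hφ]
  set y := Function.invFunOn φ (Ioi 0) 1
  have hy : 0 ≤ y := hθ.trans h.le
  calc A θ * expRemainder k θ ≤ A y * expRemainder k θ :=
        mul_le_mul_of_nonneg_right (hAm hθ hy h.le) (expRemainder_nonneg k hθ)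
    _ < A y * expRemainder k y :=
        mul_lt_mul_of_pos_left (expRemainder_strictMono k hθ h) (zero_lt_one.trans_le (hA1 y hy))

theorem hFun_lt_one {k : ℕ} {θ : ℝ} (hθ : 0 ≤ θ) (h : θ < hInv k 1) : hFun k θ < 1 :=
  lt_one_of_lt_invFunOn (A := Real.exp) (fun _ hx => Real.one_le_exp hx)
    (Real.exp_monotone.monotoneOn _) Real.continuous_exp.continuousOn (fun _ => rfl) hθ h

theorem sigmaStar_nonneg (d : ℕ) {x : ℝ} (hx : 0 ≤ x) : 0 ≤ sigmaStar d x := by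
  unfold sigmaStar
  positivity

theorem sigmaStar_pos {d : ℕ} (hd : 0 < d) {x : ℝ} (hx : 0 < x) : 0 < sigmaStar d x := by
  have : (0 : ℝ) < d := by exact_mod_cast hd
  unfold sigmaStar
  positivity

theorem sigmaStar_mono (d : ℕ) {x y : ℝ} (hx : 0 ≤ x) (hxy : x ≤ y) :
    sigmaStar d x ≤ sigmaStar d y := by
  unfold sigmaStar
  gcongr
  exact hx.trans hxy

/-- The reciprocal `σ*(x)/x` equals `(1 + √(1 + d/x)) / d`, which decreases in `x`. At `x = 0` the
quotient is `0` by the convention for division. -/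
theorem div_sigmaStar_mono {d : ℕ} (hd : 0 < d) {x y : ℝ} (hx : 0 ≤ x) (hxy : x ≤ y) :
    x / sigmaStar d x ≤ y / sigmaStar d y := by
  rcases hx.eq_or_lt with rfl | hx
  · rw [zero_div]
    exact div_nonneg hxy (sigmaStar_nonneg d hxy)
  have hy := hx.trans_le hxy
  have hd' : (0 : ℝ) < d := by exact_mod_cast hd
  rw [div_le_div_iff₀ (sigmaStar_pos hd hx) (sigmaStar_pos hd hy)]
  have h1 : x * √(y * (d + y)) ≤ y * √(x * (d + x)) := by
    refine le_of_sq_le_sq ?_ (by positivity)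
    rw [mul_pow, mul_pow, Real.sq_sqrt (by positivity), Real.sq_sqrt (by positivity)]
    have : y ^ 2 * (x * (d + x)) - x ^ 2 * (y * (d + y)) = x * y * d * (y - x) := by ring
    have h2 : 0 ≤ x * y * d * (y - x) := mul_nonneg (by positivity) (by linarith)
    linarith
  unfold sigmaStar
  rw [mul_div_assoc', mul_div_assoc']
  refine div_le_div_of_nonneg_right ?_ hd'.le
  linarith [mul_comm x y]

theorem gFun_lt_one {k d : ℕ} (hd : 0 < d) {θ : ℝ} (hθ : 0 ≤ θ) (h : θ < gInv k d 1) :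
    gFun k d θ < 1 := by
  have hb : ∀ x, 0 ≤ x → 1 ≤ 1 + 2 * sigmaStar d x := fun x hx => by
    have := sigmaStar_nonneg d hx
    linarith
  refine lt_one_of_lt_invFunOn (A := fun z => (1 + 2 * sigmaStar d z) ^ ((d : ℝ) / 2) *
    Real.exp (z / sigmaStar d z)) (fun x hx => ?_) (fun x hx y hy hxy => ?_) ?_
    (fun _ => rfl) hθ h
  · exact one_le_mul_of_one_le_of_one_le (Real.one_le_rpow (hb x hx) (by positivity))
      (Real.one_le_exp (div_nonneg hx (sigmaStar_nonneg d hx)))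
  · have h1 := sigmaStar_mono d hx hxy
    have h2 := div_sigmaStar_mono hd hx hxy
    have h3 := hb x hx
    dsimp only
    have h4 : 0 ≤ (1 + 2 * sigmaStar d y) ^ ((d : ℝ) / 2) :=
      Real.rpow_nonneg (by linarith) _
    gcongr
  · have hs : Continuous (sigmaStar d) := by
      unfold sigmaStar
      fun_prop
    refine ContinuousOn.mul (ContinuousOn.rpow_const (by fun_prop) fun x _ => .inr (by positivity))
      (ContinuousOn.rexp (continuousOn_id.div hs.continuousOn fun x hx =>
        (sigmaStar_pos hd hx).ne'))

theorem densityConst_min_lt_one {k d : ℕ} (hd : 0 < d) {θ : ℝ} (hθ : 0 ≤ θ)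
    (h : θ < max (hInv k 1) (gInv k d 1)) : min (hFun k θ) (gFun k d θ) < 1 := by
  rcases lt_max_iff.1 h with h | h
  · exact min_lt_of_left_lt (hFun_lt_one hθ h)
  · exact min_lt_of_right_lt (gFun_lt_one hd hθ h)

end Constants

/-! ### Norms, Voronoi cells, gaps and compact bands. -/

section Geometry

theorem norm_le_bandRadius {E : Type*} [NormedAddCommGroup E] {Ω : Set E} (hΩ : IsCompact Ω)
    {ω : E} (hω : ω ∈ Ω) : ‖ω‖ ≤ bandRadius Ω :=
  le_csSup (hΩ.image continuous_norm).bddAbove ⟨ω, hω, rfl⟩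

theorem bandRadius_nonneg {E : Type*} [NormedAddCommGroup E] (Ω : Set E) : 0 ≤ bandRadius Ω :=
  Real.sSup_nonneg (by rintro _ ⟨ω, -, rfl⟩; exact norm_nonneg ω)

variable {n : ℕ} {N : Seminorm ℝ (EuclideanSpace ℝ (Fin n))}

theorem continuous_seminorm (N : Seminorm ℝ (EuclideanSpace ℝ (Fin n))) : Continuous N :=
  continuousOn_univ.1 (N.convexOn.continuousOn isOpen_univ)

theorem embedConst_nonneg (N : Seminorm ℝ (EuclideanSpace ℝ (Fin n))) : 0 ≤ embedConst N :=
  Real.sInf_nonneg fun _ hb => hb.1.le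

/-- Some constant is admissible because `N` has a positive minimum on the compact unit sphere; the
admissible constants for a given `x` are closed, so the infimum is admissible too. -/
theorem norm_le_embedConst_mul (hN : ∀ x, N x = 0 → x = 0) (x : EuclideanSpace ℝ (Fin n)) :
    ‖x‖ ≤ embedConst N * N x := by
  have hne : {b : ℝ | 0 < b ∧ ∀ x, ‖x‖ ≤ b * N x}.Nonempty := by
    rcases (Metric.sphere (0 : EuclideanSpace ℝ (Fin n)) 1).eq_empty_or_nonempty with he | hne
    · refine ⟨1, one_pos, fun x => ?_⟩
      by_cases hx : x = 0
      · simp [hx]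
      · have : ‖x‖⁻¹ • x ∈ Metric.sphere (0 : EuclideanSpace ℝ (Fin n)) 1 := by
          simp [norm_smul, hx]
        rw [he] at this
        exact this.elim
    · obtain ⟨y, hy, hmin⟩ := (isCompact_sphere (0 : EuclideanSpace ℝ (Fin n)) 1).exists_isMinOn
        hne (continuous_seminorm N).continuousOn
      have hy0 : 0 < N y := by
        refine lt_of_le_of_ne (apply_nonneg N y) fun h => ?_
        rw [hN y h.symm] at hy
        simp at hy
      refine ⟨(N y)⁻¹, inv_pos.2 hy0, fun x => ?_⟩
      by_cases hx : x = 0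
      · simp [hx]
      · have hx' : 0 < ‖x‖ := norm_pos_iff.2 hx
        have h1 : N y ≤ N (‖x‖⁻¹ • x) := hmin (by simp [norm_smul, hx])
        rw [map_smul_eq_mul, norm_inv, norm_norm, ← div_eq_inv_mul, le_div_iff₀ hx'] at h1
        rwa [← div_eq_inv_mul, le_div_iff₀ hy0, mul_comm]
  have hclosed : IsClosed {b : ℝ | ‖x‖ ≤ b * N x} := isClosed_le (by fun_prop) (by fun_prop)
  exact hclosed.closure_subset_iff.2 (fun b hb => hb.2 x)
    (csInf_mem_closure hne ⟨0, fun b hb => hb.1.le⟩)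

/-- For `x` in the cell, `N (x - z n)` is the distance to the nearest sampling point, hence at most
`δ_z`. Moving from `x` to the point a fraction `τ` of the way out from `z n` lowers `N (· - z n)` by
`(1 - τ) N (x - z n)` and any other distance by no more, so the segment stays in the cell. -/
theorem cellSystem_voronoi {d : ℕ} {I : Type*} {N : Seminorm ℝ (Space d)}
    (hN : ∀ x, N x = 0 → x = 0) {z : I → Space d} (hcover : ∀ᵐ x : Space d, x ∈ ⋃ n, voronoi N z n)
    (hdisjoint : Pairwise fun n n' => volume (voronoi N z n ∩ voronoi N z n') = 0)
    (hδ : spaceDensity N z ≠ ⊤) :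
    CellSystem (voronoi N z) z (embedConst N * (spaceDensity N z).toReal) := by
  have hc := continuous_seminorm N
  refine ⟨fun n => ?_, hcover, hdisjoint, fun n x hx => ?_, fun n x hx τ hτ m => ?_⟩
  · have : voronoi N z n = ⋂ m, {x | N (x - z n) ≤ N (x - z m)} := by
      ext x
      simp [voronoi]
    rw [this]
    refine (isClosed_iInter fun m => isClosed_le ?_ ?_).measurableSet <;> fun_prop
  · refine (norm_le_embedConst_mul hN _).trans
      (mul_le_mul_of_nonneg_left ?_ (embedConst_nonneg N))
    rw [← ENNReal.ofReal_le_iff_le_toReal hδ]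
    refine le_trans ?_ (le_iSup (fun x => ⨅ n, ENNReal.ofReal (N (x - z n))) x)
    exact le_iInf fun m => ENNReal.ofReal_le_ofReal (hx m)
  · have e1 : z n + τ • (x - z n) - z n = τ • (x - z n) := by abel
    have e2 : x - z m = (z n + τ • (x - z n) - z m) + (1 - τ) • (x - z n) := by
      rw [sub_smul, one_smul]
      abel
    have h1 := map_add_le_add N (z n + τ • (x - z n) - z m) ((1 - τ) • (x - z n))
    rw [← e2, map_smul_eq_mul, Real.norm_of_nonneg (by linarith [hτ.2])] at h1
    rw [e1, map_smul_eq_mul, Real.norm_of_nonneg hτ.1]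
    have := hx m
    linarith

theorem exists_abs_sub_lt_of_timeDensity {I : Type*} {t : I → ℤ → ℝ} (hδ : timeDensity t ≠ ⊤)
    (n : I) (s : ℝ) {ε : ℝ} (hε : 0 < ε) : ∃ m, |s - t n m| < (timeDensity t).toReal + ε := by
  have h1 : ⨅ m, ENNReal.ofReal |s - t n m| ≤ timeDensity t :=
    (le_iSup (fun s => ⨅ m, ENNReal.ofReal |s - t n m|) s).trans
      (le_iSup (fun n => ⨆ s : ℝ, ⨅ m, ENNReal.ofReal |s - t n m|) n)
  have h2 : timeDensity t < ENNReal.ofReal ((timeDensity t).toReal + ε) := by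
    rw [ENNReal.lt_ofReal_iff_toReal_lt hδ]
    linarith
  obtain ⟨m, hm⟩ := iInf_lt_iff.1 (h1.trans_lt h2)
  exact ⟨m, (ENNReal.ofReal_lt_ofReal_iff (by positivity)).1 hm⟩

/-- Test the density at the midpoint of the gap: every sample is at least half a gap away. -/
theorem gap_le_of_timeDensity {I : Type*} {t : I → ℤ → ℝ} (ht : ∀ n, StrictMono (t n))
    (hδ : timeDensity t ≠ ⊤) (n : I) (m : ℤ) :
    t n (m + 1) - t n m ≤ 2 * (timeDensity t).toReal := by
  refine le_of_forall_pos_le_add fun ε hε => ?_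
  obtain ⟨j, hj⟩ := exists_abs_sub_lt_of_timeDensity hδ n ((t n m + t n (m + 1)) / 2) (half_pos hε)
  rw [abs_lt] at hj
  rcases le_or_gt j m with h | h
  · have := (ht n).monotone h
    linarith [hj.2]
  · have := (ht n).monotone (Int.add_one_le_iff.2 h)
    linarith [hj.1]

theorem exists_gt_of_timeDensity {I : Type*} {t : I → ℤ → ℝ} (hδ : timeDensity t ≠ ⊤)
    (n : I) (x : ℝ) : ∃ m, x < t n m := by
  obtain ⟨m, hm⟩ := exists_abs_sub_lt_of_timeDensity hδ n (x + (timeDensity t).toReal + 1) one_pos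
  exact ⟨m, by linarith [(abs_lt.1 hm).2]⟩

theorem exists_lt_of_timeDensity {I : Type*} {t : I → ℤ → ℝ} (hδ : timeDensity t ≠ ⊤)
    (n : I) (x : ℝ) : ∃ m, t n m < x := by
  obtain ⟨m, hm⟩ := exists_abs_sub_lt_of_timeDensity hδ n (x - (timeDensity t).toReal - 1) one_pos
  exact ⟨m, by linarith [(abs_lt.1 hm).1]⟩

/-- The support of the Fourier transforms (in Mathlib's normalization). -/
def frequencySet {d : ℕ} (Ωz : Set (Space d)) (Ωt : Set ℝ) : Set (SpaceTime d) :=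
  {ξ | (2 * Real.pi) • ξ ∈ productBand Ωz Ωt}

variable {d : ℕ} {Ωz : Set (Space d)} {Ωt : Set ℝ}

theorem isCompact_productBand (hΩz : IsCompact Ωz) (hΩt : IsCompact Ωt) :
    IsCompact (productBand Ωz Ωt) := by
  have : productBand Ωz Ωt = (fun q : Space d × ℝ => point q.1 q.2) '' (Ωz ×ˢ Ωt) := by
    ext ω
    constructor
    · exact fun h => ⟨(ω.fst, ω.snd), h, rfl⟩
    · rintro ⟨q, hq, rfl⟩
      exact hq
  rw [this]
  exact (hΩz.prod hΩt).image continuous_point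

theorem isCompact_frequencySet (hΩz : IsCompact Ωz) (hΩt : IsCompact Ωt) :
    IsCompact (frequencySet Ωz Ωt) := by
  have hπ : (2 * Real.pi) ≠ 0 := by positivity
  exact (Homeomorph.smulOfNeZero _ hπ).isClosedEmbedding.isCompact_preimage
    (isCompact_productBand hΩz hΩt)

theorem norm_fst_le_of_mem_frequencySet (hΩz : IsCompact Ωz) {ξ : SpaceTime d}
    (hξ : ξ ∈ frequencySet Ωz Ωt) : 2 * Real.pi * ‖ξ.fst‖ ≤ bandRadius Ωz := by
  have h := norm_le_bandRadius hΩz hξ.1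
  rwa [WithLp.smul_fst, norm_smul, Real.norm_of_nonneg (by positivity)] at h

theorem abs_snd_le_of_mem_frequencySet (hΩt : IsCompact Ωt) {ξ : SpaceTime d}
    (hξ : ξ ∈ frequencySet Ωz Ωt) : 2 * Real.pi * |ξ.snd| ≤ bandRadius Ωt := by
  have h := norm_le_bandRadius hΩt hξ.2
  rwa [WithLp.smul_snd, norm_smul, Real.norm_of_nonneg (by positivity)] at h

end Geometry

/-! ### The spatial frame bounds. -/

section SpatialBounds

variable {d k : ℕ} {I : Type*} [Countable I] {V : I → Set (Space d)} {z : I → Space d} {r M : ℝ}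
  {K : Set (SpaceTime d)} {g : SpaceTime d → ℂ}

theorem spatialForm_bounds_two (hd : d = 2) (hr : 0 ≤ r) (hM0 : 0 ≤ M)
    (hM : ∀ ξ ∈ K, 2 * Real.pi * ‖ξ.fst‖ ≤ M) (hV : CellSystem V z r) (hK : IsCompact K)
    (hC : wirtingerConst (k + 1) ≠ 0) (hθ : wirtingerConst (k + 1) * (r * M) ≤ 1)
    (hg : BandFun K g) :
    ENNReal.ofReal (Real.exp (-1) * (1 - (wirtingerConst (k + 1) * (r * M)) ^ (k + 1)) ^ 2) *
        ∫⁻ ξ, ‖g ξ‖ₑ ^ 2 ≤ spatialForm V z k g ∧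
      spatialForm V z k g ≤
        ENNReal.ofReal ((1 + 2 * (r * M) / Real.pi) ^ 2 * Real.exp ((r * M) ^ 2)) *
          ∫⁻ ξ, ‖g ξ‖ₑ ^ 2 := by
  have hc := wirtingerConst_nonneg (k + 1)
  have hcθ : 0 ≤ wirtingerConst (k + 1) * (r * M) := by positivity
  have h1 := spatialForm_lower hV hK hg (pow_nonneg hcθ (k + 1)) (pow_le_one₀ hcθ hθ)
    (lintegral_cellMeasure_taylor_le hd (smoothWirtinger_wirtingerConst hC) hc hM hM0 hr hV hK hg)
  have e : Real.exp (-((d - 1 : ℕ) : ℝ)) = Real.exp (-1) := by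
    rw [hd]
    norm_num
  rw [e] at h1
  exact ⟨h1, spatialForm_upper hV hr hK hg hM fun u hu =>
    tsum_lintegral_center_le hd hM hM0 hr hV hK hu⟩

theorem tsum_taylor_le_hFun (hr : 0 ≤ r) (hM0 : 0 ≤ M)
    (hM : ∀ ξ ∈ K, 2 * Real.pi * ‖ξ.fst‖ ≤ M) (hV : CellSystem V z r) (hK : IsCompact K)
    (hg : BandFun K g) :
    ∑' n, ∫⁻ q, ‖𝓕⁻ g (point q.1 q.2) - taylorPoly k g z n q‖ₑ ^ 2 ∂cellMeasure V n ≤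
      ENNReal.ofReal (hFun k (r * M) ^ 2) * ∫⁻ ξ, ‖g ξ‖ₑ ^ 2 :=
  (maxBound_exp hK hr hM0 hM).taylor_remainder_le (Real.exp_pos _).le hr hM0 hM hV hK hg

theorem gFun_nonneg (k d : ℕ) {θ : ℝ} (hθ : 0 ≤ θ) : 0 ≤ gFun k d θ := by
  have h1 := sigmaStar_nonneg d hθ
  have h2 := expRemainder_nonneg k hθ
  unfold gFun
  positivity

theorem tsum_taylor_le_gFun (hd : 0 < d) (hr : 0 ≤ r) (hM0 : 0 ≤ M)
    (hM : ∀ ξ ∈ K, 2 * Real.pi * ‖ξ.fst‖ ≤ M) (hV : CellSystem V z r) (hK : IsCompact K)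
    (hg : BandFun K g) :
    ∑' n, ∫⁻ q, ‖𝓕⁻ g (point q.1 q.2) - taylorPoly k g z n q‖ₑ ^ 2 ∂cellMeasure V n ≤
      ENNReal.ofReal (gFun k d (r * M) ^ 2) * ∫⁻ ξ, ‖g ξ‖ₑ ^ 2 := by
  have hθ : 0 ≤ r * M := by positivity
  -- For `θ = 0` also `σ = 0`, and the radius `r / σ` is useless; but both `hFun` and `gFun` vanish
  -- there.
  rcases hθ.eq_or_lt with h0 | hpos
  · refine (tsum_taylor_le_hFun hr hM0 hM hV hK hg).trans_eq ?_
    simp [← h0, hFun, gFun, expRemainder_zero]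
  have hrpos : 0 < r := lt_of_le_of_ne hr fun h => by simp [← h] at hpos
  have hσ := sigmaStar_pos hd hpos
  set σ := sigmaStar d (r * M) with hσdef
  -- The averaging radius is `ρ = r / σ`, for which the volume ratio is `(1 + σ)^(d-1)`. This is at
  -- most `(1 + 2σ)^d`, the square of the factor in `gFun`.
  set κ : ℝ := √((1 + σ) ^ (d - 1)) * Real.exp (r * M / σ) with hκdef
  have hκ : κ ^ 2 = ((r + r / σ) / (r / σ)) ^ (d - 1) * Real.exp (r / σ * M) ^ 2 := by
    have e1 : (r + r / σ) / (r / σ) = 1 + σ := by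
      field_simp
      ring
    have e2 : r / σ * M = r * M / σ := by ring
    rw [e1, e2, hκdef, mul_pow, Real.sq_sqrt (by positivity)]
  refine ((maxBound_ball hK hr hM0 hM (div_pos hrpos hσ) (by positivity) hκ).taylor_remainder_le
    (by positivity) hr hM0 hM hV hK hg).trans ?_
  have hR := expRemainder_nonneg k hθ
  have hle : κ * expRemainder k (r * M) ≤ gFun k d (r * M) := by
    rw [gFun, hκdef, ← hσdef]
    gcongr
    rw [Real.sqrt_le_left (by positivity), ← Real.rpow_natCast _ 2, ← Real.rpow_mul (by positivity)]
    have e : (d : ℝ) / 2 * (2 : ℕ) = (d : ℕ) := by push_cast; ring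
    rw [e, Real.rpow_natCast]
    calc (1 + σ) ^ (d - 1) ≤ (1 + σ) ^ d := pow_le_pow_right₀ (by linarith) (Nat.sub_le d 1)
      _ ≤ (1 + 2 * σ) ^ d := by gcongr; linarith
  gcongr

/-- Both remainder estimates hold, so the smaller one may serve as `η`. The lower bound weakens
`e^(-(d-1))` to `e^(-d)`. -/
theorem spatialForm_bounds_ge_three (hd : 0 < d) (hr : 0 ≤ r) (hM0 : 0 ≤ M)
    (hM : ∀ ξ ∈ K, 2 * Real.pi * ‖ξ.fst‖ ≤ M) (hV : CellSystem V z r) (hK : IsCompact K)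
    (hθ : min (hFun k (r * M)) (gFun k d (r * M)) ≤ 1) (hg : BandFun K g) :
    ENNReal.ofReal (Real.exp (-(d : ℝ)) * (1 - min (hFun k (r * M)) (gFun k d (r * M))) ^ 2) *
        ∫⁻ ξ, ‖g ξ‖ₑ ^ 2 ≤ spatialForm V z k g ∧
      spatialForm V z k g ≤
        ENNReal.ofReal (Real.exp (2 * (r * M) + (r * M) ^ 2)) * ∫⁻ ξ, ‖g ξ‖ₑ ^ 2 := by
  have hθ0 : 0 ≤ r * M := by positivity
  constructor
  · refine le_trans ?_ (spatialForm_lower hV hK hg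
      (η := min (hFun k (r * M)) (gFun k d (r * M))) (le_min
      (mul_nonneg (Real.exp_pos _).le (expRemainder_nonneg k hθ0)) (gFun_nonneg k d hθ0)) hθ ?_)
    · gcongr
      exact Nat.sub_le d 1
    · rcases min_choice (hFun k (r * M)) (gFun k d (r * M)) with h | h <;> rw [h]
      · exact tsum_taylor_le_hFun hr hM0 hM hV hK hg
      · exact tsum_taylor_le_gFun hd hr hM0 hM hV hK hg
  · have h := spatialForm_upper (k := k) hV hr hK hg hM fun u hu =>
      (maxBound_exp hK hr hM0 hM).tsum_lintegral_le (Real.exp_pos _).le hV hu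
    rwa [← Real.exp_nat_mul, ← Real.exp_add, Nat.cast_two] at h

theorem spatialForm_bounds (hd : 0 < d) (hr : 0 ≤ r) (hM0 : 0 ≤ M)
    (hM : ∀ ξ ∈ K, 2 * Real.pi * ‖ξ.fst‖ ≤ M) (hV : CellSystem V z r) (hK : IsCompact K)
    (hθ : r * M < densityConst k d) :
    0 < spatialLower k d (r * M) ∧ 0 < spatialUpper d (r * M) ∧ ∀ g : SpaceTime d → ℂ, BandFun K g →
      ENNReal.ofReal (spatialLower k d (r * M)) * ∫⁻ ξ, ‖g ξ‖ₑ ^ 2 ≤ spatialForm V z k g ∧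
      spatialForm V z k g ≤ ENNReal.ofReal (spatialUpper d (r * M)) * ∫⁻ ξ, ‖g ξ‖ₑ ^ 2 := by
  have hθ0 : 0 ≤ r * M := by positivity
  have hπ := Real.pi_pos
  unfold densityConst at hθ
  unfold spatialLower spatialUpper
  split_ifs at hθ ⊢ with h2
  -- Since `1 / 0 = 0`, the density condition with `θ ≥ 0` forces the Wirtinger constant to be
  -- positive, hence to be a genuine infimum.
  · have hc : 0 < wirtingerConst (k + 1) := by
      have := hθ0.trans_lt hθ
      rwa [one_div, inv_pos] at this
    rw [lt_div_iff₀ hc, mul_comm] at hθ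
    have h1 := pow_lt_one₀ (by positivity) hθ k.succ_ne_zero
    exact ⟨mul_pos (Real.exp_pos _) (pow_pos (sub_pos.2 h1) 2), by positivity, fun g hg =>
      spatialForm_bounds_two h2 hr hM0 hM hV hK hc.ne' hθ.le hg⟩
  · have h1 := densityConst_min_lt_one hd hθ0 hθ
    exact ⟨mul_pos (Real.exp_pos _) (pow_pos (sub_pos.2 h1) 2), by positivity, fun g hg =>
      spatialForm_bounds_ge_three hd hr hM0 hM hV hK h1.le hg⟩

end SpatialBounds

/-! ### Factorization of the weights into time and space. -/

section Weights

variable {d k : ℕ} {I : Type*} {N : Seminorm ℝ (Space d)} {z : I → Space d} {t : I → ℤ → ℝ} {r : ℝ}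

theorem gap_nonneg (ht : ∀ n, StrictMono (t n)) (m : ℤ) (n : I) :
    0 ≤ t n (m + 1) - t n (m - 1) :=
  sub_nonneg.2 ((ht n).monotone (by omega))

theorem weight_nonneg (ht : ∀ n, StrictMono (t n)) (m : ℤ) (n : I) (α : Fin (d - 1) → ℕ) :
    0 ≤ weight N z t m n α := by
  refine mul_nonneg (div_nonneg (gap_nonneg ht m n) (by positivity)) (integral_nonneg fun x => ?_)
  exact Finset.prod_nonneg fun i _ => by rw [pow_mul]; positivity

theorem ofReal_weight (ht : ∀ n, StrictMono (t n)) (hV : CellSystem (voronoi N z) z r)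
    (m : ℤ) (n : I) (α : Fin (d - 1) → ℕ) :
    ENNReal.ofReal (weight N z t m n α) =
      ENNReal.ofReal ((t n (m + 1) - t n (m - 1)) / 2) * cellWeight (voronoi N z) z n α := by
  have hint : IntegrableOn
      (fun x : Space d => ∏ i, ((x i - z n i) ^ 2) ^ α i / ((α i).factorial : ℝ))
      (voronoi N z n) := by
    have hc : Continuous fun x : Space d =>
        ∏ i, ((x i - z n i) ^ 2) ^ α i / ((α i).factorial : ℝ) := by
      fun_prop
    refine (hc.continuousOn.integrableOn_compact (isCompact_closedBall (z n) r)).mono_set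
      fun x hx => ?_
    rw [Metric.mem_closedBall, dist_eq_norm]
    exact hV.norm_le n x hx
  rw [cellWeight, ← ofReal_integral_eq_lintegral_ofReal hint
    (.of_forall fun x => Finset.prod_nonneg fun i _ => by positivity),
    ← ENNReal.ofReal_mul (by have := gap_nonneg ht m n; positivity), weight]
  simp_rw [Finset.prod_div_distrib, integral_div, pow_mul]
  congr 1
  ring

variable {K : Set (SpaceTime d)} {g : SpaceTime d → ℂ}

theorem tsum_weight_eq (ht : ∀ n, StrictMono (t n)) (hV : CellSystem (voronoi N z) z r) :
    ∑' i : ℤ × I × MultiIndex (d - 1) k, ENNReal.ofReal (weight N z t i.1 i.2.1 i.2.2) *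
        ‖𝓕⁻ (fun ξ => spatialSymbol i.2.2.1 ξ • g ξ) (point (z i.2.1) (t i.2.1 i.1))‖ₑ ^ 2 =
      ∑' n, ∑ α : MultiIndex (d - 1) k, cellWeight (voronoi N z) z n α.1 *
        ∑' m, ENNReal.ofReal ((t n (m + 1) - t n (m - 1)) / 2) *
          ‖𝓕⁻ (fun ξ => spatialSymbol α.1 ξ • g ξ) (point (z n) (t n m))‖ₑ ^ 2 := by
  rw [ENNReal.tsum_prod', ENNReal.tsum_comm, ENNReal.tsum_prod']
  refine tsum_congr fun n => ?_
  rw [tsum_fintype]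
  refine Finset.sum_congr rfl fun α _ => ?_
  rw [← ENNReal.tsum_mul_left]
  refine tsum_congr fun m => ?_
  rw [ofReal_weight ht hV]
  ring

/-- The line estimate applies to every `D_z^α f` at every `z n` with the same constants, so these
pull out of the spatial sum. -/
theorem sampling_bounds (ht : ∀ n, StrictMono (t n)) (hV : CellSystem (voronoi N z) z r)
    (hδ : timeDensity t ≠ ⊤) {M : ℝ} (hM : ∀ ξ ∈ K, 2 * Real.pi * |ξ.snd| ≤ M) (hM0 : 0 ≤ M)
    (hη : 2 * (timeDensity t).toReal * M / Real.pi ≤ 1) (hK : IsCompact K) (hg : BandFun K g) :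
    ENNReal.ofReal ((1 - 2 * (timeDensity t).toReal * M / Real.pi) ^ 2) *
        spatialForm (voronoi N z) z k g ≤
      ∑' i : ℤ × I × MultiIndex (d - 1) k, ENNReal.ofReal (weight N z t i.1 i.2.1 i.2.2) *
        ‖𝓕⁻ (fun ξ => spatialSymbol i.2.2.1 ξ • g ξ) (point (z i.2.1) (t i.2.1 i.1))‖ₑ ^ 2 ∧
    ∑' i : ℤ × I × MultiIndex (d - 1) k, ENNReal.ofReal (weight N z t i.1 i.2.1 i.2.2) *
        ‖𝓕⁻ (fun ξ => spatialSymbol i.2.2.1 ξ • g ξ) (point (z i.2.1) (t i.2.1 i.1))‖ₑ ^ 2 ≤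
      ENNReal.ofReal ((1 + 2 * (timeDensity t).toReal * M / Real.pi) ^ 2) *
        spatialForm (voronoi N z) z k g := by
  have h := fun (n : I) (α : MultiIndex (d - 1) k) =>
    time_sampling hK (hg.smul hK (continuous_spatialSymbol α.1)) (z n) (ht n)
      (exists_gt_of_timeDensity hδ n) (exists_lt_of_timeDensity hδ n) hM hM0
      (gap_le_of_timeDensity ht hδ n)
  rw [tsum_weight_eq ht hV, spatialForm, ← ENNReal.tsum_mul_left, ← ENNReal.tsum_mul_left]
  constructor <;> refine ENNReal.tsum_le_tsum fun n => ?_ <;> rw [Finset.mul_sum] <;>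
    refine Finset.sum_le_sum fun α _ => ?_ <;> rw [mul_left_comm] <;> gcongr
  · exact (h n α).1 hη
  · exact (h n α).2

end Weights

/-! ### The space `B(Ω)`, the kernel and the frame atoms. -/

section Bandlimited

variable {d : ℕ} {Ωz : Set (Space d)} {Ωt : Set ℝ}

/-- Cutting the Plancherel transform of `f` to the frequency set changes it only on a null set, and
its inverse Fourier integral is the smooth representative of `f`. -/
theorem exists_bandFun (hΩz : IsCompact Ωz) (hΩt : IsCompact Ωt)
    {f : Lp (α := SpaceTime d) ℂ 2 volume}
    (hf : f ∈ bandlimited (productBand Ωz Ωt)) :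
    ∃ g : SpaceTime d → ℂ, BandFun (frequencySet Ωz Ωt) g ∧
      g =ᵐ[volume] (𝓕 f : Lp (α := SpaceTime d) ℂ 2 volume) ∧ 𝓕⁻ g =ᵐ[volume] f ∧
      ∫⁻ ξ, ‖g ξ‖ₑ ^ 2 = ENNReal.ofReal (‖f‖ ^ 2) := by
  have hK := isCompact_frequencySet hΩz hΩt
  set u : Lp (α := SpaceTime d) ℂ 2 volume := 𝓕 f with hu
  have hg : BandFun (frequencySet Ωz Ωt) ((frequencySet Ωz Ωt).indicator u) :=
    ⟨(Lp.memLp u).indicator hK.measurableSet, fun ξ hξ => indicator_of_notMem hξ _⟩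
  have hgu : (frequencySet Ωz Ωt).indicator u =ᵐ[volume] u := by
    filter_upwards [show ∀ᵐ ξ : SpaceTime d,
      (2 * Real.pi) • ξ ∉ productBand Ωz Ωt → u ξ = 0 from hf] with ξ hξ
    by_cases h : ξ ∈ frequencySet Ωz Ωt
    · exact indicator_of_mem h _
    · rw [indicator_of_notMem h, hξ h]
  refine ⟨_, hg, hgu, ?_, ?_⟩
  · have h1 := fourierInv_toLp_ae (hg.integrable hK) hg.memLp
    have h2 : hg.memLp.toLp _ = u := by
      rw [MemLp.toLp_congr hg.memLp (Lp.memLp u) hgu, Lp.toLp_coeFn]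
    have h3 : (𝓕⁻ u : Lp (α := SpaceTime d) ℂ 2 volume) = f :=
      (Lp.fourierTransformₗᵢ (SpaceTime d) ℂ).symm_apply_apply f
    rw [h2, h3] at h1
    exact h1.symm
  · have h3 : ‖u‖ = ‖f‖ := (Lp.fourierTransformₗᵢ (SpaceTime d) ℂ).norm_map f
    rw [← eLpNorm_two_sq, eLpNorm_congr_ae hgu, ← Lp.enorm_def, ← ofReal_norm, h3,
      ENNReal.ofReal_pow (norm_nonneg f)]

/-- The substitution `ω = 2πξ` absorbs the factor `(2π)^(-d)`. -/
theorem kernelPhi_eq_fourierInv (hΩz : IsCompact Ωz) (hΩt : IsCompact Ωt) :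
    kernelPhi (productBand Ωz Ωt) = 𝓕⁻ ((frequencySet Ωz Ωt).indicator (1 : SpaceTime d → ℂ)) := by
  ext x
  rw [kernelPhi, ← integral_indicator (isCompact_productBand hΩz hΩt).measurableSet,
    Real.fourierInv_eq]
  have h := Measure.integral_comp_smul_of_nonneg (volume : Measure (SpaceTime d))
    ((productBand Ωz Ωt).indicator fun ω => Complex.exp (Complex.I * (inner ℝ ω x : ℝ)))
    (2 * Real.pi) (hR := by positivity)
  have e : ((2 * Real.pi : ℝ) : ℂ)⁻¹ ^ Module.finrank ℝ (SpaceTime d) =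
      (((2 * Real.pi) ^ Module.finrank ℝ (SpaceTime d))⁻¹ : ℝ) := by
    push_cast
    rw [inv_pow]
  rw [e, ← Complex.real_smul, ← h]
  refine integral_congr_ae (.of_forall fun ξ => ?_)
  dsimp only
  by_cases hξ : ξ ∈ frequencySet Ωz Ωt
  · rw [indicator_of_mem hξ, indicator_of_mem (show _ ∈ productBand Ωz Ωt from hξ),
      Circle.smul_def, Real.fourierChar_apply, inner_smul_left]
    simp
    ring_nf
  · rw [indicator_of_notMem hξ, indicator_of_notMem (show _ ∉ productBand Ωz Ωt from hξ), smul_zero]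

theorem bandFun_indicator_one {K : Set (SpaceTime d)} (hK : IsCompact K) :
    BandFun K (K.indicator (1 : SpaceTime d → ℂ)) :=
  ⟨memLp_indicator_const 2 hK.measurableSet 1 (.inr hK.measure_lt_top.ne),
    fun _ hξ => indicator_of_notMem hξ _⟩

/-- The symbol of `f ↦ w * D_z^α f (· - x)`. -/
def atomSymbol (w : ℝ) (α : Fin (d - 1) → ℕ) (x ξ : SpaceTime d) : ℂ :=
  w * (((Real.fourierChar (-inner ℝ ξ x) : Circle) : ℂ) * spatialSymbol α ξ)

@[fun_prop]
theorem continuous_atomSymbol (w : ℝ) (α : Fin (d - 1) → ℕ) (x : SpaceTime d) :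
    Continuous (atomSymbol w α x) := by
  unfold atomSymbol
  fun_prop

theorem fourierInv_atomSymbol {K : Set (SpaceTime d)} {g : SpaceTime d → ℂ} (hK : IsCompact K)
    (hg : BandFun K g) (w : ℝ) (α : Fin (d - 1) → ℕ) (x y : SpaceTime d) :
    𝓕⁻ (fun ξ => atomSymbol w α x ξ • g ξ) y = w * spatialDeriv α (𝓕⁻ g) (y - x) := by
  rw [spatialDeriv_fourierInv hK hg, Real.fourierInv_eq, Real.fourierInv_eq, ← integral_const_mul]
  refine integral_congr_ae (.of_forall fun ξ => ?_)
  simp only [Circle.smul_def, atomSymbol, smul_eq_mul, sub_eq_add_neg y x, inner_add_right,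
    inner_neg_right, AddChar.map_add_eq_mul, Circle.coe_mul]
  ring

/-- Each coordinate symbol is purely imaginary. The resulting sign disappears in the modulus of the
analysis coefficients. -/
theorem conj_spatialSymbol (α : Fin (d - 1) → ℕ) (ξ : SpaceTime d) :
    (starRingEnd ℂ) (spatialSymbol α ξ) = (-1) ^ (∑ i, α i) * spatialSymbol α ξ := by
  rw [spatialSymbol, map_prod, ← Finset.prod_pow_eq_pow_sum, ← Finset.prod_mul_distrib]
  refine Finset.prod_congr rfl fun i _ => ?_
  rw [map_pow, ← mul_pow, dirSymbol_point_single]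
  simp [map_ofNat]

theorem conj_atomSymbol (w : ℝ) (α : Fin (d - 1) → ℕ) (x ξ : SpaceTime d) :
    (starRingEnd ℂ) (atomSymbol w α x ξ) = w * (-1) ^ (∑ i, α i) *
      (((Real.fourierChar (inner ℝ ξ x) : Circle) : ℂ) * spatialSymbol α ξ) := by
  have h : (starRingEnd ℂ) ((Real.fourierChar (-inner ℝ ξ x) : Circle) : ℂ) =
      ((Real.fourierChar (inner ℝ ξ x) : Circle) : ℂ) := by
    rw [← Circle.coe_inv_eq_conj, ← AddChar.map_neg_eq_inv, neg_neg]
  rw [atomSymbol, map_mul, map_mul, h, conj_spatialSymbol, Complex.conj_ofReal]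
  ring

/-- The functions `w * D_z^α Φ_Ω(· - x)` as elements of `B(Ω)`, with their analysis coefficients. -/
theorem exists_atom (hΩz : IsCompact Ωz) (hΩt : IsCompact Ωt) (w : ℝ) (α : Fin (d - 1) → ℕ)
    (x : SpaceTime d) :
    ∃ φ : Lp (α := SpaceTime d) ℂ 2 volume, φ ∈ bandlimited (productBand Ωz Ωt) ∧
      φ =ᵐ[volume]
        (fun y => (w : ℂ) * spatialDeriv α (kernelPhi (productBand Ωz Ωt)) (y - x)) ∧
      ∀ (f : Lp (α := SpaceTime d) ℂ 2 volume) (g : SpaceTime d → ℂ),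
        BandFun (frequencySet Ωz Ωt) g →
        g =ᵐ[volume] (𝓕 f : Lp (α := SpaceTime d) ℂ 2 volume) →
        ‖inner ℂ φ f‖ = |w| * ‖spatialDeriv α (𝓕⁻ g) x‖ := by
  have hK := isCompact_frequencySet hΩz hΩt
  have h1 := bandFun_indicator_one hK
  have ha := h1.smul hK (continuous_atomSymbol w α x)
  set u := ha.memLp.toLp _ with hu
  have hF : (𝓕 (𝓕⁻ u : Lp (α := SpaceTime d) ℂ 2 volume) : Lp (α := SpaceTime d) ℂ 2 volume) = u :=
    (Lp.fourierTransformₗᵢ (SpaceTime d) ℂ).apply_symm_apply u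
  have hmem : (𝓕⁻ u : Lp (α := SpaceTime d) ℂ 2 volume) ∈ bandlimited (productBand Ωz Ωt) := by
    change ∀ᵐ ξ : SpaceTime d, (2 * Real.pi) • ξ ∉ productBand Ωz Ωt →
      (𝓕 (𝓕⁻ u : Lp (α := SpaceTime d) ℂ 2 volume) : Lp (α := SpaceTime d) ℂ 2 volume) ξ = 0
    rw [hF]
    filter_upwards [ha.memLp.coeFn_toLp] with ξ hξ hn
    rw [hu, hξ, ha.zero_off ξ hn]
  refine ⟨_, hmem, ?_, fun f g hg hgf => ?_⟩
  · refine (fourierInv_toLp_ae (ha.integrable hK) ha.memLp).trans (.of_forall fun y => ?_)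
    rw [fourierInv_atomSymbol hK h1, kernelPhi_eq_fourierInv hΩz hΩt]
  · have h2 : inner ℂ (𝓕⁻ u : Lp (α := SpaceTime d) ℂ 2 volume) f =
        (w : ℂ) * (-1) ^ (∑ i, α i) * spatialDeriv α (𝓕⁻ g) x := by
      rw [← Lp.inner_fourier_eq, hF, L2.inner_def,
        spatialDeriv_fourierInv hK hg, Real.fourierInv_eq, ← integral_const_mul]
      refine integral_congr_ae ?_
      filter_upwards [ha.memLp.coeFn_toLp, hgf] with ξ h3 h4
      rw [h3, ← h4, RCLike.inner_apply, smul_eq_mul, map_mul, conj_atomSymbol, Circle.smul_def,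
        smul_eq_mul, smul_eq_mul]
      by_cases hξ : ξ ∈ frequencySet Ωz Ωt
      · simp [hξ]
        ring
      · simp [hξ, hg.zero_off ξ hξ]
    rw [h2, norm_mul, norm_mul, norm_pow, norm_neg, norm_one, one_pow, mul_one, Complex.norm_real,
      Real.norm_eq_abs]

end Bandlimited

/-- Sums in `ENNReal` always exist, so the estimates are made there; the finite upper bound then
supplies summability. -/
theorem summable_and_bounds_of_ofReal {ι : Type*} {a : ι → ℝ} (ha : ∀ i, 0 ≤ a i) {A B s : ℝ}
    (hA : 0 ≤ A) (hB : 0 ≤ B) (hs : 0 ≤ s)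
    (h1 : ENNReal.ofReal A * ENNReal.ofReal s ≤ ∑' i, ENNReal.ofReal (a i))
    (h2 : ∑' i, ENNReal.ofReal (a i) ≤ ENNReal.ofReal B * ENNReal.ofReal s) :
    Summable a ∧ A * s ≤ ∑' i, a i ∧ ∑' i, a i ≤ B * s := by
  have hsum : Summable a := by
    have h := ENNReal.summable_toReal (h2.trans_lt (by finiteness)).ne
    simpa only [ENNReal.toReal_ofReal (ha _)] using h
  rw [← ENNReal.ofReal_mul hA, ← ENNReal.ofReal_tsum_of_nonneg ha hsum,
    ENNReal.ofReal_le_ofReal_iff (tsum_nonneg ha)] at h1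
  rw [← ENNReal.ofReal_mul hB, ← ENNReal.ofReal_tsum_of_nonneg ha hsum,
    ENNReal.ofReal_le_ofReal_iff (mul_nonneg hB hs)] at h2
  exact ⟨hsum, h1, h2⟩

end LineSampling

end

/-! ### Assembly of the sampling and frame inequalities. -/

theorem proposition3p8 (d k : ℕ) (hd : 2 ≤ d)
    -- the band and the norm
    (Ωz : Set (Space d)) (Ωt : Set ℝ) (hΩz : IsCompact Ωz) (hΩt : IsCompact Ωt)
    (N : Seminorm ℝ (Space d)) (hN : ∀ x, N x = 0 → x = 0)
    -- the sampling points in space and in time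
    {I : Type*} [Countable I] (z : I → Space d) (t : I → ℤ → ℝ)
    (ht : ∀ n, StrictMono (t n))
    -- the Voronoi cells partition space up to null sets
    (hcover : ∀ᵐ x : Space d, x ∈ ⋃ n, voronoi N z n)
    (hdisjoint : Pairwise fun n n' => volume (voronoi N z n ∩ voronoi N z n') = 0)
    -- the density conditions (a zero denominator gives `∞`)
    (hδt : timeDensity t < ENNReal.ofReal 2 / ENNReal.ofReal (Real.pi * bandRadius Ωt))
    (hδz : spaceDensity N z <
      ENNReal.ofReal (densityConst k d) / ENNReal.ofReal (bandRadius Ωz * embedConst N)) :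
    ∃ Az Bz : ℝ, 0 < Az ∧ 0 < Bz ∧
      spatialLower k d (bandRadius Ωz * embedConst N * (spaceDensity N z).toReal) ≤ Az ∧
      Bz ≤ spatialUpper d (bandRadius Ωz * embedConst N * (spaceDensity N z).toReal) ∧
      -- the sampling inequality, for the smooth representative `F` of each `f` in `B(Ω)`
      (∀ f ∈ bandlimited (productBand Ωz Ωt),
        ∃ F : SpaceTime d → ℂ, ContDiff ℝ (⊤ : ℕ∞) F ∧ F =ᵐ[volume] f ∧
          (Summable fun i : ℤ × I × MultiIndex (d - 1) k =>
            weight N z t i.1 i.2.1 i.2.2 *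
              ‖spatialDeriv i.2.2 F (point (z i.2.1) (t i.2.1 i.1))‖ ^ 2) ∧
          (1 - 2 * (timeDensity t).toReal * bandRadius Ωt / Real.pi) ^ 2 * Az * ‖f‖ ^ 2 ≤
            ∑' i : ℤ × I × MultiIndex (d - 1) k, weight N z t i.1 i.2.1 i.2.2 *
              ‖spatialDeriv i.2.2 F (point (z i.2.1) (t i.2.1 i.1))‖ ^ 2 ∧
          ∑' i : ℤ × I × MultiIndex (d - 1) k, weight N z t i.1 i.2.1 i.2.2 *
              ‖spatialDeriv i.2.2 F (point (z i.2.1) (t i.2.1 i.1))‖ ^ 2 ≤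
            (1 + 2 * (timeDensity t).toReal * bandRadius Ωt / Real.pi) ^ 2 * Bz * ‖f‖ ^ 2) ∧
      -- the equivalent frame property
      ∃ φ : ℤ × I × MultiIndex (d - 1) k → bandlimited (productBand Ωz Ωt),
        (∀ i, ((φ i : Lp (α := SpaceTime d) ℂ 2 volume) : SpaceTime d → ℂ) =ᵐ[volume]
          fun x => (Real.sqrt (weight N z t i.1 i.2.1 i.2.2) : ℂ) *
            spatialDeriv i.2.2 (kernelPhi (productBand Ωz Ωt))
              (x - point (z i.2.1) (t i.2.1 i.1))) ∧
        IsFrameWithBounds φ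
          ((1 - 2 * (timeDensity t).toReal * bandRadius Ωt / Real.pi) ^ 2 * Az)
          ((1 + 2 * (timeDensity t).toReal * bandRadius Ωt / Real.pi) ^ 2 * Bz) := by
  have hK := isCompact_frequencySet hΩz hΩt
  have hb := embedConst_nonneg N
  have hmz := bandRadius_nonneg Ωz
  have hmt := bandRadius_nonneg Ωt
  have hπ := Real.pi_pos
  have hδz' : spaceDensity N z ≠ ⊤ := hδz.ne_top
  have hδt' : timeDensity t ≠ ⊤ := hδt.ne_top
  have hη : 2 * (timeDensity t).toReal * bandRadius Ωt / Real.pi < 1 := by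
    rcases hmt.eq_or_lt with h0 | hpos
    · simp [← h0]
    · rw [← ENNReal.ofReal_div_of_pos (by positivity), ENNReal.lt_ofReal_iff_toReal_lt hδt',
        lt_div_iff₀ (by positivity)] at hδt
      rw [div_lt_one hπ]
      -- The hypothesis says `δ_t m < 2/π`, while only `δ_t m < π/2` is needed; this is weaker
      -- because `π² > 4`.
      by_contra! h
      have h1 := mul_le_mul_of_nonneg_right h hπ.le
      nlinarith [Real.pi_gt_three]
  have hθ : embedConst N * (spaceDensity N z).toReal * bandRadius Ωz < densityConst k d := by
    rcases (mul_nonneg hmz hb).eq_or_lt with h0 | hpos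
    -- With zero denominator the right-hand side is `∞` only for a positive numerator. In `ENNReal`
    -- one has `0 / 0 = 0`, which the strict inequality excludes.
    · have hC : 0 < densityConst k d := by
        by_contra hC
        rw [ENNReal.ofReal_of_nonpos (not_lt.1 hC), ENNReal.zero_div] at hδz
        exact not_lt_zero hδz
      rwa [mul_right_comm, mul_comm (embedConst N), ← h0, zero_mul]
    · rw [← ENNReal.ofReal_div_of_pos hpos, ENNReal.lt_ofReal_iff_toReal_lt hδz',
        lt_div_iff₀ hpos] at hδz
      linarith
  have hV := cellSystem_voronoi hN hcover hdisjoint hδz'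
  obtain ⟨hA0, hB0, hAB⟩ := spatialForm_bounds (by omega) (mul_nonneg hb ENNReal.toReal_nonneg) hmz
    (fun ξ hξ => norm_fst_le_of_mem_frequencySet hΩz hξ) hV hK hθ
  have e : bandRadius Ωz * embedConst N * (spaceDensity N z).toReal =
      embedConst N * (spaceDensity N z).toReal * bandRadius Ωz := by ring
  rw [e]
  set Az := spatialLower k d (embedConst N * (spaceDensity N z).toReal * bandRadius Ωz)
  set Bz := spatialUpper d (embedConst N * (spaceDensity N z).toReal * bandRadius Ωz)
  set η := 2 * (timeDensity t).toReal * bandRadius Ωt / Real.pi with hηdef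
  have hη0 : 0 ≤ η := by positivity
  have hA : 0 < (1 - η) ^ 2 * Az := mul_pos (pow_pos (sub_pos.2 hη) 2) hA0
  have hB : 0 < (1 + η) ^ 2 * Bz := by positivity
  have hw := fun (m : ℤ) (n : I) (α : Fin (d - 1) → ℕ) => weight_nonneg (N := N) (z := z) ht m n α
  have key : ∀ (f : Lp (α := SpaceTime d) ℂ 2 volume) (g : SpaceTime d → ℂ),
      BandFun (frequencySet Ωz Ωt) g → ∫⁻ ξ, ‖g ξ‖ₑ ^ 2 = ENNReal.ofReal (‖f‖ ^ 2) →
      (Summable fun i : ℤ × I × MultiIndex (d - 1) k => weight N z t i.1 i.2.1 i.2.2 *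
        ‖spatialDeriv i.2.2 (𝓕⁻ g) (point (z i.2.1) (t i.2.1 i.1))‖ ^ 2) ∧
      (1 - η) ^ 2 * Az * ‖f‖ ^ 2 ≤ ∑' i : ℤ × I × MultiIndex (d - 1) k,
        weight N z t i.1 i.2.1 i.2.2 *
          ‖spatialDeriv i.2.2 (𝓕⁻ g) (point (z i.2.1) (t i.2.1 i.1))‖ ^ 2 ∧
      ∑' i : ℤ × I × MultiIndex (d - 1) k, weight N z t i.1 i.2.1 i.2.2 *
          ‖spatialDeriv i.2.2 (𝓕⁻ g) (point (z i.2.1) (t i.2.1 i.1))‖ ^ 2 ≤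
        (1 + η) ^ 2 * Bz * ‖f‖ ^ 2 := by
    intro f g hg hgf
    obtain ⟨h1, h2⟩ := sampling_bounds (k := k) ht hV hδt'
      (fun ξ hξ => abs_snd_le_of_mem_frequencySet hΩt hξ) hmt hη.le hK hg
    obtain ⟨h3, h4⟩ := hAB g hg
    rw [hgf] at h3 h4
    have e2 : ∀ i : ℤ × I × MultiIndex (d - 1) k,
        ENNReal.ofReal (weight N z t i.1 i.2.1 i.2.2 *
          ‖spatialDeriv i.2.2 (𝓕⁻ g) (point (z i.2.1) (t i.2.1 i.1))‖ ^ 2) =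
        ENNReal.ofReal (weight N z t i.1 i.2.1 i.2.2) *
          ‖𝓕⁻ (fun ξ => spatialSymbol i.2.2.1 ξ • g ξ) (point (z i.2.1) (t i.2.1 i.1))‖ₑ ^ 2 := by
      intro i
      rw [ENNReal.ofReal_mul (hw _ _ _), ENNReal.ofReal_pow (norm_nonneg _), ofReal_norm,
        spatialDeriv_fourierInv hK hg]
    refine summable_and_bounds_of_ofReal (fun i => mul_nonneg (hw _ _ _) (by positivity))
      hA.le hB.le (by positivity) ?_ ?_ <;> simp_rw [e2]
    · rw [ENNReal.ofReal_mul (by positivity), mul_assoc]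
      exact le_trans (by gcongr) h1
    · rw [ENNReal.ofReal_mul (by positivity), mul_assoc]
      exact h2.trans (by gcongr)
  refine ⟨Az, Bz, hA0, hB0, le_rfl, le_rfl, fun f hf => ?_, ?_⟩
  · obtain ⟨g, hg, -, hgf, hn⟩ := exists_bandFun hΩz hΩt hf
    exact ⟨𝓕⁻ g, contDiff_fourierInv hK hg, hgf, key f g hg hn⟩
  · choose φ hφm hφ hφi using fun i : ℤ × I × MultiIndex (d - 1) k => exists_atom hΩz hΩt
      (Real.sqrt (weight N z t i.1 i.2.1 i.2.2)) i.2.2 (point (z i.2.1) (t i.2.1 i.1))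
    have hf : ∀ f : Lp (α := SpaceTime d) ℂ 2 volume, f ∈ bandlimited (productBand Ωz Ωt) →
        (Summable fun i => ‖inner ℂ (φ i) f‖ ^ 2) ∧
        (1 - η) ^ 2 * Az * ‖f‖ ^ 2 ≤ ∑' i, ‖inner ℂ (φ i) f‖ ^ 2 ∧
        ∑' i, ‖inner ℂ (φ i) f‖ ^ 2 ≤ (1 + η) ^ 2 * Bz * ‖f‖ ^ 2 := by
      intro f hfm
      obtain ⟨g, hg, hgf, -, hn⟩ := exists_bandFun hΩz hΩt hfm
      -- The squared analysis coefficients are the weighted squared samples, so the frame bounds are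
      -- the sampling bounds.
      have e3 : (fun i : ℤ × I × MultiIndex (d - 1) k => ‖inner ℂ (φ i) f‖ ^ 2) =
          fun i => weight N z t i.1 i.2.1 i.2.2 *
            ‖spatialDeriv i.2.2 (𝓕⁻ g) (point (z i.2.1) (t i.2.1 i.1))‖ ^ 2 := by
        funext i
        rw [hφi i f g hg hgf, mul_pow, sq_abs, Real.sq_sqrt (hw _ _ _)]
      have h := key f g hg hn
      rw [← e3] at h
      exact h
    exact ⟨fun i => ⟨φ i, hφm i⟩, hφ, hA, hB, fun f => (hf f f.2).1, fun f => (hf f f.2).2.1,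
      fun f => (hf f f.2).2.2⟩
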